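/- Let $G$ be a compact Lie group and $K\subset G$ a closed subgroup such that $G/K$ is connected and effective, with Lie algebras $\mathfrak k\subset\mathfrak g$. Let $\mathfrak g=\mathfrak k\oplus\mathfrak p$, where $\mathfrak p$ is orthogonal to $\mathfrak k$ for the Killing form $B$ of $\mathfrak g$, and suppose that $\mathfrak p=\mathfrak p_1\oplus\mathfrak p_2$ with $\mathfrak p_1,\mathfrak p_2$ irreducible and inequivalent $\mathrm{Ad}(K)$-representations. Suppose that there is an intermediate closed subgroup $K<H<G$ with Lie algebra $\mathfrak h=\mathfrak k\oplus\mathfrak p_1$. Let $Q$ be an $\mathrm{Ad}(K)$-invariant scalar product on $\mathfrak p$ whose restrictions to $\mathfrak p_1$ and to $\mathfrak p_2$ are negative multiples of $B$. Then the $G$-invariant Riemannian metrics on $G/K$ are $g=x_1Q|_{\mathfrak p_1}\oplus x_2Q|_{\mathfrak p_2}$ with $x_1,x_2>0$, and we write $y=x_1/x_2$. Suppose that $G/K$ carries, up to scaling, exactly two $G$-invariant Einstein metrics, and let $0<y_1<y_2$ be the corresponding values of $y$ (so $g$ is Einstein if and only if $y\in\{y_1,y_2\}$). Let $g_0$ be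 a $G$-invariant metric with $y(0)>y_2$. Then there is $T\in(0,\infty)$ and a solution $g(t)=x_1(t)Q|_{\mathfrak p_1}\oplus x_2(t)Q|_{\mathfrak p_2}$, $t\in[0,T)$, of the Ricci flow $\partial_t g=-2\,\mathrm{Ric}(g)$ with $g(0)=g_0$ such that: 1. $[0,T)$ is maximal: $|\mathrm{Rm}(g(t))|_{g(t)}$ is unbounded as $t\to T$, and every $G$-invariant solution on an interval $[0,T')$ with initial metric $g_0$ satisfies $T'\le T$ and agrees with $g(t)$ on $[0,T')$ (so the solution is unique); 2. as $t\to T$, $G/K$ shrinks to a point, that is, $x_1(t)\to0$ and $x_2(t)\to0$, and $y(t)=x_1(t)/x_2(t)\to y_2$. Moreover there is no ancient $G$-invariant solution with this initial metric: no solution $g(t)$ of the Ricci flow by $G$-invariant metrics is defined on an interval $(-\infty,T')$ with $T'>0$ and satisfies $g(0)=g_0$. -/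

import Mathlib

open Set Filter Topology
open scoped Manifold ContDiff

noncomputable section

/-! ### Curvature of an invariant metric on a reductive homogeneous space

For a reductive decomposition `𝔤 = 𝔨 ⊕ 𝔭`, the tangent space of `G/K` at the base point is `𝔭`, and
`G`-invariant tensors on `G/K` are the same thing as their values at the base point, i.e. as
`Ad(K)`-invariant tensors on `𝔭`.  The curvature at the base point is given by Nomizu's formulas. -/

namespace HomRicci

section Algebra

/-- A scalar product (positive definite symmetric bilinear form) on a real vector space. -/
structure ScalarProduct (V : Type*) [AddCommGroup V] [Module ℝ V] where
  form : LinearMap.BilinForm ℝ V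
  symm : ∀ X Y, form X Y = form Y X
  pos : ∀ X, X ≠ 0 → 0 < form X X

theorem ScalarProduct.nondegenerate {V : Type*} [AddCommGroup V] [Module ℝ V]
    (g : ScalarProduct V) : g.form.Nondegenerate := by
  constructor
  · intro X hX
    by_contra h
    exact (g.pos X h).ne' (hX X)
  · intro X hX
    by_contra h
    exact (g.pos X h).ne' (hX X)

variable {L : Type*} [LieRing L] [LieAlgebra ℝ L] {p k : Submodule ℝ L}

/-- The `𝔭`-component `[X, Y]_𝔭` of the bracket of `X, Y ∈ 𝔭`. -/
def brP (h : IsCompl p k) : p →ₗ[ℝ] p →ₗ[ℝ] p :=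
  LinearMap.mk₂ ℝ (fun X Y => p.projectionOnto k h ⁅(X : L), (Y : L)⁆)
    (by intros; simp) (by intros; simp) (by intros; simp) (by intros; simp)

/-- The isotropy term `[[X, Y]_𝔨, Z]` (projected to `𝔭`, where it lies in the reductive case). -/
def isotropyTerm (h : IsCompl p k) (X Y Z : p) : p :=
  p.projectionOnto k h ⁅(k.projectionOnto p h.symm ⁅(X : L), (Y : L)⁆ : L), (Z : L)⁆

variable [FiniteDimensional ℝ L]

/-- The functional `Z ↦ ½ (g([X,Y]_𝔭, Z) + g([Z,X]_𝔭, Y) + g([Z,Y]_𝔭, X))` of Koszul's formula. -/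
def koszul (h : IsCompl p k) (g : ScalarProduct p) : p →ₗ[ℝ] p →ₗ[ℝ] Module.Dual ℝ p :=
  LinearMap.mk₂ ℝ
    (fun X Y => (1 / 2 : ℝ) • (g.form (brP h X Y) + (g.form.flip Y) ∘ₗ ((brP h).flip X) +
      (g.form.flip X) ∘ₗ ((brP h).flip Y)))
    (by intros; ext; simp; ring) (by intros; ext; simp; ring)
    (by intros; ext; simp; ring) (by intros; ext; simp; ring)

/-- The Nomizu map `Λ(X)Y` of the Levi-Civita connection of the invariant metric `g`:
`g(Λ(X)Y, Z) = ½ (g([X,Y]_𝔭, Z) + g([Z,X]_𝔭, Y) + g([Z,Y]_𝔭, X))`. -/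
def nomizu (h : IsCompl p k) (g : ScalarProduct p) : p →ₗ[ℝ] p →ₗ[ℝ] p :=
  (koszul h g).compr₂ (LinearMap.BilinForm.toDual g.form g.nondegenerate).symm.toLinearMap

/-- The curvature tensor at the base point,
`R(X,Y)Z = Λ(X)Λ(Y)Z - Λ(Y)Λ(X)Z - Λ([X,Y]_𝔭)Z - [[X,Y]_𝔨, Z]`. -/
def curvature (h : IsCompl p k) (g : ScalarProduct p) (X Y Z : p) : p :=
  nomizu h g X (nomizu h g Y Z) - nomizu h g Y (nomizu h g X Z) - nomizu h g (brP h X Y) Z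
    - isotropyTerm h X Y Z

/-- The endomorphism `Z ↦ R(Z,X)Y`. -/
def curvatureEnd (h : IsCompl p k) (g : ScalarProduct p) (X Y : p) : p →ₗ[ℝ] p where
  toFun Z := curvature h g Z X Y
  map_add' Z Z' := by simp [curvature, isotropyTerm]; abel
  map_smul' c Z := by simp [curvature, isotropyTerm, smul_sub]

/-- The Ricci tensor `Ric(X,Y) = tr (Z ↦ R(Z,X)Y)`. -/
def ricci (h : IsCompl p k) (g : ScalarProduct p) (X Y : p) : ℝ :=
  LinearMap.trace ℝ p (curvatureEnd h g X Y)

/-- `g` is Einstein: `Ric(g) = c g` for a real constant `c`. -/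
def IsEinstein (h : IsCompl p k) (g : ScalarProduct p) : Prop :=
  ∃ c : ℝ, ∀ X Y, ricci h g X Y = c * g.form X Y

/-- `|Rm(g)| ≤ M`, where `|Rm(g)|` is the maximum of `|g(R(X,Y)Z,W)|` over vectors of `g`-length at
most one (a norm equivalent to the Euclidean norm of the curvature tensor, with constants which
depend on the dimension only; by homogeneity the base point suffices). -/
def CurvatureBoundedBy (h : IsCompl p k) (g : ScalarProduct p) (M : ℝ) : Prop :=
  ∀ X Y Z W : p, g.form X X ≤ 1 → g.form Y Y ≤ 1 → g.form Z Z ≤ 1 → g.form W W ≤ 1 →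
    |g.form (curvature h g X Y Z) W| ≤ M

end Algebra

/-! ### Lie groups, the isotropy representation and invariant metrics -/

section Group

variable {E : Type*} [NormedAddCommGroup E] [NormedSpace ℝ E]
  {G : Type*} [TopologicalSpace G] [ChartedSpace E G] [Group G]

instance [LieGroup 𝓘(ℝ, E) ∞ G] : LieGroup 𝓘(ℝ, E) (minSmoothness ℝ 3) G :=
  LieGroup.of_le (n := ∞) (by
    rw [minSmoothness_of_isRCLikeNormedField]
    exact ENat.LEInfty.out)

instance [FiniteDimensional ℝ E] : FiniteDimensional ℝ (GroupLieAlgebra 𝓘(ℝ, E) G) :=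
  inferInstanceAs (FiniteDimensional ℝ E)

/-- The adjoint representation: `Ad(a)` is the derivative at `1` of `x ↦ a x a⁻¹`. -/
def Ad (a : G) : GroupLieAlgebra 𝓘(ℝ, E) G →ₗ[ℝ] GroupLieAlgebra 𝓘(ℝ, E) G :=
  (mfderiv 𝓘(ℝ, E) 𝓘(ℝ, E) (fun x : G => a * x * a⁻¹) 1 : E →L[ℝ] E).toLinearMap

/-- The Lie algebra of a subgroup `K` of `G`, as a subspace of the Lie algebra of `G`: the initial
velocities of the smooth curves in `G` that start at `1` and stay in `K`. -/
def lieAlgebraOf (K : Subgroup G) : Submodule ℝ (GroupLieAlgebra 𝓘(ℝ, E) G) :=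
  Submodule.span ℝ {X | ∃ c : ℝ → G, ContMDiff 𝓘(ℝ, ℝ) 𝓘(ℝ, E) ∞ c ∧ c 0 = 1 ∧ (∀ t, c t ∈ K) ∧
    (mfderiv 𝓘(ℝ, ℝ) 𝓘(ℝ, E) c 0 : ℝ →L[ℝ] E) 1 = X}

/-- The subspace `V` is invariant under `Ad(K)`. -/
def IsAdInvariant (K : Subgroup G) (V : Submodule ℝ (GroupLieAlgebra 𝓘(ℝ, E) G)) : Prop :=
  ∀ a ∈ K, ∀ X ∈ V, Ad a X ∈ V

/-- `V` is an irreducible (real) representation of `K`. -/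
def IsAdIrreducible (K : Subgroup G) (V : Submodule ℝ (GroupLieAlgebra 𝓘(ℝ, E) G)) : Prop :=
  IsAdInvariant K V ∧ V ≠ ⊥ ∧ ∀ W ≤ V, IsAdInvariant K W → W = ⊥ ∨ W = V

/-- `V` and `W` are equivalent representations of `K`. -/
def AdEquivalent (K : Subgroup G) (V W : Submodule ℝ (GroupLieAlgebra 𝓘(ℝ, E) G)) : Prop :=
  ∃ φ : V ≃ₗ[ℝ] W, ∀ a ∈ K, ∀ X Y : V,
    (Y : GroupLieAlgebra 𝓘(ℝ, E) G) = Ad a (X : GroupLieAlgebra 𝓘(ℝ, E) G) →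
    (φ Y : GroupLieAlgebra 𝓘(ℝ, E) G) = Ad a (φ X : GroupLieAlgebra 𝓘(ℝ, E) G)

/-- An `Ad(K)`-invariant scalar product on `𝔭`, i.e. a `G`-invariant Riemannian metric on `G/K`. -/
structure InvariantMetric (K : Subgroup G) (p : Submodule ℝ (GroupLieAlgebra 𝓘(ℝ, E) G))
    extends ScalarProduct p where
  invariant : ∀ a ∈ K, ∀ X X' Y Y' : p,
    (X' : GroupLieAlgebra 𝓘(ℝ, E) G) = Ad a (X : GroupLieAlgebra 𝓘(ℝ, E) G) →
    (Y' : GroupLieAlgebra 𝓘(ℝ, E) G) = Ad a (Y : GroupLieAlgebra 𝓘(ℝ, E) G) →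
    form X' Y' = form X Y

/-- The compact connected effective homogeneous spaces `G/K` whose isotropy representation is a sum
`𝔭 = 𝔭₁ ⊕ 𝔭₂` of two inequivalent irreducible summands, with an intermediate Lie group
`K < H < G` whose Lie algebra is `𝔥 = 𝔨 ⊕ 𝔭₁`.  Here `𝔭` is a complement of `𝔨` in `𝔤` that is
orthogonal to `𝔨` for the Killing form of `𝔤`. -/
structure IsTwoSummandSpace [LieGroup 𝓘(ℝ, E) ∞ G] [CompleteSpace E] (K H : Subgroup G)
    (p₁ p₂ : Submodule ℝ (GroupLieAlgebra 𝓘(ℝ, E) G)) : Prop where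
  compact : CompactSpace G
  isClosed_K : IsClosed (K : Set G)
  connected : ConnectedSpace (G ⧸ K)
  effective : K.normalCore = ⊥
  disjoint : Disjoint p₁ p₂
  isCompl : IsCompl (p₁ ⊔ p₂) (lieAlgebraOf K)
  orthogonal : ∀ X ∈ p₁ ⊔ p₂, ∀ Z ∈ (lieAlgebraOf K : Submodule ℝ (GroupLieAlgebra 𝓘(ℝ, E) G)),
    killingForm ℝ (GroupLieAlgebra 𝓘(ℝ, E) G) X Z = 0
  irreducible₁ : IsAdIrreducible K p₁
  irreducible₂ : IsAdIrreducible K p₂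
  inequivalent : ¬ AdEquivalent K p₁ p₂
  isClosed_H : IsClosed (H : Set G)
  lt_H : K < H
  H_lt : H < ⊤
  lieAlgebra_H : (lieAlgebraOf H : Submodule ℝ (GroupLieAlgebra 𝓘(ℝ, E) G)) = lieAlgebraOf K ⊔ p₁

variable {K : Subgroup G} {p₁ p₂ : Submodule ℝ (GroupLieAlgebra 𝓘(ℝ, E) G)}

/-- The restrictions of `Q` to `𝔭₁` and to `𝔭₂` are negative multiples of the Killing form:
`-B = b₁ Q` on `𝔭₁` and `-B = b₂ Q` on `𝔭₂`, with `b₁, b₂ > 0`. -/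
def IsBackground [LieGroup 𝓘(ℝ, E) ∞ G] [CompleteSpace E]
    (Q : InvariantMetric K (p₁ ⊔ p₂)) : Prop :=
  ∃ b₁ b₂ : ℝ, 0 < b₁ ∧ 0 < b₂ ∧
    (∀ X Y : ↥(p₁ ⊔ p₂), (X : GroupLieAlgebra 𝓘(ℝ, E) G) ∈ p₁ →
      (Y : GroupLieAlgebra 𝓘(ℝ, E) G) ∈ p₁ →
      -killingForm ℝ (GroupLieAlgebra 𝓘(ℝ, E) G) X Y = b₁ * Q.form X Y) ∧
    (∀ X Y : ↥(p₁ ⊔ p₂), (X : GroupLieAlgebra 𝓘(ℝ, E) G) ∈ p₂ →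
      (Y : GroupLieAlgebra 𝓘(ℝ, E) G) ∈ p₂ →
      -killingForm ℝ (GroupLieAlgebra 𝓘(ℝ, E) G) X Y = b₂ * Q.form X Y)

/-- `g = x₁ Q|𝔭₁ ⊕ x₂ Q|𝔭₂` with `x₁, x₂ > 0`. -/
def IsDiagonal (Q g : InvariantMetric K (p₁ ⊔ p₂)) (x₁ x₂ : ℝ) : Prop :=
  0 < x₁ ∧ 0 < x₂ ∧
    (∀ X Y : ↥(p₁ ⊔ p₂), (X : GroupLieAlgebra 𝓘(ℝ, E) G) ∈ p₁ →
      (Y : GroupLieAlgebra 𝓘(ℝ, E) G) ∈ p₁ → g.form X Y = x₁ * Q.form X Y) ∧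
    (∀ X Y : ↥(p₁ ⊔ p₂), (X : GroupLieAlgebra 𝓘(ℝ, E) G) ∈ p₂ →
      (Y : GroupLieAlgebra 𝓘(ℝ, E) G) ∈ p₂ → g.form X Y = x₂ * Q.form X Y) ∧
    (∀ X Y : ↥(p₁ ⊔ p₂), (X : GroupLieAlgebra 𝓘(ℝ, E) G) ∈ p₁ →
      (Y : GroupLieAlgebra 𝓘(ℝ, E) G) ∈ p₂ → g.form X Y = 0)

variable [FiniteDimensional ℝ E] [LieGroup 𝓘(ℝ, E) ∞ G]
  {p : Submodule ℝ (GroupLieAlgebra 𝓘(ℝ, E) G)}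

/-- The family `g(t)` of `G`-invariant metrics solves the Ricci flow `∂g/∂t = -2 Ric(g)` on the
interval `J` (with one-sided derivatives at an endpoint that belongs to `J`). -/
def IsRicciFlowOn (h : IsCompl p (lieAlgebraOf K)) (g : ℝ → InvariantMetric K p) (J : Set ℝ) :
    Prop :=
  ∀ t ∈ J, ∀ X Y : p, HasDerivWithinAt (fun s => (g s).form X Y)
    (-2 * ricci h (g t).toScalarProduct X Y) J t

end Group

end HomRicci

end

/-!
By Schur's lemma every invariant metric is diagonal. Since `𝔨 ⊕ 𝔭₁` is a subalgebra, the Ricci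
tensor of `x₁ Q|𝔭₁ ⊕ x₂ Q|𝔭₂` is `(A + B y²) Q|𝔭₁ ⊕ (C - D y) Q|𝔭₂` with `B, D ≥ 0`, so that the
Einstein equation is a quadratic equation for `y` with roots `y₁ < y₂`, and the Ricci flow becomes
`y' = -2 a (y - y₁) (y - y₂) / x₂`, `x₂' = -2 (C - D y)` with `a = B + D`.

For `y > y₂` the quantity `r = (y - y₂) / (y - y₁)` satisfies `r' = -2 a (y₂ - y₁) r / x₂`, and
integrating `dx₂ / dr` gives `x₂ = c (1 - r) ^ θ * s` with `θ = D / a` and `s` a positive power of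
`r`. In terms of `s` the flow is `s' = -k / (c (1 - r) ^ θ)` with `k > 0`. The right-hand side is
bounded away from zero, so `s` vanishes at a finite time `T`, where `y = y₂` and `x₁ = x₂ = 0`.
A curvature bound `M` would imply `A ≤ dim 𝔭 * M * x₁`, so the curvature blows up.

An ancient solution starting above `y₂` stays above `y(0)` in backward time, and
`x₂(t) ≤ x₂(0) - 2 C t`. Hence the derivative of `-1 / (y - y₂)` is at most
`-2 a / (x₂(0) - 2 C t)`, whose integral diverges logarithmically as `t → -∞`, while
`-1 / (y - y₂)` stays bounded.
-/

noncomputable section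

namespace HomRicci

section MixedDerivative

variable {E F E' : Type*} [NormedAddCommGroup E] [NormedSpace ℝ E]
  [NormedAddCommGroup F] [NormedSpace ℝ F] [NormedAddCommGroup E'] [NormedSpace ℝ E']

theorem fderiv_apply_inr {m : E × F → E'} {a : E} {b : F} (hm : DifferentiableAt ℝ m (a, b))
    (Y : F) : fderiv ℝ m (a, b) (0, Y) = fderiv ℝ (fun w => m (a, w)) b Y := by
  have hslice : HasFDerivAt (fun w => m (a, w)) _ b :=
    hm.hasFDerivAt.comp b (hasFDerivAt_prodMk_right a b)
  rw [hslice.fderiv]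
  rfl

theorem fderiv_apply_inl {m : E × F → E'} {a : E} {b : F} (hm : DifferentiableAt ℝ m (a, b))
    (X : E) : fderiv ℝ m (a, b) (X, 0) = fderiv ℝ (fun u => m (u, b)) a X := by
  have hslice : HasFDerivAt (fun u => m (u, b)) _ a :=
    HasFDerivAt.comp (f := fun u => (u, b)) a hm.hasFDerivAt (hasFDerivAt_prodMk_left a b)
  rw [hslice.fderiv]
  rfl

theorem eventually_differentiableAt {f : E → F} {x : E} (hf : ContDiffAt ℝ 2 f x) :
    ∀ᶠ y in 𝓝 x, DifferentiableAt ℝ f y := by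
  filter_upwards [hf.eventually (by simp)] with y hy using hy.differentiableAt (by norm_num)

theorem hasFDerivAt_fderiv {f : E → F} {x : E} (hf : ContDiffAt ℝ 2 f x) :
    HasFDerivAt (fderiv ℝ f) (fderiv ℝ (fderiv ℝ f) x) x :=
  ((hf.fderiv_right (m := 1) (by norm_num)).differentiableAt (by norm_num)).hasFDerivAt

/-- The mixed second derivative `∂₁∂₂m` of a function of two variables, as a bilinear map. -/
def mixedDeriv (m : E × F → E') (q : E × F) : E →L[ℝ] F →L[ℝ] E' :=
  (fderiv ℝ (fderiv ℝ m) q).bilinearComp (.inl ℝ E F) (.inr ℝ E F)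

theorem hasFDerivAt_fderiv_apply_inr {m : E × F → E'} {a : E} {b : F}
    (hm : ContDiffAt ℝ 2 m (a, b)) (Y : F) :
    HasFDerivAt (fun u => fderiv ℝ m (u, b) (0, Y)) ((mixedDeriv m (a, b)).flip Y) a :=
  (HasFDerivAt.comp (f := fun u => (u, b)) a (hasFDerivAt_fderiv hm)
    (hasFDerivAt_prodMk_left a b)).clm_apply (hasFDerivAt_const ((0 : E), Y) a)
    |>.congr_fderiv (by ext; simp [mixedDeriv])

/-- The relation `m (C (u, w), u) = m (u, w)` says that `C (u, w) = u w u⁻¹` for the local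
multiplication `m`; differentiating it in `w` and then in `u` relates the two mixed derivatives. -/
theorem mixedDeriv_conj {m C : E × E → E} {e : E} (hm : ContDiffAt ℝ 2 m (e, e))
    (m_right : ∀ᶠ u in 𝓝 e, m (u, e) = u) (hC : ContDiffAt ℝ 2 C (e, e))
    (C_right : ∀ᶠ u in 𝓝 e, C (u, e) = e) (C_left : ∀ᶠ w in 𝓝 e, C (e, w) = w)
    (conj : ∀ᶠ q in 𝓝 (e, e), m (C q, q.1) = m q) (X Y : E) :
    mixedDeriv C (e, e) X Y = mixedDeriv m (e, e) X Y - mixedDeriv m (e, e) Y X := by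
  have left_nhds : Tendsto (fun u : E => (u, e)) (𝓝 e) (𝓝 (e, e)) :=
    (Continuous.prodMk_left e).tendsto e
  have right_nhds : Tendsto (fun u : E => (e, u)) (𝓝 e) (𝓝 (e, e)) :=
    (Continuous.prodMk_right e).tendsto e
  have fderiv_conj : ∀ᶠ u in 𝓝 e, fderiv ℝ m (e, u) (fderiv ℝ C (u, e) (0, Y), 0) =
      fderiv ℝ m (u, e) (0, Y) := by
    filter_upwards [conj.curry_nhds, C_right, left_nhds.eventually (eventually_differentiableAt hC),
      left_nhds.eventually (eventually_differentiableAt hm),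
      right_nhds.eventually (eventually_differentiableAt hm)] with u hu hCu hCd hml hmr
    have hC_slice : HasFDerivAt (fun w => C (u, w)) _ e :=
      hCd.hasFDerivAt.comp e (hasFDerivAt_prodMk_right u e)
    have hmC : HasFDerivAt m (fderiv ℝ m (e, u)) (C (u, e), u) := hCu.symm ▸ hmr.hasFDerivAt
    have h := (HasFDerivAt.comp (f := fun w => (C (u, w), u)) e hmC
      (hC_slice.prodMk (hasFDerivAt_const u e))).unique
      ((hml.hasFDerivAt.comp e (hasFDerivAt_prodMk_right u e)).congr_of_eventuallyEq hu)
    simpa using congrArg (fun L : E →L[ℝ] E => L Y) h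
  have C_inr : fderiv ℝ C (e, e) (0, Y) = Y := by
    rw [fderiv_apply_inr (hC.differentiableAt (by norm_num)),
      ((hasFDerivAt_id e).congr_of_eventuallyEq C_left).fderiv, ContinuousLinearMap.id_apply]
  have m_inl (Z : E) : fderiv ℝ m (e, e) (Z, 0) = Z := by
    rw [fderiv_apply_inl (hm.differentiableAt (by norm_num)),
      ((hasFDerivAt_id e).congr_of_eventuallyEq m_right).fderiv, ContinuousLinearMap.id_apply]
  have lhs := ((hasFDerivAt_fderiv hm).comp e (hasFDerivAt_prodMk_right e e)).clm_apply
    ((hasFDerivAt_fderiv_apply_inr hC Y).prodMk (hasFDerivAt_const (0 : E) e))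
  have hX := congrArg (fun L : E →L[ℝ] E => L X) (lhs.unique
    ((hasFDerivAt_fderiv_apply_inr hm Y).congr_of_eventuallyEq fderiv_conj))
  have hsymm : fderiv ℝ (fderiv ℝ m) (e, e) (0, X) (Y, 0) = mixedDeriv m (e, e) Y X :=
    (hm.isSymmSndFDerivAt (by simp)).eq (0, X) (Y, 0)
  simp only [Function.comp_apply, C_inr, add_apply, ContinuousLinearMap.comp_apply,
    ContinuousLinearMap.prod_apply, ContinuousLinearMap.flip_apply, zero_apply, m_inl,
    ContinuousLinearMap.inr_apply, hsymm] at hX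
  exact eq_sub_of_add_eq hX

end MixedDerivative

section Adjoint

open VectorField

variable {E : Type*} [NormedAddCommGroup E] [NormedSpace ℝ E]
  {G : Type*} [TopologicalSpace G] [ChartedSpace E G] [Group G] [LieGroup 𝓘(ℝ, E) ∞ G]

theorem contMDiff_conj₂ :
    ContMDiff (𝓘(ℝ, E).prod 𝓘(ℝ, E)) 𝓘(ℝ, E) ∞ fun q : G × G => q.1 * q.2 * q.1⁻¹ :=
  (contMDiff_fst.mul contMDiff_snd).mul contMDiff_fst.inv

theorem contMDiff_conj (a : G) : ContMDiff 𝓘(ℝ, E) 𝓘(ℝ, E) ∞ (MulAut.conj a) :=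
  contMDiff_conj₂.comp (contMDiff_const.prodMk contMDiff_id)

theorem mdifferentiableAt_conj (a x : G) :
    MDifferentiableAt 𝓘(ℝ, E) 𝓘(ℝ, E) (MulAut.conj a) x :=
  (contMDiff_conj a).mdifferentiable (by simp) x

theorem mdifferentiableAt_mul_left (a x : G) :
    MDifferentiableAt 𝓘(ℝ, E) 𝓘(ℝ, E) (a * ·) x :=
  (contMDiff_mul_left (n := ∞)).mdifferentiable (by simp) x

theorem Ad_mul (a b : G) (X : GroupLieAlgebra 𝓘(ℝ, E) G) : Ad (a * b) X = Ad a (Ad b X) := by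
  have hcomp := mfderiv_comp_apply_of_eq 1 (mdifferentiableAt_conj (E := E) a 1)
    (mdifferentiableAt_conj b 1) (map_one (MulAut.conj b)) X
  rwa [← MulAut.coe_mul, ← map_mul] at hcomp

omit [LieGroup 𝓘(ℝ, E) ∞ G] in
theorem Ad_one (X : GroupLieAlgebra 𝓘(ℝ, E) G) : Ad (1 : G) X = X := by
  have hid : (fun x : G => 1 * x * 1⁻¹) = id := by ext; simp
  rw [Ad, hid, mfderiv_id]
  rfl

theorem Ad_inv_Ad (a : G) (X : GroupLieAlgebra 𝓘(ℝ, E) G) : Ad a⁻¹ (Ad a X) = X := by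
  rw [← Ad_mul, inv_mul_cancel, Ad_one]

theorem Ad_Ad_inv (a : G) (X : GroupLieAlgebra 𝓘(ℝ, E) G) : Ad a (Ad a⁻¹ X) = X := by
  rw [← Ad_mul, mul_inv_cancel, Ad_one]

variable (E) in
/-- Conjugation by `a` as a diffeomorphism of the Lie group. -/
def conjDiffeomorph (a : G) : G ≃ₘ⟮𝓘(ℝ, E), 𝓘(ℝ, E)⟯ G where
  toEquiv := (MulAut.conj a).toEquiv
  contMDiff_toFun := contMDiff_conj a
  contMDiff_invFun := by
    have hsymm : ((MulAut.conj a).toEquiv.symm : G → G) = MulAut.conj a⁻¹ := by ext; simp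
    exact hsymm ▸ contMDiff_conj a⁻¹

theorem isInvertible_mfderiv_conj (a g : G) :
    (mfderiv 𝓘(ℝ, E) 𝓘(ℝ, E) (MulAut.conj a) g).IsInvertible :=
  ⟨(conjDiffeomorph E a).mfderivToContinuousLinearEquiv (by simp) g, rfl⟩

theorem mpullback_conj_mulInvariantVectorField (a : G) (X : GroupLieAlgebra 𝓘(ℝ, E) G) :
    mpullback 𝓘(ℝ, E) 𝓘(ℝ, E) (MulAut.conj a) (mulInvariantVectorField (Ad a X)) =
      mulInvariantVectorField X := by
  ext g
  rw [mpullback_apply, (isInvertible_mfderiv_conj a g).inverse_apply_eq]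
  have hcomm : (MulAut.conj a ∘ (g * ·) : G → G) = (MulAut.conj a g * ·) ∘ MulAut.conj a :=
    funext fun x => map_mul (MulAut.conj a) g x
  have hleft := mfderiv_comp_apply_of_eq 1 (mdifferentiableAt_conj (E := E) a g)
    (mdifferentiableAt_mul_left g 1) (mul_one g) X
  have hright := mfderiv_comp_apply_of_eq 1
    (mdifferentiableAt_mul_left (E := E) (MulAut.conj a g) 1) (mdifferentiableAt_conj a 1)
    (map_one (MulAut.conj a)) X
  rw [hcomm] at hleft
  exact hright.symm.trans hleft

omit [LieGroup 𝓘(ℝ, E) ∞ G] in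
theorem mulInvariantVectorField_one (X : GroupLieAlgebra 𝓘(ℝ, E) G) :
    mulInvariantVectorField X (1 : G) = X := by
  have hid : (fun x : G => 1 * x) = id := by ext; simp
  rw [mulInvariantVectorField, hid, mfderiv_id]
  rfl

theorem Ad_lie [CompleteSpace E] (a : G) (X Y : GroupLieAlgebra 𝓘(ℝ, E) G) :
    Ad a ⁅X, Y⁆ = ⁅Ad a X, Ad a Y⁆ := by
  have hpull := congrFun (mpullback_conj_mulInvariantVectorField a (Ad a⁻¹ ⁅Ad a X, Ad a Y⁆)) 1
  rw [Ad_Ad_inv, GroupLieAlgebra.bracket_def, mulInvariantVector_mlieBracket,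
    mpullback_mlieBracket (n := ∞), mpullback_conj_mulInvariantVectorField,
    mpullback_conj_mulInvariantVectorField, mulInvariantVectorField_one,
    ← GroupLieAlgebra.bracket_def, ← GroupLieAlgebra.bracket_def] at hpull
  · rw [hpull, Ad_Ad_inv]
  · exact mdifferentiableAt_mulInvariantVectorField _
  · exact mdifferentiableAt_mulInvariantVectorField _
  · exact (contMDiff_conj a).contMDiffAt
  · rw [minSmoothness_of_isRCLikeNormedField]
    exact ENat.LEInfty.out

end Adjoint

section ChartAtOne

open VectorField

variable {E : Type*} [NormedAddCommGroup E] [NormedSpace ℝ E]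
  {G : Type*} [TopologicalSpace G] [ChartedSpace E G] [Group G]

variable (E G) in
/-- The preferred chart of a Lie group at the identity. -/
abbrev oneChart : PartialEquiv G E := extChartAt 𝓘(ℝ, E) (1 : G)

/-- The map `f : G × G → G` read in the preferred chart at the identity. -/
def inOneChart (f : G × G → G) (q : E × E) : E :=
  oneChart E G (f ((oneChart E G).symm q.1, (oneChart E G).symm q.2))

theorem oneChart_symm_one : (oneChart E G).symm (oneChart E G 1) = 1 :=
  extChartAt_to_inv (1 : G)

theorem eventually_mem_target : ∀ᶠ u in 𝓝 (oneChart E G 1), u ∈ (oneChart E G).target :=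
  extChartAt_target_mem_nhds (1 : G)

theorem eventually_mem_source : ∀ᶠ g in 𝓝 (1 : G), g ∈ (oneChart E G).source :=
  extChartAt_source_mem_nhds (1 : G)

theorem tendsto_symm_fst_snd : Tendsto (fun q : E × E => ((oneChart E G).symm q.1,
    (oneChart E G).symm q.2)) (𝓝 (oneChart E G 1, oneChart E G 1)) (𝓝 (1, 1)) := by
  have hsymm : Tendsto (oneChart E G).symm (𝓝 (oneChart E G 1)) (𝓝 1) := by
    simpa only [ContinuousAt, extChartAt_to_inv] using
      continuousAt_extChartAt_symm (I := 𝓘(ℝ, E)) (1 : G)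
  rw [nhds_prod_eq, nhds_prod_eq]
  exact hsymm.prodMap hsymm

theorem inOneChart_one_left {f : G × G → G} (hf : ∀ x, f (1, x) = x) :
    ∀ᶠ w in 𝓝 (oneChart E G 1), inOneChart f (oneChart E G 1, w) = w := by
  filter_upwards [eventually_mem_target] with w hw
  rw [inOneChart, oneChart_symm_one, hf, (oneChart E G).right_inv hw]

theorem inOneChart_one_right {f : G × G → G} (hf : ∀ x, f (x, 1) = x) :
    ∀ᶠ u in 𝓝 (oneChart E G 1), inOneChart f (u, oneChart E G 1) = u := by
  filter_upwards [eventually_mem_target] with u hu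
  rw [inOneChart, oneChart_symm_one, hf, (oneChart E G).right_inv hu]

variable [LieGroup 𝓘(ℝ, E) ∞ G]

theorem contDiffAt_inOneChart {f : G × G → G}
    (hf : ContMDiffAt (𝓘(ℝ, E).prod 𝓘(ℝ, E)) 𝓘(ℝ, E) ∞ f (1, 1)) (hf1 : f (1, 1) = 1) :
    ContDiffAt ℝ 2 (inOneChart f) (oneChart E G 1, oneChart E G 1) := by
  have : IsManifold 𝓘(ℝ, E) ∞ G := inferInstance
  have hsymm : ContMDiffAt 𝓘(ℝ, E) 𝓘(ℝ, E) ∞ (oneChart E G).symm (oneChart E G 1) :=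
    (contMDiffOn_extChartAt_symm (1 : G)).contMDiffAt (extChartAt_target_mem_nhds (1 : G))
  have hpair : ContMDiffAt 𝓘(ℝ, E × E) (𝓘(ℝ, E).prod 𝓘(ℝ, E)) ∞
      (fun q : E × E => ((oneChart E G).symm q.1, (oneChart E G).symm q.2))
      (oneChart E G 1, oneChart E G 1) :=
    (hsymm.comp (oneChart E G 1, oneChart E G 1) contDiff_fst.contMDiff.contMDiffAt).prodMk
      (hsymm.comp (oneChart E G 1, oneChart E G 1) contDiff_snd.contMDiff.contMDiffAt)
  have hf_pair := hf.comp_of_eq hpair (by simp only [oneChart_symm_one])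
  have hchart : ContMDiffAt 𝓘(ℝ, E) 𝓘(ℝ, E) ∞ (oneChart E G) 1 := contMDiffAt_extChartAt
  exact (hchart.comp_of_eq hf_pair (by simp only [Function.comp, oneChart_symm_one, hf1])
    ).contDiffAt.of_le ENat.LEInfty.out

theorem contDiffAt_inOneChart_mul : ContDiffAt ℝ 2 (inOneChart fun q : G × G => q.1 * q.2)
    (oneChart E G 1, oneChart E G 1) :=
  contDiffAt_inOneChart (contMDiff_mul 𝓘(ℝ, E) ∞).contMDiffAt (one_mul 1)

theorem contDiffAt_inOneChart_conj :
    ContDiffAt ℝ 2 (inOneChart fun q : G × G => q.1 * q.2 * q.1⁻¹)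
      (oneChart E G 1, oneChart E G 1) :=
  contDiffAt_inOneChart contMDiff_conj₂.contMDiffAt (by simp)

omit [LieGroup 𝓘(ℝ, E) ∞ G] in
theorem mfderiv_one_eq_fderiv {φ : G → E} (hφ : MDifferentiableAt 𝓘(ℝ, E) 𝓘(ℝ, E) φ 1) :
    mfderiv 𝓘(ℝ, E) 𝓘(ℝ, E) φ 1 = fderiv ℝ (φ ∘ (oneChart E G).symm) (oneChart E G 1) := by
  refine (if_pos hφ).trans ?_
  simp only [writtenInExtChartAt, modelWithCornersSelf_coe, range_id, fderivWithin_univ]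
  rfl

theorem eventually_differentiableAt_prodMk {m : E × E → E} {a b : E}
    (hm : ContDiffAt ℝ 2 m (a, b)) : ∀ᶠ u in 𝓝 a, DifferentiableAt ℝ m (u, b) :=
  ((Continuous.prodMk_left b).tendsto a).eventually (eventually_differentiableAt hm)

theorem mpullbackWithin_oneChart_symm_mulInvariantVectorField (X : GroupLieAlgebra 𝓘(ℝ, E) G) :
    ∀ᶠ u in 𝓝 (oneChart E G 1),
      mpullbackWithin 𝓘(ℝ, E) 𝓘(ℝ, E) (oneChart E G).symm (mulInvariantVectorField X)
        (range 𝓘(ℝ, E)) u =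
      fderiv ℝ (inOneChart fun q : G × G => q.1 * q.2) (u, oneChart E G 1) (0, X) := by
  have : IsManifold 𝓘(ℝ, E) 1 G := IsManifold.of_le (n := ∞) ENat.LEInfty.out
  filter_upwards [eventually_mem_target,
    eventually_differentiableAt_prodMk contDiffAt_inOneChart_mul] with u hu hmu
  have hinv : (mfderivWithin 𝓘(ℝ, E) 𝓘(ℝ, E) (oneChart E G).symm (range 𝓘(ℝ, E)) u).inverse =
      mfderiv 𝓘(ℝ, E) 𝓘(ℝ, E) (oneChart E G) ((oneChart E G).symm u) :=
    ContinuousLinearMap.inverse_eq (mfderivWithin_extChartAt_symm_comp_mfderiv_extChartAt hu)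
      (mfderiv_extChartAt_comp_mfderivWithin_extChartAt_symm hu)
  have hsource := (oneChart E G).map_target hu
  rw [extChartAt_source] at hsource
  set g := (oneChart E G).symm u
  have hg : MDifferentiableAt 𝓘(ℝ, E) 𝓘(ℝ, E) (oneChart E G) g :=
    mdifferentiableAt_extChartAt hsource
  have hcomp := mfderiv_comp_apply_of_eq 1 hg (mdifferentiableAt_mul_left g 1) (mul_one g) X
  have hslice : mfderiv 𝓘(ℝ, E) 𝓘(ℝ, E) (oneChart E G ∘ (g * ·)) 1 =
      fderiv ℝ (fun w => inOneChart (fun q : G × G => q.1 * q.2) (u, w)) (oneChart E G 1) :=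
    mfderiv_one_eq_fderiv (hg.comp_of_eq 1 (mdifferentiableAt_mul_left g 1) (mul_one g))
  rw [mpullbackWithin_apply, hinv]
  exact hcomp.symm.trans ((congrArg (fun L : E →L[ℝ] E => L X) hslice).trans
    (fderiv_apply_inr hmu X).symm)

theorem lie_eq_mixedDeriv_mul (X Y : GroupLieAlgebra 𝓘(ℝ, E) G) :
    (⁅X, Y⁆ : GroupLieAlgebra 𝓘(ℝ, E) G) =
      mixedDeriv (inOneChart fun q : G × G => q.1 * q.2) (oneChart E G 1, oneChart E G 1) X Y -
        mixedDeriv (inOneChart fun q : G × G => q.1 * q.2)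
          (oneChart E G 1, oneChart E G 1) Y X := by
  have : IsManifold 𝓘(ℝ, E) 1 G := IsManifold.of_le (n := ∞) ENat.LEInfty.out
  have hfield := mpullbackWithin_oneChart_symm_mulInvariantVectorField (E := E) (G := G)
  have hderiv (Z : E) := (hasFDerivAt_fderiv_apply_inr contDiffAt_inOneChart_mul Z
    ).congr_of_eventuallyEq (hfield Z)
  have hvalue (Z : E) := (hfield Z).self_of_nhds.trans
    ((fderiv_apply_inr (contDiffAt_inOneChart_mul.differentiableAt (by norm_num)) Z).trans
      (congrArg (fun L : E →L[ℝ] E => L Z)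
        ((hasFDerivAt_id _).congr_of_eventuallyEq (inOneChart_one_left one_mul)).fderiv))
  have hchart : (mfderiv 𝓘(ℝ, E) 𝓘(ℝ, E) (oneChart E G) (1 : G)).inverse =
      ContinuousLinearMap.id ℝ E :=
    (congrArg (ContinuousLinearMap.inverse (R := ℝ) (M := E) (M₂ := E))
      mfderiv_extChartAt_self).trans ContinuousLinearMap.inverse_id
  simp only [modelWithCornersSelf_coe, range_id] at hvalue hderiv
  rw [GroupLieAlgebra.bracket_def, mlieBracket, mlieBracketWithin_apply]
  refine (congrArg (fun L : E →L[ℝ] E => L _) hchart).trans ?_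
  simp only [modelWithCornersSelf_coe, range_id, preimage_univ, univ_inter]
  refine (congrFun (lieBracketWithin_univ (𝕜 := ℝ) (E := E)) (oneChart E G 1)).trans ?_
  exact (congrArg₂ (fun a b : E => a - b)
    (congrArg₂ (fun (L : E →L[ℝ] E) (v : E) => L v) (hderiv Y).fderiv (hvalue X))
    (congrArg₂ (fun (L : E →L[ℝ] E) (v : E) => L v) (hderiv X).fderiv (hvalue Y))).trans rfl

theorem mixedDeriv_conj_eq_lie (X Y : GroupLieAlgebra 𝓘(ℝ, E) G) :
    mixedDeriv (inOneChart fun q : G × G => q.1 * q.2 * q.1⁻¹)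
        (oneChart E G 1, oneChart E G 1) X Y =
      (⁅X, Y⁆ : GroupLieAlgebra 𝓘(ℝ, E) G) := by
  refine (mixedDeriv_conj (E := E) contDiffAt_inOneChart_mul (inOneChart_one_right mul_one)
    contDiffAt_inOneChart_conj (Eventually.of_forall fun u => ?_) (inOneChart_one_left (by simp))
    ?_ X Y).trans (lie_eq_mixedDeriv_mul X Y).symm
  · simp only [inOneChart, oneChart_symm_one, mul_one, mul_inv_cancel]
  · have tendsto_conj : Tendsto (fun q : G × G => q.1 * q.2 * q.1⁻¹) (𝓝 (1, 1)) (𝓝 1) := by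
      simpa using (contMDiff_conj₂ (E := E) (G := G)).continuous.tendsto (1, 1)
    filter_upwards [(tendsto_conj.comp tendsto_symm_fst_snd).eventually
      (eventually_mem_source (E := E))] with q hq
    simp only [Function.comp_apply] at hq
    simp only [inOneChart]
    rw [(oneChart E G).left_inv hq, inv_mul_cancel_right]

theorem Ad_eq_fderiv_inOneChart_conj : ∀ᶠ g in 𝓝 (1 : G), ∀ Y : E,
    Ad g Y = fderiv ℝ (inOneChart fun q : G × G => q.1 * q.2 * q.1⁻¹)
      (oneChart E G g, oneChart E G 1) (0, Y) := by
  filter_upwards [eventually_mem_source (E := E) (G := G),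
    (continuousAt_extChartAt (I := 𝓘(ℝ, E)) (1 : G)).eventually
      (eventually_differentiableAt_prodMk contDiffAt_inOneChart_conj)] with g hg hd Y
  have chart_one : MDifferentiableAt 𝓘(ℝ, E) 𝓘(ℝ, E) (oneChart E G) 1 :=
    mdifferentiableAt_extChartAt (mem_chart_source E (1 : G))
  have conj_one : g * 1 * g⁻¹ = 1 := by rw [mul_one, mul_inv_cancel]
  have hcomp := mfderiv_comp_apply_of_eq 1 chart_one (mdifferentiableAt_conj g 1) conj_one Y
  have hslice : mfderiv 𝓘(ℝ, E) 𝓘(ℝ, E) (oneChart E G ∘ MulAut.conj g) 1 =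
      fderiv ℝ (fun w => inOneChart (fun q : G × G => q.1 * q.2 * q.1⁻¹) (oneChart E G g, w))
        (oneChart E G 1) := by
    refine (mfderiv_one_eq_fderiv (chart_one.comp_of_eq 1 (mdifferentiableAt_conj g 1)
      conj_one)).trans (congrArg (fderiv ℝ · _) (funext fun w => ?_))
    simp only [inOneChart, (oneChart E G).left_inv hg]
    rfl
  have hid : mfderiv 𝓘(ℝ, E) 𝓘(ℝ, E) (oneChart E G) (1 : G) = ContinuousLinearMap.id ℝ E :=
    mfderiv_extChartAt_self
  exact ((congrArg (fun L : E →L[ℝ] E => L (Ad g Y)) hid).symm.trans hcomp.symm).trans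
    ((congrArg (fun L : E →L[ℝ] E => L Y) hslice).trans (fderiv_apply_inr hd Y).symm)

omit [LieGroup 𝓘(ℝ, E) ∞ G] in
theorem hasDerivAt_oneChart_comp {c : ℝ → G} (hc : MDifferentiableAt 𝓘(ℝ, ℝ) 𝓘(ℝ, E) c 0)
    (hc0 : c 0 = 1) :
    HasDerivAt (fun t => oneChart E G (c t)) ((mfderiv 𝓘(ℝ, ℝ) 𝓘(ℝ, E) c 0 : ℝ →L[ℝ] E) 1) 0 := by
  have h := hc.hasMFDerivAt.2
  simp only [writtenInExtChartAt, hc0] at h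
  simp only [modelWithCornersSelf_coe, range_id] at h
  exact HasFDerivAt.hasDerivAt (hasFDerivWithinAt_univ.1 h)

theorem hasDerivAt_Ad {c : ℝ → G} (hc : ContMDiff 𝓘(ℝ, ℝ) 𝓘(ℝ, E) ∞ c)
    (hc0 : c 0 = 1) {X : GroupLieAlgebra 𝓘(ℝ, E) G}
    (hX : (mfderiv 𝓘(ℝ, ℝ) 𝓘(ℝ, E) c 0 : ℝ →L[ℝ] E) 1 = X) (Y : GroupLieAlgebra 𝓘(ℝ, E) G) :
    HasDerivAt (F := E) (fun t => Ad (E := E) (c t) Y) (⁅X, Y⁆ : GroupLieAlgebra 𝓘(ℝ, E) G) 0 := by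
  have hchart : HasDerivAt (F := E) (fun t => oneChart E G (c t)) X 0 :=
    hX ▸ hasDerivAt_oneChart_comp (hc.contMDiffAt.mdifferentiableAt (by simp)) hc0
  have hpartial := hasFDerivAt_fderiv_apply_inr
    (contDiffAt_inOneChart_conj (E := E) (G := G)) Y
  have hnear : Tendsto c (𝓝 0) (𝓝 1) := by simpa only [hc0] using hc.continuous.tendsto 0
  have hAd := (hpartial.comp_hasDerivAt_of_eq (0 : ℝ) hchart (by rw [hc0])).congr_of_eventuallyEq
    ((hnear.eventually (Ad_eq_fderiv_inOneChart_conj (E := E))).mono fun t ht => ht Y)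
  exact hAd.congr_deriv (mixedDeriv_conj_eq_lie X Y)

end ChartAtOne

section AdInvariance

section Derivatives

variable {V : Type*} [NormedAddCommGroup V] [NormedSpace ℝ V] [FiniteDimensional ℝ V]

theorem deriv_mem_submodule (W : Submodule ℝ V) {f : ℝ → V} {f' : V} {t : ℝ}
    (hf : HasDerivAt f f' t) (hW : ∀ s, f s ∈ W) : f' ∈ W := by
  refine W.closed_of_finiteDimensional.mem_of_tendsto hf.tendsto_slope
    (Eventually.of_forall fun s => ?_)
  rw [slope_def_module]
  exact W.smul_mem _ (W.sub_mem (hW s) (hW t))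

theorem hasDerivAt_bilin (f : LinearMap.BilinForm ℝ V) {u v : ℝ → V} {u' v' : V} {t : ℝ}
    (hu : HasDerivAt u u' t) (hv : HasDerivAt v v' t) :
    HasDerivAt (fun s => f (u s) (v s)) (f u' (v t) + f (u t) v') t := by
  let F : V →L[ℝ] V →L[ℝ] ℝ :=
    LinearMap.toContinuousLinearMap (LinearMap.toContinuousLinearMap.toLinearMap ∘ₗ f)
  have hF := (F.hasFDerivAt.comp_hasDerivAt t hu).clm_apply hv
  exact hF

end Derivatives

variable {E : Type*} [NormedAddCommGroup E] [NormedSpace ℝ E]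
  {G : Type*} [TopologicalSpace G] [ChartedSpace E G] [Group G] [LieGroup 𝓘(ℝ, E) ∞ G]
  {K : Subgroup G} {V W p : Submodule ℝ (GroupLieAlgebra 𝓘(ℝ, E) G)}

theorem isAdInvariant_lieAlgebraOf : IsAdInvariant K (lieAlgebraOf (E := E) K) := by
  intro a ha
  refine (Submodule.span_le (p := (lieAlgebraOf (E := E) K).comap (Ad a))).2 ?_
  rintro X ⟨c, hc, hc0, hcK, rfl⟩
  refine Submodule.subset_span ⟨fun t => MulAut.conj a (c t), (contMDiff_conj a).comp hc, ?_,
    fun t => K.mul_mem (K.mul_mem ha (hcK t)) (K.inv_mem ha), ?_⟩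
  · simp only [hc0, map_one]
  · exact mfderiv_comp_apply_of_eq 0 (mdifferentiableAt_conj a 1)
      (hc.contMDiffAt.mdifferentiableAt (by simp)) hc0 (1 : ℝ)

omit [LieGroup 𝓘(ℝ, E) ∞ G] in
theorem IsAdInvariant.sup (hV : IsAdInvariant K V) (hW : IsAdInvariant K W) :
    IsAdInvariant K (V ⊔ W) := by
  intro a ha X hX
  obtain ⟨Y, hY, Z, hZ, rfl⟩ := Submodule.mem_sup.1 hX
  rw [map_add]
  exact Submodule.add_mem_sup (hV a ha Y hY) (hW a ha Z hZ)

theorem lieAlgebraOf_induction {P : GroupLieAlgebra 𝓘(ℝ, E) G → Prop}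
    (curve : ∀ (X : GroupLieAlgebra 𝓘(ℝ, E) G) (c : ℝ → G), (∀ t, c t ∈ K) → c 0 = 1 →
      (∀ Y : GroupLieAlgebra 𝓘(ℝ, E) G, HasDerivAt (F := E) (fun t => Ad (E := E) (c t) Y)
        (⁅X, Y⁆ : GroupLieAlgebra 𝓘(ℝ, E) G) 0) → P X)
    (zero : P 0) (add : ∀ X Y, P X → P Y → P (X + Y)) (smul : ∀ (r : ℝ) X, P X → P (r • X))
    {X : GroupLieAlgebra 𝓘(ℝ, E) G} (hX : X ∈ lieAlgebraOf K) : P X := by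
  induction hX using Submodule.span_induction with
  | mem X hX =>
    obtain ⟨c, hc, hc0, hcK, hcX⟩ := hX
    exact curve X c hcK hc0 fun Y => hasDerivAt_Ad hc hc0 hcX Y
  | zero => exact zero
  | add X Y _ _ hX hY => exact add X Y hX hY
  | smul r X _ hX => exact smul r X hX

variable [CompleteSpace E]

/-- `Ad(a)` as an automorphism of the Lie algebra, to transport the Killing form. -/
def AdEquiv (a : G) : GroupLieAlgebra 𝓘(ℝ, E) G ≃ₗ⁅ℝ⁆ GroupLieAlgebra 𝓘(ℝ, E) G where
  toLinearMap := Ad a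
  map_lie' {X Y} := Ad_lie a X Y
  invFun := Ad a⁻¹
  left_inv := Ad_inv_Ad a
  right_inv := Ad_Ad_inv a

theorem killingForm_Ad (a : G) (X Y : GroupLieAlgebra 𝓘(ℝ, E) G) :
    killingForm ℝ (GroupLieAlgebra 𝓘(ℝ, E) G) (Ad a X) (Ad a Y) =
      killingForm ℝ (GroupLieAlgebra 𝓘(ℝ, E) G) X Y :=
  LieAlgebra.killingForm_of_equiv_apply (AdEquiv a) X Y

variable [FiniteDimensional ℝ E]

theorem IsAdInvariant.lie_mem (hW : IsAdInvariant K W) {X Y : GroupLieAlgebra 𝓘(ℝ, E) G}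
    (hX : X ∈ lieAlgebraOf K) (hY : Y ∈ W) : ⁅X, Y⁆ ∈ W := by
  refine lieAlgebraOf_induction (P := (⁅·, Y⁆ ∈ W)) ?_ ?_ ?_ ?_ hX
  · intro X c hcK _ hderiv
    exact deriv_mem_submodule (V := E) W (hderiv Y) fun s => hW _ (hcK s) Y hY
  · simp only [zero_lie, W.zero_mem]
  · intro X X' hX hX'
    simpa only [add_lie] using W.add_mem hX hX'
  · intro r X hX
    simpa only [smul_lie] using W.smul_mem r hX

theorem bilinForm_lie_skew (f : LinearMap.BilinForm ℝ (GroupLieAlgebra 𝓘(ℝ, E) G))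
    {X Y Z : GroupLieAlgebra 𝓘(ℝ, E) G} (hf : ∀ a ∈ K, f (Ad a X) (Ad a Y) = f X Y)
    (hZ : Z ∈ lieAlgebraOf K) : f ⁅Z, X⁆ Y + f X ⁅Z, Y⁆ = 0 := by
  refine lieAlgebraOf_induction (P := fun Z => f ⁅Z, X⁆ Y + f X ⁅Z, Y⁆ = 0) ?_ ?_ ?_ ?_ hZ
  · intro Z c hcK hc0 hderiv
    have hprod := hasDerivAt_bilin (V := E) f (hderiv X) (hderiv Y)
    have hconst : (fun s => f (Ad (c s) X) (Ad (c s) Y)) = fun _ => f X Y :=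
      funext fun s => hf _ (hcK s)
    have := hprod.unique (hconst ▸ hasDerivAt_const (0 : ℝ) (f X Y))
    rwa [hc0, Ad_one, Ad_one] at this
  · simp only [zero_lie, map_zero, LinearMap.zero_apply, add_zero]
  · intro Z Z' hZ hZ'
    simp only [add_lie, map_add, LinearMap.add_apply]
    linear_combination hZ + hZ'
  · intro r Z hZ
    simp only [smul_lie, map_smul, LinearMap.smul_apply, smul_eq_mul]
    linear_combination r * hZ

theorem InvariantMetric.skew (hp : IsAdInvariant K p) (g : InvariantMetric K p)
    {Z : GroupLieAlgebra 𝓘(ℝ, E) G} (hZ : Z ∈ lieAlgebraOf K) (X Y X' Y' : p)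
    (hX' : (X' : GroupLieAlgebra 𝓘(ℝ, E) G) = ⁅Z, (X : GroupLieAlgebra 𝓘(ℝ, E) G)⁆)
    (hY' : (Y' : GroupLieAlgebra 𝓘(ℝ, E) G) = ⁅Z, (Y : GroupLieAlgebra 𝓘(ℝ, E) G)⁆) :
    g.form X' Y + g.form X Y' = 0 := by
  obtain ⟨q, hq⟩ := p.exists_isCompl
  let f : LinearMap.BilinForm ℝ (GroupLieAlgebra 𝓘(ℝ, E) G) :=
    g.form.compl₁₂ (p.projectionOnto q hq) (p.projectionOnto q hq)
  have hf (U U' : p) : f U U' = g.form U U' := by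
    simp only [f, LinearMap.compl₁₂_apply, Submodule.projectionOnto_apply_left]
  have invariant (a : G) (ha : a ∈ K) : f (Ad a X) (Ad a Y) = f X Y :=
    (hf ⟨_, hp a ha X X.2⟩ ⟨_, hp a ha Y Y.2⟩).trans
      ((g.invariant a ha X _ Y _ rfl rfl).trans (hf X Y).symm)
  have := bilinForm_lie_skew f invariant hZ
  rwa [← hX', ← hY', hf, hf] at this

end AdInvariance

section Trace

namespace ScalarProduct

variable {V : Type*} [AddCommGroup V] [Module ℝ V] (g : ScalarProduct V)

theorem nonneg (X : V) : 0 ≤ g.form X X := by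
  rcases eq_or_ne X 0 with rfl | hX
  · rw [map_zero]
  · exact (g.pos X hX).le

theorem eq_of_form_eq {X Y : V} (hXY : ∀ Z, g.form X Z = g.form Y Z) : X = Y := by
  by_contra hne
  refine (g.pos (X - Y) (sub_ne_zero.2 hne)).ne' ?_
  rw [map_sub g.form, LinearMap.sub_apply, hXY, sub_self]

theorem trace_eq_sum {ι : Type*} [Fintype ι] [DecidableEq ι] {b : Module.Basis ι ℝ V}
    (hb : ∀ i j, g.form (b i) (b j) = if i = j then 1 else 0) (T : V →ₗ[ℝ] V) :
    LinearMap.trace ℝ V T = ∑ i, g.form (T (b i)) (b i) := by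
  have repr_eq (v : V) (i : ι) : b.repr v i = g.form v (b i) := by
    conv_rhs => rw [← b.sum_repr v]
    simp only [map_sum, map_smul, LinearMap.sum_apply, LinearMap.smul_apply, hb, smul_eq_mul,
      mul_ite, mul_one, mul_zero, Finset.sum_ite_eq', Finset.mem_univ, if_true]
  rw [LinearMap.trace_eq_matrix_trace ℝ b, Matrix.trace]
  simp only [Matrix.diag_apply, LinearMap.toMatrix_apply, repr_eq]

/-- `g` as an inner product in the sense of `InnerProductSpace`, which makes orthonormal bases and
the spectral theorem available. -/
abbrev innerCore : InnerProductSpace.Core ℝ V where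
  inner X Y := g.form X Y
  conj_inner_symm X Y := g.symm Y X
  re_inner_nonneg := g.nonneg
  add_left X Y Z := by rw [map_add, LinearMap.add_apply]
  smul_left X Y r := by rw [map_smul, LinearMap.smul_apply, smul_eq_mul]; rfl
  definite X hX := by
    by_contra h
    exact (g.pos X h).ne' hX

variable [FiniteDimensional ℝ V]

theorem exists_orthonormal_basis : ∃ b : Module.Basis (Fin (Module.finrank ℝ V)) ℝ V,
    ∀ i j, g.form (b i) (b j) = if i = j then 1 else 0 := by
  let _ : NormedAddCommGroup V := g.innerCore.toNormedAddCommGroup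
  let _ : InnerProductSpace ℝ V := InnerProductSpace.ofCore g.innerCore.toCore
  refine ⟨(stdOrthonormalBasis ℝ V).toBasis, fun i j => ?_⟩
  rw [OrthonormalBasis.coe_toBasis]
  exact orthonormal_iff_ite.1 (stdOrthonormalBasis ℝ V).orthonormal i j

theorem trace_eq_zero_of_skew {T : V →ₗ[ℝ] V} (hT : ∀ X Y, g.form (T X) Y = -g.form X (T Y)) :
    LinearMap.trace ℝ V T = 0 := by
  obtain ⟨b, hb⟩ := g.exists_orthonormal_basis
  rw [g.trace_eq_sum hb]
  refine Finset.sum_eq_zero fun i _ => self_eq_neg.1 ?_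
  nth_rw 1 [hT, g.symm]

theorem trace_comp_nonpos {T T' : V →ₗ[ℝ] V} (hT : ∀ X Y, g.form (T X) Y = -g.form X (T' Y)) :
    LinearMap.trace ℝ V (T ∘ₗ T') ≤ 0 := by
  obtain ⟨b, hb⟩ := g.exists_orthonormal_basis
  rw [g.trace_eq_sum hb]
  refine Finset.sum_nonpos fun i _ => ?_
  rw [LinearMap.comp_apply, hT]
  exact neg_nonpos.2 (g.nonneg (T' (b i)))

theorem abs_trace_le {T : V →ₗ[ℝ] V} {M : ℝ}
    (hT : ∀ X, g.form X X ≤ 1 → |g.form (T X) X| ≤ M) :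
    |LinearMap.trace ℝ V T| ≤ Module.finrank ℝ V * M := by
  obtain ⟨b, hb⟩ := g.exists_orthonormal_basis
  rw [g.trace_eq_sum hb]
  calc |∑ i, g.form (T (b i)) (b i)| ≤ ∑ i, |g.form (T (b i)) (b i)| :=
        Finset.abs_sum_le_sum_abs _ _
    _ ≤ Finset.card Finset.univ • M :=
        Finset.sum_le_card_nsmul _ _ M fun i _ => hT _ (by rw [hb, if_pos rfl])
    _ = Module.finrank ℝ V * M := by rw [Finset.card_univ, Fintype.card_fin, nsmul_eq_mul]

end ScalarProduct

end Trace

section Curvature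

variable {L : Type*} [LieRing L] [LieAlgebra ℝ L] {p k : Submodule ℝ L} (h : IsCompl p k)

theorem brP_apply (X Y : p) : brP h X Y = p.projectionOnto k h ⁅(X : L), (Y : L)⁆ := rfl

theorem brP_swap (X Y : p) : brP h X Y = -brP h Y X := by
  rw [brP_apply, brP_apply, ← lie_skew, map_neg]

theorem brP_self (X : p) : brP h X X = 0 := by
  rw [brP_apply, lie_self, map_zero]

theorem isotropyTerm_swap (X Y Z : p) : isotropyTerm h X Y Z = -isotropyTerm h Y X Z := by
  simp only [isotropyTerm]
  rw [← lie_skew (X : L) (Y : L), map_neg, Submodule.coe_neg, neg_lie, map_neg]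

theorem projectionOnto_add_projectionOnto (v : L) :
    (p.projectionOnto k h v : L) + (k.projectionOnto p h.symm v : L) = v := by
  simpa only [Submodule.coe_projectionOnto_apply] using
    Submodule.projection_add_projection_eq_self h v

theorem projectionOnto_lie_lie (X Y Z : p) :
    p.projectionOnto k h ⁅(X : L), ⁅(Y : L), (Z : L)⁆⁆ =
      brP h X (brP h Y Z) - isotropyTerm h Y Z X := by
  conv_lhs => rw [← projectionOnto_add_projectionOnto h ⁅(Y : L), (Z : L)⁆, lie_add, map_add]
  rw [← lie_skew (X : L) (k.projectionOnto p h.symm _ : L), map_neg, ← sub_eq_add_neg]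
  rfl

theorem brP_jacobi (X Y Z : p) :
    brP h X (brP h Y Z) + brP h Y (brP h Z X) + brP h Z (brP h X Y) =
      isotropyTerm h X Y Z + isotropyTerm h Y Z X + isotropyTerm h Z X Y := by
  have jacobi := congrArg (p.projectionOnto k h) (lie_jacobi (X : L) (Y : L) (Z : L))
  simp only [map_add, map_zero, projectionOnto_lie_lie] at jacobi
  rw [← sub_eq_zero, ← jacobi]
  abel

variable [FiniteDimensional ℝ L] (g : ScalarProduct p)

theorem nomizu_form (X Y Z : p) : g.form (nomizu h g X Y) Z =
    1 / 2 * (g.form (brP h X Y) Z + g.form (brP h Z X) Y + g.form (brP h Z Y) X) :=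
  (LinearMap.BilinForm.apply_toDual_symm_apply (hB := g.nondegenerate) (koszul h g X Y) Z).trans
    (by
      simp only [koszul, one_div, smul_add, LinearMap.mk₂_apply, LinearMap.add_apply,
        LinearMap.smul_apply, smul_eq_mul, LinearMap.coe_comp, Function.comp_apply,
        LinearMap.flip_apply, LinearMap.BilinForm.flip_apply]
      ring)

theorem nomizu_skew (X Y Z : p) :
    g.form (nomizu h g X Y) Z = -g.form Y (nomizu h g X Z) := by
  rw [g.symm Y, nomizu_form, nomizu_form, brP_swap h Y X, brP_swap h Y Z, brP_swap h Z X]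
  simp only [map_neg, LinearMap.neg_apply]
  ring

theorem nomizu_torsion_free (X Y : p) : nomizu h g X Y = nomizu h g Y X + brP h X Y := by
  refine g.eq_of_form_eq fun Z => ?_
  rw [map_add, LinearMap.add_apply, nomizu_form, nomizu_form, brP_swap h Y X]
  simp only [map_neg, LinearMap.neg_apply]
  ring

theorem bianchi (X Y Z : p) :
    curvature h g X Y Z + curvature h g Y Z X + curvature h g Z X Y = 0 := by
  suffices curvature h g X Y Z + curvature h g Y Z X + curvature h g Z X Y =
      (brP h X (brP h Y Z) + brP h Y (brP h Z X) + brP h Z (brP h X Y)) -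
      (isotropyTerm h X Y Z + isotropyTerm h Y Z X + isotropyTerm h Z X Y) by
    rw [this, brP_jacobi, sub_self]
  simp only [curvature]
  rw [nomizu_torsion_free h g Y Z, nomizu_torsion_free h g Z X, nomizu_torsion_free h g X Y]
  simp only [map_add]
  rw [nomizu_torsion_free h g X (brP h Y Z), nomizu_torsion_free h g Y (brP h Z X),
    nomizu_torsion_free h g Z (brP h X Y)]
  abel

theorem curvature_swap (X Y Z : p) : curvature h g X Y Z = -curvature h g Y X Z := by
  simp only [curvature]
  rw [brP_swap h X Y, isotropyTerm_swap h X Y Z]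
  simp only [map_neg, LinearMap.neg_apply]
  abel

/-- The Ricci tensor as a bilinear form. -/
def ricciForm : LinearMap.BilinForm ℝ p :=
  LinearMap.mk₂ ℝ (ricci h g)
    (fun X X' Y => by
      rw [ricci, ricci, ricci, ← map_add]
      refine congrArg _ (LinearMap.ext fun Z => ?_)
      simp only [curvatureEnd, curvature, isotropyTerm, map_add, LinearMap.add_apply,
        Submodule.coe_add, lie_add, add_lie, LinearMap.coe_mk, AddHom.coe_mk]
      abel)
    (fun c X Y => by
      rw [ricci, ricci, ← map_smul]
      refine congrArg _ (LinearMap.ext fun Z => ?_)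
      simp [curvatureEnd, curvature, isotropyTerm, smul_sub])
    (fun X Y Y' => by
      rw [ricci, ricci, ricci, ← map_add]
      refine congrArg _ (LinearMap.ext fun Z => ?_)
      simp only [curvatureEnd, curvature, isotropyTerm, map_add, LinearMap.add_apply,
        Submodule.coe_add, lie_add, LinearMap.coe_mk, AddHom.coe_mk]
      abel)
    (fun c X Y => by
      rw [ricci, ricci, ← map_smul]
      refine congrArg _ (LinearMap.ext fun Z => ?_)
      simp [curvatureEnd, curvature, isotropyTerm, smul_sub])

theorem ricciForm_apply (X Y : p) : ricciForm h g X Y = ricci h g X Y := rfl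

variable {h g}

theorem abs_ricci_le {M : ℝ} (hM : CurvatureBoundedBy h g M) {X : p} (hX : g.form X X ≤ 1) :
    |ricci h g X X| ≤ Module.finrank ℝ p * M :=
  g.abs_trace_le fun Z hZ => hM Z X X Z hZ hX hX hZ

omit [FiniteDimensional ℝ L] in
variable (h g) in
/-- The scalar product `g` on `𝔭` is infinitesimally invariant under `[𝔭, 𝔭]_𝔨`; for an invariant
metric this is the infinitesimal form of `Ad(K)`-invariance. -/
def IsotropySkew : Prop :=
  ∀ X Y Z W, g.form (isotropyTerm h X Y Z) W = -g.form Z (isotropyTerm h X Y W)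

theorem curvature_skew (hg : IsotropySkew h g) (X Y Z W : p) :
    g.form (curvature h g X Y Z) W = -g.form Z (curvature h g X Y W) := by
  simp only [curvature, map_sub, LinearMap.sub_apply]
  rw [hg, nomizu_skew h g (brP h X Y), nomizu_skew h g X, nomizu_skew h g Y,
    nomizu_skew h g Y (nomizu h g X Z), nomizu_skew h g X Z]
  ring

theorem ricci_symm (hg : IsotropySkew h g) (X Y : p) : ricci h g X Y = ricci h g Y X := by
  let R : p →ₗ[ℝ] p := curvatureEnd h g Y X - curvatureEnd h g X Y
  -- By the Bianchi identity `R` is the curvature operator `R(X,Y)`, which is skew.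
  have hR (Z : p) : R Z = curvature h g X Y Z := by
    change curvature h g Z Y X - curvature h g Z X Y = curvature h g X Y Z
    rw [curvature_swap h g Z Y X, ← sub_eq_zero, ← neg_eq_zero, ← bianchi h g X Y Z]
    abel
  have trace_R : LinearMap.trace ℝ p R = 0 := g.trace_eq_zero_of_skew fun Z W => by
    rw [hR, hR, curvature_skew hg]
  rw [map_sub, sub_eq_zero] at trace_R
  exact trace_R.symm

end Curvature

section Automorphism

variable {L : Type*} [LieRing L] [LieAlgebra ℝ L] {p k : Submodule ℝ L} {h : IsCompl p k}
  {A : L →ₗ⁅ℝ⁆ L} {σ : p ≃ₗ[ℝ] p}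

theorem projectionOnto_map_left (hk : ∀ Z ∈ k, A Z ∈ k) (hσ : ∀ X : p, (σ X : L) = A X) (v : L) :
    p.projectionOnto k h (A v) = σ (p.projectionOnto k h v) := by
  conv_lhs => rw [← projectionOnto_add_projectionOnto h v, map_add, ← hσ]
  rw [map_add, Submodule.projectionOnto_apply_left,
    Submodule.projectionOnto_apply_right h ⟨_, hk _ (SetLike.coe_mem _)⟩, add_zero]

theorem projectionOnto_map_right (hk : ∀ Z ∈ k, A Z ∈ k) (hσ : ∀ X : p, (σ X : L) = A X) (v : L) :
    (k.projectionOnto p h.symm (A v) : L) = A (k.projectionOnto p h.symm v) := by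
  conv_lhs => rw [← projectionOnto_add_projectionOnto h v, map_add, ← hσ]
  rw [map_add, Submodule.projectionOnto_apply_right h.symm,
    Submodule.projectionOnto_apply_left h.symm ⟨_, hk _ (SetLike.coe_mem _)⟩, zero_add]

theorem brP_map (hk : ∀ Z ∈ k, A Z ∈ k) (hσ : ∀ X : p, (σ X : L) = A X) (X Y : p) :
    brP h (σ X) (σ Y) = σ (brP h X Y) := by
  rw [brP_apply, brP_apply, hσ, hσ, ← LieHom.map_lie, projectionOnto_map_left hk hσ]

theorem isotropyTerm_map (hk : ∀ Z ∈ k, A Z ∈ k) (hσ : ∀ X : p, (σ X : L) = A X) (X Y Z : p) :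
    isotropyTerm h (σ X) (σ Y) (σ Z) = σ (isotropyTerm h X Y Z) := by
  simp only [isotropyTerm]
  rw [hσ, hσ, hσ, ← LieHom.map_lie, projectionOnto_map_right (h := h) hk hσ, ← LieHom.map_lie,
    projectionOnto_map_left hk hσ]

variable [FiniteDimensional ℝ L] {g : ScalarProduct p}

theorem nomizu_map (hk : ∀ Z ∈ k, A Z ∈ k) (hσ : ∀ X : p, (σ X : L) = A X)
    (hg : ∀ X Y, g.form (σ X) (σ Y) = g.form X Y) (X Y : p) :
    nomizu h g (σ X) (σ Y) = σ (nomizu h g X Y) := by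
  refine g.eq_of_form_eq (σ.surjective.forall.2 fun Z => ?_)
  simp only [hg, nomizu_form, brP_map hk hσ]

theorem ricci_map (hk : ∀ Z ∈ k, A Z ∈ k) (hσ : ∀ X : p, (σ X : L) = A X)
    (hg : ∀ X Y, g.form (σ X) (σ Y) = g.form X Y) (X Y : p) :
    ricci h g (σ X) (σ Y) = ricci h g X Y := by
  have curvature_map (X Y Z : p) :
      curvature h g (σ X) (σ Y) (σ Z) = σ (curvature h g X Y Z) := by
    simp only [curvature, map_sub, nomizu_map hk hσ hg, brP_map hk hσ, isotropyTerm_map hk hσ]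
  have conj_eq : curvatureEnd h g (σ X) (σ Y) = σ.conj (curvatureEnd h g X Y) := by
    refine LinearMap.ext (σ.surjective.forall.2 fun Z => ?_)
    rw [LinearEquiv.conj_apply_apply, σ.symm_apply_apply]
    exact curvature_map Z X Y
  rw [ricci, conj_eq, LinearMap.trace_conj', ricci]

end Automorphism

section TwoSummands

section Projections

variable {V : Type*} [AddCommGroup V] [Module ℝ V] {q₁ q₂ : Submodule ℝ V}

theorem ext_of_isCompl {W : Type*} [AddCommGroup W] [Module ℝ W] (hq : IsCompl q₁ q₂)
    {T T' : V →ₗ[ℝ] W} (h₁ : ∀ Z ∈ q₁, T Z = T' Z) (h₂ : ∀ Z ∈ q₂, T Z = T' Z) : T = T' :=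
  LinearMap.ext fun Z => by
    rw [← Submodule.projection_add_projection_eq_self hq Z, map_add, map_add,
      h₁ _ (Submodule.projection_apply_mem hq Z), h₂ _ (Submodule.projection_apply_mem hq.symm Z)]

theorem projection_eq_zero (hq : IsCompl q₁ q₂) {X : V} (hX : X ∈ q₂) :
    q₁.projection q₂ hq X = 0 :=
  (Submodule.projection_apply_eq_zero_iff hq).2 hX

theorem ScalarProduct.projection_comm (β : ScalarProduct V) (hq : IsCompl q₁ q₂)
    (orthogonal : ∀ X ∈ q₁, ∀ Y ∈ q₂, β.form X Y = 0) (X Y : V) :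
    β.form (q₁.projection q₂ hq X) Y = β.form X (q₁.projection q₂ hq Y) := by
  have form_left (X Y : V) : β.form (q₁.projection q₂ hq X) Y =
      β.form (q₁.projection q₂ hq X) (q₁.projection q₂ hq Y) := by
    conv_lhs => rw [← Submodule.projection_add_projection_eq_self hq Y]
    rw [map_add, orthogonal _ (Submodule.projection_apply_mem hq X) _
      (Submodule.projection_apply_mem hq.symm Y), add_zero]
  rw [form_left X Y, β.symm X, form_left Y X, β.symm]

theorem ScalarProduct.trace_comp_proj_nonpos [FiniteDimensional ℝ V] (β : ScalarProduct V)
    {T P P' : V →ₗ[ℝ] V} (skew : ∀ X Y, β.form (T X) Y = -β.form X (T Y))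
    (P_symm : ∀ X Y, β.form (P X) Y = β.form X (P Y)) (P_idem : ∀ X, P (P X) = P X)
    (P'_symm : ∀ X Y, β.form (P' X) Y = β.form X (P' Y)) (P'_idem : ∀ X, P' (P' X) = P' X) :
    LinearMap.trace ℝ V (T ∘ₗ P ∘ₗ T ∘ₗ P') ≤ 0 := by
  have adjoint (X Y : V) : β.form ((P' ∘ₗ T ∘ₗ P) X) Y = -β.form X ((P ∘ₗ T ∘ₗ P') Y) := by
    simp only [LinearMap.comp_apply]
    rw [P'_symm, skew, P_symm]
  have square : (T ∘ₗ P ∘ₗ T ∘ₗ P') ∘ₗ P' = T ∘ₗ P ∘ₗ T ∘ₗ P' := by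
    ext X
    simp only [LinearMap.comp_apply, P'_idem]
  calc LinearMap.trace ℝ V (T ∘ₗ P ∘ₗ T ∘ₗ P')
      = LinearMap.trace ℝ V (P' ∘ₗ (T ∘ₗ P ∘ₗ T ∘ₗ P')) := by
        rw [LinearMap.trace_comp_comm' _ P', square]
    _ = LinearMap.trace ℝ V ((P' ∘ₗ T ∘ₗ P) ∘ₗ (P ∘ₗ T ∘ₗ P')) := by
        congr 1
        ext X
        simp only [LinearMap.comp_apply, P_idem]
    _ ≤ 0 := β.trace_comp_nonpos adjoint

end Projections

variable {L : Type*} [LieRing L] [LieAlgebra ℝ L] {p k : Submodule ℝ L}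

/-- The algebraic data of an orthogonal splitting `𝔭 = 𝔭₁ ⊕ 𝔭₂` for which `𝔨 ⊕ 𝔭₁` is a
subalgebra; `β` is minus the Killing form on `𝔭`, and `𝔭₁, 𝔭₂` are subspaces `q₁, q₂` of `𝔭`. -/
structure IsSplitting (h : IsCompl p k) {q₁ q₂ : Submodule ℝ p} (hq : IsCompl q₁ q₂)
    (β : ScalarProduct p) : Prop where
  skew : ∀ X Y Z, β.form (brP h X Y) Z = -β.form Y (brP h X Z)
  orthogonal : ∀ X ∈ q₁, ∀ Y ∈ q₂, β.form X Y = 0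
  brP_mem : ∀ X ∈ q₁, ∀ Y ∈ q₁, brP h X Y ∈ q₁
  isotropyTerm_eq_zero : ∀ X ∈ q₁, ∀ Y ∈ q₂, ∀ Z, isotropyTerm h X Y Z = 0

/-- The metric `g = x₁ β|𝔭₁ ⊕ x₂ β|𝔭₂`. -/
def IsSplitMetric {q₁ q₂ : Submodule ℝ p} (hq : IsCompl q₁ q₂) (β g : ScalarProduct p)
    (x₁ x₂ : ℝ) : Prop :=
  ∀ X Y, g.form X Y = x₁ * β.form (q₁.projection q₂ hq X) (q₁.projection q₂ hq Y) +
    x₂ * β.form (q₂.projection q₁ hq.symm X) (q₂.projection q₁ hq.symm Y)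

namespace IsSplitting

variable {h : IsCompl p k} {q₁ q₂ : Submodule ℝ p} {hq : IsCompl q₁ q₂} {β : ScalarProduct p}

local notation "P₁" => Submodule.projection q₁ q₂ hq
local notation "P₂" => Submodule.projection q₂ q₁ (IsCompl.symm hq)

theorem projection₁_comm (S : IsSplitting h hq β) (X Y : p) :
    β.form (P₁ X) Y = β.form X (P₁ Y) :=
  β.projection_comm hq S.orthogonal X Y

theorem projection₂_comm (S : IsSplitting h hq β) (X Y : p) :
    β.form (P₂ X) Y = β.form X (P₂ Y) :=
  β.projection_comm hq.symm (fun X hX Y hY => (β.symm X Y).trans (S.orthogonal Y hY X hX)) X Y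

theorem brP_mem₁₂ (S : IsSplitting h hq β) {X Y : p} (hX : X ∈ q₁) (hY : Y ∈ q₂) :
    brP h X Y ∈ q₂ := by
  rw [← Submodule.projection_apply_eq_zero_iff hq]
  refine β.eq_of_form_eq fun Z => ?_
  rw [S.projection₁_comm, S.skew, β.symm,
    S.orthogonal _ (S.brP_mem _ hX _ (Submodule.projection_apply_mem hq _)) _ hY, neg_zero,
    map_zero, LinearMap.zero_apply]

theorem brP_mem₂₁ (S : IsSplitting h hq β) {X Y : p} (hX : X ∈ q₂) (hY : Y ∈ q₁) :
    brP h X Y ∈ q₂ := by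
  rw [brP_swap]
  exact q₂.neg_mem (S.brP_mem₁₂ hY hX)

variable {g : ScalarProduct p} {x₁ x₂ : ℝ}

theorem form_eq (S : IsSplitting h hq β) (hg : IsSplitMetric hq β g x₁ x₂) (X Y : p) :
    g.form X Y = β.form X (x₁ • P₁ Y + x₂ • P₂ Y) := by
  rw [hg, map_add, map_smul, map_smul, S.projection₁_comm, S.projection₂_comm,
    Submodule.projection_apply_of_mem_left hq (Submodule.projection_apply_mem hq Y),
    Submodule.projection_apply_of_mem_left hq.symm (Submodule.projection_apply_mem hq.symm Y)]
  rfl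

theorem form_eq_of_mem₂ (S : IsSplitting h hq β) (hg : IsSplitMetric hq β g x₁ x₂) {W : p}
    (hW : W ∈ q₂) (Z : p) : g.form W Z = x₂ * β.form Z W := by
  rw [g.symm, S.form_eq hg, projection_eq_zero hq hW,
    Submodule.projection_apply_of_mem_left hq.symm hW, smul_zero, zero_add, map_smul, smul_eq_mul]

theorem isSplitMetric_self (S : IsSplitting h hq β) : IsSplitMetric hq β β 1 1 := by
  intro X Y
  rw [one_mul, one_mul, S.projection₁_comm, S.projection₂_comm,
    Submodule.projection_apply_of_mem_left hq (Submodule.projection_apply_mem hq Y),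
    Submodule.projection_apply_of_mem_left hq.symm (Submodule.projection_apply_mem hq.symm Y),
    ← map_add, Submodule.projection_add_projection_eq_self hq]

theorem brP_smul_add_brP_smul (x₁ x₂ : ℝ) (X Y : p) :
    brP h X (x₁ • P₁ Y + x₂ • P₂ Y) + brP h Y (x₁ • P₁ X + x₂ • P₂ X) =
      (x₂ - x₁) • (brP h (P₁ X) (P₂ Y) - brP h (P₂ X) (P₁ Y)) := by
  have expand (X₁ X₂ Y₁ Y₂ : p) :
      brP h (X₁ + X₂) (x₁ • Y₁ + x₂ • Y₂) + brP h (Y₁ + Y₂) (x₁ • X₁ + x₂ • X₂) =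
        (x₂ - x₁) • (brP h X₁ Y₂ - brP h X₂ Y₁) := by
    rw [brP_swap h (Y₁ + Y₂)]
    simp only [map_add, map_smul, LinearMap.add_apply, LinearMap.smul_apply]
    module
  simpa only [Submodule.projection_add_projection_eq_self] using expand (P₁ X) (P₂ X) (P₁ Y) (P₂ Y)

variable [FiniteDimensional ℝ L]

theorem nomizu_eq (S : IsSplitting h hq β) (hg : IsSplitMetric hq β g x₁ x₂) (hx₂ : x₂ ≠ 0)
    (X Y : p) : nomizu h g X Y = (1 / 2 : ℝ) • brP h X Y +
      ((1 - x₁ / x₂) / 2) • (brP h (P₁ X) (P₂ Y) - brP h (P₂ X) (P₁ Y)) := by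
  have mixed_mem : brP h (P₁ X) (P₂ Y) - brP h (P₂ X) (P₁ Y) ∈ q₂ :=
    q₂.sub_mem (S.brP_mem₁₂ (Submodule.projection_apply_mem hq X)
      (Submodule.projection_apply_mem hq.symm Y))
      (S.brP_mem₂₁ (Submodule.projection_apply_mem hq.symm X) (Submodule.projection_apply_mem hq Y))
  refine g.eq_of_form_eq fun Z => ?_
  rw [nomizu_form, S.form_eq hg (brP h Z X) Y, S.form_eq hg (brP h Z Y) X, brP_swap h Z X,
    brP_swap h Z Y]
  simp only [map_neg, LinearMap.neg_apply]
  rw [S.skew, S.skew, neg_neg, neg_neg, add_assoc, ← map_add, brP_smul_add_brP_smul]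
  simp only [map_add g.form, map_smul g.form, LinearMap.add_apply, LinearMap.smul_apply,
    smul_eq_mul]
  rw [S.form_eq_of_mem₂ hg mixed_mem, map_smul, smul_eq_mul]
  field_simp

theorem nomizu₁₁ (S : IsSplitting h hq β) (hg : IsSplitMetric hq β g x₁ x₂) (hx₂ : x₂ ≠ 0)
    {X Y : p} (hX : X ∈ q₁) (hY : Y ∈ q₁) : nomizu h g X Y = (1 / 2 : ℝ) • brP h X Y := by
  rw [S.nomizu_eq hg hx₂, projection_eq_zero hq.symm hX, projection_eq_zero hq.symm hY]
  simp only [map_zero, LinearMap.zero_apply, sub_zero, smul_zero, add_zero]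

theorem nomizu₂₂ (S : IsSplitting h hq β) (hg : IsSplitMetric hq β g x₁ x₂) (hx₂ : x₂ ≠ 0)
    {X Y : p} (hX : X ∈ q₂) (hY : Y ∈ q₂) : nomizu h g X Y = (1 / 2 : ℝ) • brP h X Y := by
  rw [S.nomizu_eq hg hx₂, projection_eq_zero hq hX, projection_eq_zero hq hY]
  simp only [map_zero, LinearMap.zero_apply, sub_zero, smul_zero, add_zero]

theorem nomizu₁₂ (S : IsSplitting h hq β) (hg : IsSplitMetric hq β g x₁ x₂) (hx₂ : x₂ ≠ 0)
    {X Y : p} (hX : X ∈ q₁) (hY : Y ∈ q₂) :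
    nomizu h g X Y = (1 - x₁ / x₂ / 2) • brP h X Y := by
  rw [S.nomizu_eq hg hx₂, projection_eq_zero hq.symm hX, projection_eq_zero hq hY,
    Submodule.projection_apply_of_mem_left hq hX,
    Submodule.projection_apply_of_mem_left hq.symm hY]
  simp only [map_zero, sub_zero]
  module

theorem nomizu₂₁ (S : IsSplitting h hq β) (hg : IsSplitMetric hq β g x₁ x₂) (hx₂ : x₂ ≠ 0)
    {X Y : p} (hX : X ∈ q₂) (hY : Y ∈ q₁) :
    nomizu h g X Y = (x₁ / x₂ / 2) • brP h X Y := by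
  rw [nomizu_torsion_free, S.nomizu₁₂ hg hx₂ hY hX, brP_swap h Y X]
  module

theorem curvature₁₁ (S : IsSplitting h hq β) (hg : IsSplitMetric hq β g x₁ x₂) (hx₂ : x₂ ≠ 0)
    {X Z : p} (hX : X ∈ q₁) (hZ : Z ∈ q₁) :
    curvature h g Z X X = (1 / 4 : ℝ) • brP h X (brP h Z X) - isotropyTerm h Z X X := by
  have hZX := S.brP_mem Z hZ X hX
  rw [curvature, S.nomizu₁₁ hg hx₂ hX hX, S.nomizu₁₁ hg hx₂ hZ hX, map_smul, map_smul,
    S.nomizu₁₁ hg hx₂ hX hZX, S.nomizu₁₁ hg hx₂ hZX hX, brP_self, brP_swap h (brP h Z X) X,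
    map_zero]
  module

theorem curvature₂₁ (S : IsSplitting h hq β) (hg : IsSplitMetric hq β g x₁ x₂) (hx₂ : x₂ ≠ 0)
    {X Z : p} (hX : X ∈ q₁) (hZ : Z ∈ q₂) :
    curvature h g Z X X = ((x₁ / x₂) ^ 2 / 4) • brP h X (brP h Z X) := by
  have hZX := S.brP_mem₂₁ hZ hX
  rw [curvature, isotropyTerm_swap, S.isotropyTerm_eq_zero X hX Z hZ, S.nomizu₁₁ hg hx₂ hX hX,
    S.nomizu₂₁ hg hx₂ hZ hX, map_smul, map_smul, S.nomizu₁₂ hg hx₂ hX hZX,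
    S.nomizu₂₁ hg hx₂ hZX hX, brP_self, brP_swap h (brP h Z X) X, map_zero]
  module

theorem curvature₁₂ (S : IsSplitting h hq β) (hg : IsSplitMetric hq β g x₁ x₂) (hx₂ : x₂ ≠ 0)
    {X Z : p} (hX : X ∈ q₂) (hZ : Z ∈ q₁) :
    curvature h g Z X X = (x₁ / x₂ / 4) • brP h X (brP h Z X) := by
  have hZX := S.brP_mem₁₂ hZ hX
  rw [curvature, S.isotropyTerm_eq_zero Z hZ X hX, S.nomizu₂₂ hg hx₂ hX hX,
    S.nomizu₁₂ hg hx₂ hZ hX, map_smul, map_smul, S.nomizu₂₂ hg hx₂ hX hZX,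
    S.nomizu₂₂ hg hx₂ hZX hX, brP_self, brP_swap h (brP h Z X) X, map_zero]
  module

theorem curvature₂₂ (S : IsSplitting h hq β) (hg : IsSplitMetric hq β g x₁ x₂) (hx₂ : x₂ ≠ 0)
    {X Z : p} (hX : X ∈ q₂) (hZ : Z ∈ q₂) :
    curvature h g Z X X = (1 - 3 / 4 * (x₁ / x₂)) • brP h X (P₁ (brP h Z X)) +
      (1 / 4 : ℝ) • brP h X (P₂ (brP h Z X)) - isotropyTerm h Z X X := by
  have hW₁ := Submodule.projection_apply_mem hq (brP h Z X)
  have hW₂ := Submodule.projection_apply_mem hq.symm (brP h Z X)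
  have hW := Submodule.projection_add_projection_eq_self hq (brP h Z X)
  rw [curvature, S.nomizu₂₂ hg hx₂ hX hX, S.nomizu₂₂ hg hx₂ hZ hX, map_smul, map_smul, brP_self]
  generalize P₁ (brP h Z X) = W₁ at *
  generalize P₂ (brP h Z X) = W₂ at *
  rw [← hW, map_add, map_add, LinearMap.add_apply, S.nomizu₂₁ hg hx₂ hX hW₁,
    S.nomizu₂₂ hg hx₂ hX hW₂, S.nomizu₁₂ hg hx₂ hW₁ hX, S.nomizu₂₂ hg hx₂ hW₂ hX,
    brP_swap h W₁ X, brP_swap h W₂ X, map_zero]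
  module

omit [FiniteDimensional ℝ L] in
theorem trace_brP_comp_projection_nonpos [FiniteDimensional ℝ p] (S : IsSplitting h hq β) (X : p) :
    LinearMap.trace ℝ p (brP h X ∘ₗ P₁ ∘ₗ brP h X ∘ₗ P₂) ≤ 0 ∧
      LinearMap.trace ℝ p (brP h X ∘ₗ P₂ ∘ₗ brP h X ∘ₗ P₂) ≤ 0 := by
  have idem₁ (Y : p) : P₁ (P₁ Y) = P₁ Y :=
    Submodule.projection_apply_of_mem_left hq (Submodule.projection_apply_mem hq Y)
  have idem₂ (Y : p) : P₂ (P₂ Y) = P₂ Y :=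
    Submodule.projection_apply_of_mem_left hq.symm (Submodule.projection_apply_mem hq.symm Y)
  exact ⟨β.trace_comp_proj_nonpos (S.skew X) S.projection₁_comm idem₁ S.projection₂_comm idem₂,
    β.trace_comp_proj_nonpos (S.skew X) S.projection₂_comm idem₂ S.projection₂_comm idem₂⟩

theorem curvatureEnd_of_mem₁ (S : IsSplitting h hq β) (hg : IsSplitMetric hq β g x₁ x₂)
    (hx₂ : x₂ ≠ 0) {X : p} (hX : X ∈ q₁) :
    curvatureEnd h g X X = curvatureEnd h β X X +
      ((1 - (x₁ / x₂) ^ 2) / 4) • (brP h X ∘ₗ P₂ ∘ₗ brP h X ∘ₗ P₂) := by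
  refine ext_of_isCompl hq (fun Z hZ => ?_) fun Z hZ => ?_ <;>
    change curvature h g Z X X = curvature h β Z X X +
      ((1 - (x₁ / x₂) ^ 2) / 4) • brP h X (P₂ (brP h X (P₂ Z)))
  · rw [projection_eq_zero hq.symm hZ, S.curvature₁₁ hg hx₂ hX hZ,
      S.curvature₁₁ S.isSplitMetric_self one_ne_zero hX hZ]
    simp only [map_zero, smul_zero, add_zero]
  · rw [Submodule.projection_apply_of_mem_left hq.symm hZ,
      Submodule.projection_apply_of_mem_left hq.symm (S.brP_mem₁₂ hX hZ),
      S.curvature₂₁ hg hx₂ hX hZ, S.curvature₂₁ S.isSplitMetric_self one_ne_zero hX hZ,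
      brP_swap h Z X, map_neg]
    module

theorem curvatureEnd_of_mem₂ (S : IsSplitting h hq β) (hg : IsSplitMetric hq β g x₁ x₂)
    (hx₂ : x₂ ≠ 0) {X : p} (hX : X ∈ q₂) :
    curvatureEnd h g X X = curvatureEnd h β X X +
      ((1 - x₁ / x₂) / 4) • (brP h X ∘ₗ (P₂ ∘ₗ brP h X ∘ₗ P₁)) -
        (3 / 4 * (1 - x₁ / x₂)) • (brP h X ∘ₗ P₁ ∘ₗ brP h X ∘ₗ P₂) := by
  refine ext_of_isCompl hq (fun Z hZ => ?_) fun Z hZ => ?_ <;>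
    change curvature h g Z X X = curvature h β Z X X +
      ((1 - x₁ / x₂) / 4) • brP h X (P₂ (brP h X (P₁ Z))) -
        (3 / 4 * (1 - x₁ / x₂)) • brP h X (P₁ (brP h X (P₂ Z)))
  · rw [Submodule.projection_apply_of_mem_left hq hZ, projection_eq_zero hq.symm hZ,
      Submodule.projection_apply_of_mem_left hq.symm (S.brP_mem₂₁ hX hZ),
      S.curvature₁₂ hg hx₂ hX hZ, S.curvature₁₂ S.isSplitMetric_self one_ne_zero hX hZ,
      brP_swap h Z X]
    simp only [map_neg, map_zero]
    module
  · rw [projection_eq_zero hq hZ, Submodule.projection_apply_of_mem_left hq.symm hZ,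
      S.curvature₂₂ hg hx₂ hX hZ, S.curvature₂₂ S.isSplitMetric_self one_ne_zero hX hZ,
      brP_swap h Z X]
    simp only [map_neg, map_zero]
    module

theorem exists_ricci_eq_of_mem₁ (S : IsSplitting h hq β) {X : p} (hX : X ∈ q₁) :
    ∃ A B : ℝ, 0 ≤ B ∧ ∀ (g : ScalarProduct p) (x₁ x₂ : ℝ), IsSplitMetric hq β g x₁ x₂ → x₂ ≠ 0 →
      ricci h g X X = A + B * (x₁ / x₂) ^ 2 := by
  set τ := LinearMap.trace ℝ p (brP h X ∘ₗ P₂ ∘ₗ brP h X ∘ₗ P₂)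
  have hτ : τ ≤ 0 := (S.trace_brP_comp_projection_nonpos X).2
  refine ⟨ricci h β X X + τ / 4, -τ / 4, by linarith, fun g x₁ x₂ hg hx₂ => ?_⟩
  rw [ricci, S.curvatureEnd_of_mem₁ hg hx₂ hX, map_add, map_smul, smul_eq_mul, ricci]
  ring

theorem exists_ricci_eq_of_mem₂ (S : IsSplitting h hq β) {X : p} (hX : X ∈ q₂) :
    ∃ C D : ℝ, 0 ≤ D ∧ ∀ (g : ScalarProduct p) (x₁ x₂ : ℝ), IsSplitMetric hq β g x₁ x₂ → x₂ ≠ 0 →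
      ricci h g X X = C - D * (x₁ / x₂) := by
  set τ := LinearMap.trace ℝ p (brP h X ∘ₗ P₁ ∘ₗ brP h X ∘ₗ P₂) with τ_def
  have hτ : τ ≤ 0 := (S.trace_brP_comp_projection_nonpos X).1
  have trace_swap : LinearMap.trace ℝ p (brP h X ∘ₗ P₂ ∘ₗ brP h X ∘ₗ P₁) = τ := by
    rw [τ_def, ← LinearMap.comp_assoc, LinearMap.trace_comp_comm', LinearMap.comp_assoc]
  refine ⟨ricci h β X X - τ / 2, -τ / 2, by linarith, fun g x₁ x₂ hg hx₂ => ?_⟩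
  rw [ricci, S.curvatureEnd_of_mem₂ hg hx₂ hX, map_sub, map_add, map_smul, map_smul, trace_swap,
    smul_eq_mul, smul_eq_mul, ← τ_def, ricci]
  ring

end IsSplitting

end TwoSummands

section Schur

namespace ScalarProduct

variable {V : Type*} [AddCommGroup V] [Module ℝ V]

/-- The restriction of a scalar product to a smaller subspace. -/
def restrict {q p : Submodule ℝ V} (g : ScalarProduct p) (hq : q ≤ p) : ScalarProduct q where
  form := g.form.compl₁₂ (Submodule.inclusion hq) (Submodule.inclusion hq)
  symm _ _ := g.symm _ _
  pos _ hX := g.pos _ ((map_ne_zero_iff _ (Submodule.inclusion_injective hq)).2 hX)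

theorem exists_form_self_eq_one {q p : Submodule ℝ V} (g : ScalarProduct p) (hq : q ≠ ⊥)
    (hqp : q ≤ p) : ∃ X : p, (X : V) ∈ q ∧ g.form X X = 1 := by
  obtain ⟨X, hX, X_ne⟩ := Submodule.exists_mem_ne_zero_of_ne_bot hq
  have X_pos := g.pos ⟨X, hqp hX⟩ fun h => X_ne (congrArg Subtype.val h)
  set c := g.form ⟨X, hqp hX⟩ ⟨X, hqp hX⟩
  refine ⟨(√c)⁻¹ • ⟨X, hqp hX⟩, q.smul_mem _ hX, ?_⟩
  rw [map_smul g.form, LinearMap.smul_apply, map_smul, smul_smul, ← mul_inv, smul_eq_mul,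
    Real.mul_self_sqrt X_pos.le, inv_mul_cancel₀ X_pos.ne']

theorem ne_zero_of_form_eq_one (g : ScalarProduct V) {X : V} (hX : g.form X X = 1) : X ≠ 0 := by
  rintro rfl
  exact zero_ne_one (((g.form 0).map_zero).symm.trans hX)

variable [FiniteDimensional ℝ V]

theorem exists_form_apply_eq {W : Type*} [AddCommGroup W] [Module ℝ W] (Q : ScalarProduct V)
    (f : W →ₗ[ℝ] V →ₗ[ℝ] ℝ) : ∃ φ : W →ₗ[ℝ] V, ∀ X Y, Q.form (φ X) Y = f X Y :=
  ⟨(LinearMap.BilinForm.toDual Q.form Q.nondegenerate).symm.toLinearMap ∘ₗ f, fun _ _ =>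
    LinearMap.BilinForm.apply_toDual_symm_apply (hB := Q.nondegenerate) _ _⟩

theorem exists_eigenvector [Nontrivial V] (Q : ScalarProduct V) {f : V →ₗ[ℝ] V →ₗ[ℝ] ℝ}
    (f_symm : ∀ X Y, f X Y = f Y X) :
    ∃ (c : ℝ) (X : V), X ≠ 0 ∧ ∀ Y, f X Y = c * Q.form X Y := by
  obtain ⟨S, hS⟩ := Q.exists_form_apply_eq f
  let _ : NormedAddCommGroup V := Q.innerCore.toNormedAddCommGroup
  let _ : InnerProductSpace ℝ V := InnerProductSpace.ofCore Q.innerCore.toCore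
  have S_symm : S.IsSymmetric := fun X Y => by
    change Q.form (S X) Y = Q.form X (S Y)
    rw [hS, Q.symm, hS, f_symm]
  obtain ⟨c, hc⟩ : ∃ c, Module.End.eigenspace S c ≠ ⊥ := by
    by_contra! no_eigenvalue
    exact not_subsingleton V (S_symm.subsingleton_of_no_eigenvalue_finiteDimensional no_eigenvalue)
  obtain ⟨X, hX, X_ne⟩ := Submodule.exists_mem_ne_zero_of_ne_bot hc
  refine ⟨c, X, X_ne, fun Y => ?_⟩
  rw [← hS, Module.End.mem_eigenspace_iff.1 hX, map_smul, LinearMap.smul_apply, smul_eq_mul]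

end ScalarProduct

variable {E : Type*} [NormedAddCommGroup E] [NormedSpace ℝ E]
  {G : Type*} [TopologicalSpace G] [ChartedSpace E G] [Group G] {K : Subgroup G}
  {q q' : Submodule ℝ (GroupLieAlgebra 𝓘(ℝ, E) G)}

local notation "𝔤" => GroupLieAlgebra 𝓘(ℝ, E) G

/-- The pairing `f` of two subspaces is `Ad(K)`-invariant. As in `InvariantMetric`, the vectors
`Ad(a) X` and `Ad(a) Y` are given as elements `X'` and `Y'` of the subspaces. -/
def IsAdInvariantForm (K : Subgroup G) (f : q →ₗ[ℝ] q' →ₗ[ℝ] ℝ) : Prop :=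
  ∀ a ∈ K, ∀ (X X' : q) (Y Y' : q'),
    (X' : GroupLieAlgebra 𝓘(ℝ, E) G) = Ad a (X : GroupLieAlgebra 𝓘(ℝ, E) G) →
    (Y' : GroupLieAlgebra 𝓘(ℝ, E) G) = Ad a (Y : GroupLieAlgebra 𝓘(ℝ, E) G) → f X' Y' = f X Y

theorem IsAdInvariantForm.restrict {p : Submodule ℝ 𝔤} {f : p →ₗ[ℝ] p →ₗ[ℝ] ℝ}
    (hf : IsAdInvariantForm K f) (hq : q ≤ p) (hq' : q' ≤ p) :
    IsAdInvariantForm K (f.compl₁₂ (Submodule.inclusion hq) (Submodule.inclusion hq')) :=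
  fun a ha _ _ _ _ hX hY => hf a ha _ _ _ _ hX hY

theorem IsAdIrreducible.eq_bot_or_eq_top (hq : IsAdIrreducible K q) {W : Submodule ℝ q}
    (hW : ∀ a ∈ K, ∀ X X' : q, (X' : 𝔤) = Ad a (X : 𝔤) → X ∈ W → X' ∈ W) : W = ⊥ ∨ W = ⊤ := by
  have map_invariant : IsAdInvariant K (W.map q.subtype) := by
    rintro a ha _ ⟨X, hX, rfl⟩
    exact ⟨⟨Ad a X, hq.1 a ha X X.2⟩, hW a ha X _ rfl hX, rfl⟩
  have map_injective := Submodule.map_injective_of_injective q.injective_subtype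
  refine (hq.2.2 _ (Submodule.map_subtype_le q W) map_invariant).imp (fun h => ?_) fun h => ?_
  · exact map_injective (h.trans (Submodule.map_bot _).symm)
  · exact map_injective (h.trans (Submodule.map_subtype_top q).symm)

variable [LieGroup 𝓘(ℝ, E) ∞ G]

theorem IsAdInvariant.exists_eq_Ad (hq : IsAdInvariant K q) {a : G} (ha : a ∈ K) (Y' : q) :
    ∃ Y : q, (Y' : 𝔤) = Ad a (Y : 𝔤) :=
  ⟨⟨Ad a⁻¹ Y', hq _ (K.inv_mem ha) _ Y'.2⟩, (Ad_Ad_inv a _).symm⟩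

variable [FiniteDimensional ℝ E]

-- A symmetric form has an eigenvector with respect to `Q`, and its eigenspaces are invariant.
theorem IsAdIrreducible.exists_form_eq (hq : IsAdIrreducible K q) {Q : ScalarProduct q}
    (hQ : IsAdInvariantForm K Q.form) {f : q →ₗ[ℝ] q →ₗ[ℝ] ℝ} (f_symm : ∀ X Y, f X Y = f Y X)
    (hf : IsAdInvariantForm K f) : ∃ c : ℝ, ∀ X Y, f X Y = c * Q.form X Y := by
  have : Nontrivial q := Submodule.nontrivial_iff_ne_bot.2 hq.2.1
  obtain ⟨c, X₀, X₀_ne, hX₀⟩ := Q.exists_eigenvector f_symm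
  let W : Submodule ℝ q := LinearMap.ker (f - c • Q.form)
  have mem_W (X : q) : X ∈ W ↔ ∀ Y, f X Y = c * Q.form X Y := by
    simp only [W, LinearMap.mem_ker, LinearMap.ext_iff, LinearMap.sub_apply, LinearMap.smul_apply,
      smul_eq_mul, sub_eq_zero]
  have W_invariant : ∀ a ∈ K, ∀ X X' : q, (X' : 𝔤) = Ad a (X : 𝔤) → X ∈ W → X' ∈ W := by
    intro a ha X X' hX' hX
    refine (mem_W X').2 fun Y' => ?_
    obtain ⟨Y, hY⟩ := hq.1.exists_eq_Ad ha Y'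
    rw [hf a ha X X' Y Y' hX' hY, hQ a ha X X' Y Y' hX' hY, (mem_W X).1 hX]
  rcases hq.eq_bot_or_eq_top W_invariant with h | h
  · exact absurd ((Submodule.mem_bot ℝ).1 (h ▸ (mem_W X₀).2 hX₀)) X₀_ne
  · exact ⟨c, fun X => (mem_W X).1 (h ▸ Submodule.mem_top)⟩

theorem IsAdInvariantForm.eq_zero_of_not_adEquivalent {f : q →ₗ[ℝ] q' →ₗ[ℝ] ℝ}
    (hf : IsAdInvariantForm K f) (hq : IsAdIrreducible K q) (hq' : IsAdIrreducible K q')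
    (inequivalent : ¬ AdEquivalent K q q') {Q : ScalarProduct q'}
    (hQ : IsAdInvariantForm K Q.form) : f = 0 := by
  obtain ⟨φ, hφ⟩ := Q.exists_form_apply_eq f
  have equivariant : ∀ a ∈ K, ∀ X X' : q, (X' : 𝔤) = Ad a (X : 𝔤) →
      (φ X' : 𝔤) = Ad a (φ X : 𝔤) := by
    intro a ha X X' hX'
    suffices φ X' = ⟨Ad a (φ X), hq'.1 a ha _ (φ X).2⟩ from congrArg Subtype.val this
    refine Q.eq_of_form_eq fun Y' => ?_
    obtain ⟨Y, hY⟩ := hq'.1.exists_eq_Ad ha Y'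
    rw [hφ, hf a ha X X' Y Y' hX' hY, hQ a ha (φ X) _ Y Y' rfl hY, hφ]
  have ker_invariant : ∀ a ∈ K, ∀ X X' : q, (X' : 𝔤) = Ad a (X : 𝔤) →
      X ∈ LinearMap.ker φ → X' ∈ LinearMap.ker φ := fun a ha X X' hX' hX => by
    refine LinearMap.mem_ker.2 (Subtype.ext ?_)
    rw [equivariant a ha X X' hX', LinearMap.mem_ker.1 hX, Submodule.coe_zero, map_zero]
  have range_invariant : ∀ a ∈ K, ∀ Y Y' : q', (Y' : 𝔤) = Ad a (Y : 𝔤) →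
      Y ∈ LinearMap.range φ → Y' ∈ LinearMap.range φ := by
    rintro a ha _ Y' hY' ⟨X, rfl⟩
    exact ⟨⟨Ad a X, hq.1 a ha X X.2⟩, Subtype.ext ((equivariant a ha X _ rfl).trans hY'.symm)⟩
  have φ_eq_zero : φ = 0 := by
    rcases hq.eq_bot_or_eq_top ker_invariant with ker_eq | ker_eq
    · rcases hq'.eq_bot_or_eq_top range_invariant with range_eq | range_eq
      · exact LinearMap.range_eq_bot.1 range_eq
      · exact absurd ⟨LinearEquiv.ofBijective φ ⟨LinearMap.ker_eq_bot.1 ker_eq,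
          LinearMap.range_eq_top.1 range_eq⟩, equivariant⟩ inequivalent
    · exact LinearMap.ker_eq_top.1 ker_eq
  refine LinearMap.ext₂ fun X Y => ?_
  rw [← hφ, φ_eq_zero, LinearMap.zero_apply, map_zero]
  rfl

end Schur

section SubmoduleOf

variable {V : Type*} [AddCommGroup V] [Module ℝ V] {p₁ p₂ : Submodule ℝ V}

theorem isCompl_submoduleOf_sup (hp : Disjoint p₁ p₂) :
    IsCompl (p₁.submoduleOf (p₁ ⊔ p₂)) (p₂.submoduleOf (p₁ ⊔ p₂)) := by
  constructor
  · rw [Submodule.disjoint_def]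
    exact fun X h₁ h₂ => Subtype.ext (Submodule.disjoint_def.1 hp X h₁ h₂)
  · rw [codisjoint_iff_le_sup]
    rintro ⟨X, hX⟩ -
    obtain ⟨Y, hY, Z, hZ, rfl⟩ := Submodule.mem_sup.1 hX
    exact Submodule.mem_sup.2 ⟨⟨Y, le_sup_left (a := p₁) hY⟩, hY,
      ⟨Z, le_sup_right (a := p₁) hZ⟩, hZ, rfl⟩

/-- The projection of `𝔭₁ ⊕ 𝔭₂` to `𝔭₁`, as an endomorphism. -/
def proj₁ (hp : Disjoint p₁ p₂) : ↥(p₁ ⊔ p₂) →ₗ[ℝ] ↥(p₁ ⊔ p₂) :=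
  Submodule.projection _ _ (isCompl_submoduleOf_sup hp)

/-- The projection of `𝔭₁ ⊕ 𝔭₂` to `𝔭₂`, as an endomorphism. -/
def proj₂ (hp : Disjoint p₁ p₂) : ↥(p₁ ⊔ p₂) →ₗ[ℝ] ↥(p₁ ⊔ p₂) :=
  Submodule.projection _ _ (isCompl_submoduleOf_sup hp).symm

variable (hp : Disjoint p₁ p₂)

theorem proj₁_mem (X : ↥(p₁ ⊔ p₂)) : (proj₁ hp X : V) ∈ p₁ :=
  Submodule.projection_apply_mem (isCompl_submoduleOf_sup hp) X

theorem proj₂_mem (X : ↥(p₁ ⊔ p₂)) : (proj₂ hp X : V) ∈ p₂ :=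
  Submodule.projection_apply_mem (isCompl_submoduleOf_sup hp).symm X

theorem proj₁_add_proj₂ (X : ↥(p₁ ⊔ p₂)) : proj₁ hp X + proj₂ hp X = X :=
  Submodule.projection_add_projection_eq_self (isCompl_submoduleOf_sup hp) X

theorem proj₁_of_mem₁ {X : ↥(p₁ ⊔ p₂)} (hX : (X : V) ∈ p₁) : proj₁ hp X = X :=
  Submodule.projection_apply_of_mem_left (isCompl_submoduleOf_sup hp) hX

theorem proj₂_of_mem₂ {X : ↥(p₁ ⊔ p₂)} (hX : (X : V) ∈ p₂) : proj₂ hp X = X :=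
  Submodule.projection_apply_of_mem_left (isCompl_submoduleOf_sup hp).symm hX

theorem proj₁_of_mem₂ {X : ↥(p₁ ⊔ p₂)} (hX : (X : V) ∈ p₂) : proj₁ hp X = 0 :=
  projection_eq_zero (isCompl_submoduleOf_sup hp) hX

theorem proj₂_of_mem₁ {X : ↥(p₁ ⊔ p₂)} (hX : (X : V) ∈ p₁) : proj₂ hp X = 0 :=
  projection_eq_zero (isCompl_submoduleOf_sup hp).symm hX

theorem form_eq_add_of_orthogonal {f : LinearMap.BilinForm ℝ ↥(p₁ ⊔ p₂)}
    (f_symm : ∀ X Y, f X Y = f Y X) {f₁ f₂ : LinearMap.BilinForm ℝ ↥(p₁ ⊔ p₂)}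
    (h₁ : ∀ X Y : ↥(p₁ ⊔ p₂), (X : V) ∈ p₁ → (Y : V) ∈ p₁ → f X Y = f₁ X Y)
    (h₂ : ∀ X Y : ↥(p₁ ⊔ p₂), (X : V) ∈ p₂ → (Y : V) ∈ p₂ → f X Y = f₂ X Y)
    (orthogonal : ∀ X Y : ↥(p₁ ⊔ p₂), (X : V) ∈ p₁ → (Y : V) ∈ p₂ → f X Y = 0)
    (X Y : ↥(p₁ ⊔ p₂)) :
    f X Y = f₁ (proj₁ hp X) (proj₁ hp Y) + f₂ (proj₂ hp X) (proj₂ hp Y) := by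
  conv_lhs => rw [← proj₁_add_proj₂ hp X, ← proj₁_add_proj₂ hp Y]
  rw [map_add f, LinearMap.add_apply, map_add, map_add,
    h₁ _ _ (proj₁_mem hp X) (proj₁_mem hp Y), h₂ _ _ (proj₂_mem hp X) (proj₂_mem hp Y),
    f_symm (proj₂ hp X), orthogonal _ _ (proj₁_mem hp X) (proj₂_mem hp Y),
    orthogonal _ _ (proj₁_mem hp Y) (proj₂_mem hp X), add_zero, zero_add]

theorem proj_eq_of_map_mem {A : V →ₗ[ℝ] V} (hA₁ : ∀ X ∈ p₁, A X ∈ p₁) (hA₂ : ∀ X ∈ p₂, A X ∈ p₂)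
    {X X' : ↥(p₁ ⊔ p₂)} (hX : (X' : V) = A X) :
    (proj₁ hp X' : V) = A (proj₁ hp X) ∧ (proj₂ hp X' : V) = A (proj₂ hp X) := by
  let Y₁ : ↥(p₁ ⊔ p₂) := ⟨_, le_sup_left (a := p₁) (hA₁ _ (proj₁_mem hp X))⟩
  let Y₂ : ↥(p₁ ⊔ p₂) := ⟨_, le_sup_right (a := p₁) (hA₂ _ (proj₂_mem hp X))⟩
  have hY₁ : (Y₁ : V) ∈ p₁ := hA₁ _ (proj₁_mem hp X)
  have hY₂ : (Y₂ : V) ∈ p₂ := hA₂ _ (proj₂_mem hp X)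
  have X'_eq : X' = Y₁ + Y₂ := by
    refine Subtype.ext ?_
    rw [hX, Submodule.coe_add, ← map_add, ← Submodule.coe_add, proj₁_add_proj₂]
  rw [X'_eq, map_add, map_add, proj₁_of_mem₁ hp hY₁, proj₁_of_mem₂ hp hY₂, proj₂_of_mem₁ hp hY₁,
    proj₂_of_mem₂ hp hY₂, add_zero, zero_add]
  exact ⟨rfl, rfl⟩

theorem ScalarProduct.form_proj_pos (Q : ScalarProduct ↥(p₁ ⊔ p₂)) {c₁ c₂ : ℝ} (h₁ : 0 < c₁)
    (h₂ : 0 < c₂) {X : ↥(p₁ ⊔ p₂)} (hX : X ≠ 0) :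
    0 < c₁ * Q.form (proj₁ hp X) (proj₁ hp X) + c₂ * Q.form (proj₂ hp X) (proj₂ hp X) := by
  have nonneg₁ := mul_nonneg h₁.le (Q.nonneg (proj₁ hp X))
  have nonneg₂ := mul_nonneg h₂.le (Q.nonneg (proj₂ hp X))
  by_cases proj₁_eq : proj₁ hp X = 0
  · have proj₂_ne : proj₂ hp X ≠ 0 := fun proj₂_eq =>
      hX (by rw [← proj₁_add_proj₂ hp X, proj₁_eq, proj₂_eq, add_zero])
    exact add_pos_of_nonneg_of_pos nonneg₁ (mul_pos h₂ (Q.pos _ proj₂_ne))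
  · exact add_pos_of_pos_of_nonneg (mul_pos h₁ (Q.pos _ proj₁_eq)) nonneg₂

end SubmoduleOf

section DiagonalMetrics

variable {E : Type*} [NormedAddCommGroup E] [NormedSpace ℝ E]
  {G : Type*} [TopologicalSpace G] [ChartedSpace E G] [Group G]
  {K : Subgroup G} {p₁ p₂ : Submodule ℝ (GroupLieAlgebra 𝓘(ℝ, E) G)}

local notation "𝔤" => GroupLieAlgebra 𝓘(ℝ, E) G

variable {Q g g' : InvariantMetric K (p₁ ⊔ p₂)} {x₁ x₂ : ℝ}

theorem InvariantMetric.ext_form {p : Submodule ℝ 𝔤} {g g' : InvariantMetric K p}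
    (h : ∀ X Y, g.form X Y = g'.form X Y) : g = g' := by
  obtain ⟨⟨f, _, _⟩, _⟩ := g
  obtain ⟨⟨f', _, _⟩, _⟩ := g'
  obtain rfl : f = f' := LinearMap.ext₂ h
  rfl

theorem IsDiagonal.form_eq (hp : Disjoint p₁ p₂) (hg : IsDiagonal Q g x₁ x₂) (X Y : ↥(p₁ ⊔ p₂)) :
    g.form X Y = x₁ * Q.form (proj₁ hp X) (proj₁ hp Y) +
      x₂ * Q.form (proj₂ hp X) (proj₂ hp Y) :=
  form_eq_add_of_orthogonal hp g.symm (f₁ := x₁ • Q.form) (f₂ := x₂ • Q.form)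
    hg.2.2.1 hg.2.2.2.1 hg.2.2.2.2 X Y

theorem isDiagonal_of_form_eq (hp : Disjoint p₁ p₂) (h₁ : 0 < x₁) (h₂ : 0 < x₂)
    (hg : ∀ X Y, g.form X Y = x₁ * Q.form (proj₁ hp X) (proj₁ hp Y) +
      x₂ * Q.form (proj₂ hp X) (proj₂ hp Y)) : IsDiagonal Q g x₁ x₂ := by
  refine ⟨h₁, h₂, fun X Y hX hY => ?_, fun X Y hX hY => ?_, fun X Y hX hY => ?_⟩
  · rw [hg, proj₁_of_mem₁ hp hX, proj₁_of_mem₁ hp hY, proj₂_of_mem₁ hp hY, map_zero, mul_zero,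
      add_zero]
  · rw [hg, proj₂_of_mem₂ hp hX, proj₂_of_mem₂ hp hY, proj₁_of_mem₂ hp hY, map_zero, mul_zero,
      zero_add]
  · rw [hg, proj₁_of_mem₂ hp hY, proj₂_of_mem₁ hp hX, map_zero, map_zero, LinearMap.zero_apply,
      mul_zero, mul_zero, add_zero]

theorem IsDiagonal.unique (hp : Disjoint p₁ p₂) (hg : IsDiagonal Q g x₁ x₂)
    (hg' : IsDiagonal Q g' x₁ x₂) : g = g' :=
  InvariantMetric.ext_form fun X Y => by rw [hg.form_eq hp, hg'.form_eq hp]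

theorem IsDiagonal.form_self₁ (hg : IsDiagonal Q g x₁ x₂) {U : ↥(p₁ ⊔ p₂)} (hU : (U : 𝔤) ∈ p₁)
    (QU : Q.form U U = 1) : g.form U U = x₁ :=
  (hg.2.2.1 U U hU hU).trans (by rw [QU, mul_one])

theorem IsDiagonal.form_self₂ (hg : IsDiagonal Q g x₁ x₂) {V : ↥(p₁ ⊔ p₂)} (hV : (V : 𝔤) ∈ p₂)
    (QV : Q.form V V = 1) : g.form V V = x₂ :=
  (hg.2.2.2.1 V V hV hV).trans (by rw [QV, mul_one])

/-- The metric `x₁ Q|𝔭₁ ⊕ x₂ Q|𝔭₂`. -/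
def diagonalMetric (hp : Disjoint p₁ p₂) (hp₁ : IsAdInvariant K p₁) (hp₂ : IsAdInvariant K p₂)
    (Q : InvariantMetric K (p₁ ⊔ p₂)) (h₁ : 0 < x₁) (h₂ : 0 < x₂) :
    InvariantMetric K (p₁ ⊔ p₂) where
  form := x₁ • Q.form.compl₁₂ (proj₁ hp) (proj₁ hp) + x₂ • Q.form.compl₁₂ (proj₂ hp) (proj₂ hp)
  symm X Y := congrArg₂ (x₁ * · + x₂ * ·) (Q.symm _ _) (Q.symm _ _)
  pos X hX := Q.form_proj_pos hp h₁ h₂ hX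
  invariant a ha X X' Y Y' hX hY := by
    obtain ⟨X₁_eq, X₂_eq⟩ := proj_eq_of_map_mem hp (hp₁ a ha) (hp₂ a ha) hX
    obtain ⟨Y₁_eq, Y₂_eq⟩ := proj_eq_of_map_mem hp (hp₁ a ha) (hp₂ a ha) hY
    exact congrArg₂ (x₁ * · + x₂ * ·) (Q.invariant a ha _ _ _ _ X₁_eq Y₁_eq)
      (Q.invariant a ha _ _ _ _ X₂_eq Y₂_eq)

theorem isDiagonal_diagonalMetric (hp : Disjoint p₁ p₂) (hp₁ : IsAdInvariant K p₁)
    (hp₂ : IsAdInvariant K p₂) (Q : InvariantMetric K (p₁ ⊔ p₂)) (h₁ : 0 < x₁) (h₂ : 0 < x₂) :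
    IsDiagonal Q (diagonalMetric hp hp₁ hp₂ Q h₁ h₂) x₁ x₂ :=
  isDiagonal_of_form_eq hp h₁ h₂ fun _ _ => rfl

variable [FiniteDimensional ℝ E] [LieGroup 𝓘(ℝ, E) ∞ G]

theorem IsAdInvariantForm.eq_zero_of_mem (h₁ : IsAdIrreducible K p₁) (h₂ : IsAdIrreducible K p₂)
    (inequivalent : ¬ AdEquivalent K p₁ p₂) (Q : InvariantMetric K (p₁ ⊔ p₂))
    {f : LinearMap.BilinForm ℝ ↥(p₁ ⊔ p₂)} (hf : IsAdInvariantForm K f) {X Y : ↥(p₁ ⊔ p₂)}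
    (hX : (X : 𝔤) ∈ p₁) (hY : (Y : 𝔤) ∈ p₂) : f X Y = 0 := by
  have restriction_eq_zero := (hf.restrict le_sup_left le_sup_right).eq_zero_of_not_adEquivalent
    h₁ h₂ inequivalent (Q := Q.toScalarProduct.restrict le_sup_right)
    (IsAdInvariantForm.restrict (f := Q.form) Q.invariant le_sup_right le_sup_right)
  exact LinearMap.congr_fun₂ restriction_eq_zero ⟨X, hX⟩ ⟨Y, hY⟩

theorem IsAdInvariantForm.exists_eq_add (hp : Disjoint p₁ p₂) (h₁ : IsAdIrreducible K p₁)
    (h₂ : IsAdIrreducible K p₂) (inequivalent : ¬ AdEquivalent K p₁ p₂)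
    (Q : InvariantMetric K (p₁ ⊔ p₂)) {f : LinearMap.BilinForm ℝ ↥(p₁ ⊔ p₂)}
    (hf : IsAdInvariantForm K f) (f_symm : ∀ X Y, f X Y = f Y X) :
    ∃ c₁ c₂ : ℝ, ∀ X Y, f X Y =
      c₁ * Q.form (proj₁ hp X) (proj₁ hp Y) + c₂ * Q.form (proj₂ hp X) (proj₂ hp Y) := by
  have hQ : IsAdInvariantForm K Q.form := Q.invariant
  obtain ⟨c₁, hc₁⟩ := h₁.exists_form_eq (Q := Q.toScalarProduct.restrict le_sup_left)
    (hQ.restrict le_sup_left le_sup_left) (fun _ _ => f_symm _ _)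
    (hf.restrict le_sup_left le_sup_left)
  obtain ⟨c₂, hc₂⟩ := h₂.exists_form_eq (Q := Q.toScalarProduct.restrict le_sup_right)
    (hQ.restrict le_sup_right le_sup_right) (fun _ _ => f_symm _ _)
    (hf.restrict le_sup_right le_sup_right)
  exact ⟨c₁, c₂, form_eq_add_of_orthogonal hp f_symm (f₁ := c₁ • Q.form) (f₂ := c₂ • Q.form)
    (fun X Y hX hY => hc₁ ⟨X, hX⟩ ⟨Y, hY⟩) (fun X Y hX hY => hc₂ ⟨X, hX⟩ ⟨Y, hY⟩)
    fun X Y hX hY => hf.eq_zero_of_mem h₁ h₂ inequivalent Q hX hY⟩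

theorem exists_isDiagonal (hp : Disjoint p₁ p₂) (h₁ : IsAdIrreducible K p₁)
    (h₂ : IsAdIrreducible K p₂) (inequivalent : ¬ AdEquivalent K p₁ p₂)
    (Q g : InvariantMetric K (p₁ ⊔ p₂)) : ∃ x₁ x₂ : ℝ, IsDiagonal Q g x₁ x₂ := by
  have hg : IsAdInvariantForm K g.form := g.invariant
  obtain ⟨x₁, x₂, g_eq⟩ := hg.exists_eq_add hp h₁ h₂ inequivalent Q g.symm
  obtain ⟨X, hX, QX⟩ := Q.exists_form_self_eq_one h₁.2.1 (le_sup_left (b := p₂))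
  obtain ⟨Y, hY, QY⟩ := Q.exists_form_self_eq_one h₂.2.1 (le_sup_right (a := p₁))
  have gX := g_eq X X
  have gY := g_eq Y Y
  rw [proj₁_of_mem₁ hp hX, proj₂_of_mem₁ hp hX, map_zero, mul_zero, add_zero, QX, mul_one] at gX
  rw [proj₂_of_mem₂ hp hY, proj₁_of_mem₂ hp hY, map_zero, mul_zero, zero_add, QY, mul_one] at gY
  exact ⟨x₁, x₂, isDiagonal_of_form_eq hp (gX ▸ g.pos X (Q.ne_zero_of_form_eq_one QX))
    (gY ▸ g.pos Y (Q.ne_zero_of_form_eq_one QY)) g_eq⟩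

end DiagonalMetrics

section Isotropy

variable {E : Type*} [NormedAddCommGroup E] [NormedSpace ℝ E] [FiniteDimensional ℝ E]
  [CompleteSpace E]
  {G : Type*} [TopologicalSpace G] [ChartedSpace E G] [Group G] [LieGroup 𝓘(ℝ, E) ∞ G]
  {K : Subgroup G} {p : Submodule ℝ (GroupLieAlgebra 𝓘(ℝ, E) G)}

local notation "𝔤" => GroupLieAlgebra 𝓘(ℝ, E) G

theorem InvariantMetric.isotropySkew (h : IsCompl p (lieAlgebraOf K)) (hp : IsAdInvariant K p)
    (g : InvariantMetric K p) : IsotropySkew h g.toScalarProduct := by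
  intro X Y Z W
  have mem_k := SetLike.coe_mem ((lieAlgebraOf K).projectionOnto p h.symm ⁅(X : 𝔤), (Y : 𝔤)⁆)
  have coe_isotropyTerm (V : p) : (isotropyTerm h X Y V : 𝔤) =
      ⁅((lieAlgebraOf K).projectionOnto p h.symm ⁅(X : 𝔤), (Y : 𝔤)⁆ : 𝔤), (V : 𝔤)⁆ :=
    congrArg Subtype.val (Submodule.projectionOnto_apply_left h ⟨_, hp.lie_mem mem_k V.2⟩)
  exact eq_neg_of_add_eq_zero_left
    (g.skew hp mem_k Z W _ _ (coe_isotropyTerm Z) (coe_isotropyTerm W))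

/-- The automorphism `Ad(a)` of an `Ad(K)`-invariant subspace, for `a ∈ K`. -/
def IsAdInvariant.equiv (hp : IsAdInvariant K p) {a : G} (ha : a ∈ K) : p ≃ₗ[ℝ] p where
  toLinearMap := (Ad a).restrict (hp a ha)
  invFun X := ⟨Ad a⁻¹ X, hp _ (K.inv_mem ha) X X.2⟩
  left_inv _ := Subtype.ext (Ad_inv_Ad a _)
  right_inv _ := Subtype.ext (Ad_Ad_inv a _)

theorem InvariantMetric.isAdInvariantForm_ricciForm (h : IsCompl p (lieAlgebraOf K))
    (hp : IsAdInvariant K p) (g : InvariantMetric K p) :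
    IsAdInvariantForm K (ricciForm h g.toScalarProduct) := by
  intro a ha X X' Y Y' hX hY
  obtain rfl : X' = hp.equiv ha X := Subtype.ext hX
  obtain rfl : Y' = hp.equiv ha Y := Subtype.ext hY
  rw [ricciForm_apply, ricciForm_apply]
  exact ricci_map (A := (AdEquiv a).toLieHom) (σ := hp.equiv ha)
    (fun Z hZ => isAdInvariant_lieAlgebraOf a ha Z hZ) (fun _ => rfl)
    (fun X Y => g.invariant a ha X _ Y _ rfl rfl) X Y

end Isotropy

section KillingForm

variable {L : Type*} [LieRing L] [LieAlgebra ℝ L] {p k : Submodule ℝ L} (h : IsCompl p k)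

theorem killingForm_projectionOnto_left
    (orthogonal : ∀ X ∈ p, ∀ Z ∈ k, killingForm ℝ L X Z = 0) (V : L) {X : L} (hX : X ∈ p) :
    killingForm ℝ L (p.projectionOnto k h V) X = killingForm ℝ L V X := by
  conv_rhs => rw [← projectionOnto_add_projectionOnto h V, map_add, LinearMap.add_apply,
    LieModule.traceForm_comm ℝ L L (k.projectionOnto p h.symm V : L),
    orthogonal X hX _ (SetLike.coe_mem _), add_zero]

theorem killingForm_projectionOnto_right
    (orthogonal : ∀ X ∈ p, ∀ Z ∈ k, killingForm ℝ L X Z = 0) (V : L) {Z : L} (hZ : Z ∈ k) :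
    killingForm ℝ L (k.projectionOnto p h.symm V) Z = killingForm ℝ L V Z := by
  conv_rhs => rw [← projectionOnto_add_projectionOnto h V, map_add, LinearMap.add_apply,
    orthogonal _ (SetLike.coe_mem _) Z hZ, zero_add]

end KillingForm

section TwoSummandPair

variable {E : Type*} [NormedAddCommGroup E] [NormedSpace ℝ E] [CompleteSpace E]
  {G : Type*} [TopologicalSpace G] [ChartedSpace E G] [Group G] [LieGroup 𝓘(ℝ, E) ∞ G]
  {K H : Subgroup G} {p₁ p₂ : Submodule ℝ (GroupLieAlgebra 𝓘(ℝ, E) G)}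

local notation "𝔤" => GroupLieAlgebra 𝓘(ℝ, E) G
local notation "κ" => killingForm ℝ (GroupLieAlgebra 𝓘(ℝ, E) G)

theorem IsDiagonal.isSplitMetric {Q g : InvariantMetric K (p₁ ⊔ p₂)} (hp : Disjoint p₁ p₂)
    {β : ScalarProduct ↥(p₁ ⊔ p₂)} {b₁ b₂ x₁ x₂ : ℝ} (hb₁ : b₁ ≠ 0) (hb₂ : b₂ ≠ 0)
    (hg : IsDiagonal Q g x₁ x₂) (hβ : ∀ X Y, β.form X Y =
      b₁ * Q.form (proj₁ hp X) (proj₁ hp Y) + b₂ * Q.form (proj₂ hp X) (proj₂ hp Y)) :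
    IsSplitMetric (isCompl_submoduleOf_sup hp) β g.toScalarProduct (x₁ / b₁) (x₂ / b₂) := by
  intro X Y
  have β_proj₁ : β.form (proj₁ hp X) (proj₁ hp Y) = b₁ * Q.form (proj₁ hp X) (proj₁ hp Y) := by
    rw [hβ, proj₁_of_mem₁ hp (proj₁_mem hp X), proj₁_of_mem₁ hp (proj₁_mem hp Y),
      proj₂_of_mem₁ hp (proj₁_mem hp Y), map_zero, mul_zero, add_zero]
  have β_proj₂ : β.form (proj₂ hp X) (proj₂ hp Y) = b₂ * Q.form (proj₂ hp X) (proj₂ hp Y) := by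
    rw [hβ, proj₂_of_mem₂ hp (proj₂_mem hp X), proj₂_of_mem₂ hp (proj₂_mem hp Y),
      proj₁_of_mem₂ hp (proj₂_mem hp Y), map_zero, mul_zero, zero_add]
  change g.form X Y = x₁ / b₁ * β.form (proj₁ hp X) (proj₁ hp Y) +
    x₂ / b₂ * β.form (proj₂ hp X) (proj₂ hp Y)
  rw [hg.form_eq hp, β_proj₁, β_proj₂, ← mul_assoc, ← mul_assoc, div_mul_cancel₀ _ hb₁,
    div_mul_cancel₀ _ hb₂]

/-- The infinitesimal part of `IsTwoSummandSpace`: `𝔭₁` and `𝔭₂` are inequivalent irreducible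
representations of `K` whose sum is a `κ`-orthogonal complement of `𝔨`. Of the intermediate group
`H` only `[𝔭₁, 𝔭₁] ⊆ 𝔨 ⊕ 𝔭₁` is kept, so that nothing is required of the topology of `G/K`. -/
structure IsTwoSummandPair (K : Subgroup G) (p₁ p₂ : Submodule ℝ (GroupLieAlgebra 𝓘(ℝ, E) G)) :
    Prop where
  disjoint : Disjoint p₁ p₂
  isCompl : IsCompl (p₁ ⊔ p₂) (lieAlgebraOf K)
  orthogonal : ∀ X ∈ p₁ ⊔ p₂, ∀ Z ∈ lieAlgebraOf (E := E) K,
    killingForm ℝ (GroupLieAlgebra 𝓘(ℝ, E) G) X Z = 0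
  irreducible₁ : IsAdIrreducible K p₁
  irreducible₂ : IsAdIrreducible K p₂
  inequivalent : ¬ AdEquivalent K p₁ p₂
  lie_mem : ∀ X ∈ p₁, ∀ Y ∈ p₁, ⁅X, Y⁆ ∈ lieAlgebraOf K ⊔ p₁

theorem IsTwoSummandSpace.isTwoSummandPair [FiniteDimensional ℝ E]
    (hM : IsTwoSummandSpace K H p₁ p₂) : IsTwoSummandPair K p₁ p₂ where
  disjoint := hM.disjoint
  isCompl := hM.isCompl
  orthogonal := hM.orthogonal
  irreducible₁ := hM.irreducible₁
  irreducible₂ := hM.irreducible₂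
  inequivalent := hM.inequivalent
  lie_mem X hX Y hY := by
    rw [← hM.lieAlgebra_H]
    have le_lieAlgebraOf_H : p₁ ≤ lieAlgebraOf H := hM.lieAlgebra_H ▸ le_sup_right
    exact isAdInvariant_lieAlgebraOf.lie_mem (le_lieAlgebraOf_H hX) (le_lieAlgebraOf_H hY)

namespace IsTwoSummandPair

section Summands

variable (hM : IsTwoSummandPair K p₁ p₂)
include hM

theorem isAdInvariant : IsAdInvariant K (p₁ ⊔ p₂) :=
  hM.irreducible₁.1.sup hM.irreducible₂.1

theorem exists_diagonal_family (Q : InvariantMetric K (p₁ ⊔ p₂)) {x₁ x₂ : ℝ → ℝ} {J : Set ℝ}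
    (h₁ : ∀ t ∈ J, 0 < x₁ t) (h₂ : ∀ t ∈ J, 0 < x₂ t) :
    ∃ g : ℝ → InvariantMetric K (p₁ ⊔ p₂), ∀ t ∈ J, IsDiagonal Q (g t) (x₁ t) (x₂ t) := by
  classical
  refine ⟨fun t => if ht : t ∈ J then diagonalMetric hM.disjoint hM.irreducible₁.1
    hM.irreducible₂.1 Q (h₁ t ht) (h₂ t ht) else Q, fun t ht => ?_⟩
  simp only [dif_pos ht]
  exact isDiagonal_diagonalMetric _ _ _ Q (h₁ t ht) (h₂ t ht)

theorem scale_eq {Q g : InvariantMetric K (p₁ ⊔ p₂)} {x₁ x₂ z₁ z₂ : ℝ}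
    (hx : IsDiagonal Q g x₁ x₂) (hz : IsDiagonal Q g z₁ z₂) : x₁ = z₁ ∧ x₂ = z₂ := by
  obtain ⟨U, hU, QU⟩ := Q.exists_form_self_eq_one hM.irreducible₁.2.1 (le_sup_left (b := p₂))
  obtain ⟨V, hV, QV⟩ := Q.exists_form_self_eq_one hM.irreducible₂.2.1 (le_sup_right (a := p₁))
  exact ⟨(hx.form_self₁ hU QU).symm.trans (hz.form_self₁ hU QU),
    (hx.form_self₂ hV QV).symm.trans (hz.form_self₂ hV QV)⟩

theorem brP_mem {X Y : ↥(p₁ ⊔ p₂)} (hX : (X : 𝔤) ∈ p₁) (hY : (Y : 𝔤) ∈ p₁) :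
    (brP hM.isCompl X Y : 𝔤) ∈ p₁ := by
  obtain ⟨Z, hZ, W, hW, lie_eq⟩ := Submodule.mem_sup.1 (hM.lie_mem X hX Y hY)
  rw [brP_apply, ← lie_eq, map_add, Submodule.projectionOnto_apply_right hM.isCompl ⟨Z, hZ⟩,
    zero_add,
    Submodule.projectionOnto_apply_left hM.isCompl ⟨W, le_sup_left (a := p₁) hW⟩]
  exact hW

theorem brP_skew {β : ScalarProduct ↥(p₁ ⊔ p₂)} (hβ : ∀ X Y, β.form X Y = -κ X Y)
    (X Y Z : ↥(p₁ ⊔ p₂)) :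
    β.form (brP hM.isCompl X Y) Z = -β.form Y (brP hM.isCompl X Z) := by
  rw [hβ, hβ, brP_apply, brP_apply, LieModule.traceForm_comm ℝ 𝔤 𝔤 (Y : 𝔤),
    killingForm_projectionOnto_left hM.isCompl hM.orthogonal _ Z.2,
    killingForm_projectionOnto_left hM.isCompl hM.orthogonal _ Y.2,
    LieModule.traceForm_comm ℝ 𝔤 𝔤 _ (Y : 𝔤), ← lie_skew (X : 𝔤) (Y : 𝔤), map_neg,
    LinearMap.neg_apply, LieModule.traceForm_apply_lie_apply]

variable [FiniteDimensional ℝ E]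

theorem lie_eq_zero_of_mem_radical {β : ScalarProduct ↥(p₁ ⊔ p₂)}
    (hβ : ∀ X Y, β.form X Y = -κ X Y) {Z V : 𝔤} (hZ : Z ∈ lieAlgebraOf K)
    (radical : ∀ W, κ Z W = 0) (hV : V ∈ p₁ ⊔ p₂) : ⁅Z, V⁆ = 0 := by
  let U : ↥(p₁ ⊔ p₂) := ⟨⁅Z, V⁆, hM.isAdInvariant.lie_mem hZ hV⟩
  have form_self : β.form U U = 0 := by
    rw [hβ, neg_eq_zero]
    exact (LieModule.traceForm_apply_lie_apply ℝ 𝔤 𝔤 Z V ⁅Z, V⁆).trans (radical _)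
  have U_eq_zero : U = 0 := by
    by_contra U_ne
    exact (β.pos U U_ne).ne' form_self
  exact congrArg Subtype.val U_eq_zero

theorem killingForm_eq_zero (Q : InvariantMetric K (p₁ ⊔ p₂)) {X Y : 𝔤} (hX : X ∈ p₁)
    (hY : Y ∈ p₂) : κ X Y = 0 := by
  let f : LinearMap.BilinForm ℝ ↥(p₁ ⊔ p₂) :=
    LinearMap.compl₁₂ κ (p₁ ⊔ p₂).subtype (p₁ ⊔ p₂).subtype
  have hf : IsAdInvariantForm K f := by
    intro a _ X X' Y Y' hX hY
    change κ X' Y' = κ X Y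
    rw [hX, hY, killingForm_Ad]
  exact hf.eq_zero_of_mem hM.irreducible₁ hM.irreducible₂ hM.inequivalent Q
    (X := ⟨X, le_sup_left (a := p₁) hX⟩) (Y := ⟨Y, le_sup_right (a := p₁) hY⟩) hX hY

theorem killingForm_projectionOnto_lie_eq_zero (Q : InvariantMetric K (p₁ ⊔ p₂)) {X Y : 𝔤}
    (hX : X ∈ p₁) (hY : Y ∈ p₂) (W : 𝔤) :
    κ ((lieAlgebraOf K).projectionOnto _ hM.isCompl.symm ⁅X, Y⁆ : 𝔤) W = 0 := by
  have mem_k := SetLike.coe_mem ((lieAlgebraOf K).projectionOnto _ hM.isCompl.symm W)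
  rw [LieModule.traceForm_comm,
    ← killingForm_projectionOnto_right hM.isCompl hM.orthogonal W (SetLike.coe_mem _),
    LieModule.traceForm_comm, killingForm_projectionOnto_right hM.isCompl hM.orthogonal _ mem_k,
    LieModule.traceForm_apply_lie_apply, ← lie_skew, map_neg, neg_eq_zero]
  exact hM.killingForm_eq_zero Q hX (hM.irreducible₂.1.lie_mem mem_k hY)

-- The `𝔨`-component of `[X, Y]` lies in the radical of the Killing form, so it acts trivially.
theorem isotropyTerm_eq_zero (Q : InvariantMetric K (p₁ ⊔ p₂)) {β : ScalarProduct ↥(p₁ ⊔ p₂)}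
    (hβ : ∀ X Y, β.form X Y = -κ X Y) {X Y : ↥(p₁ ⊔ p₂)} (hX : (X : 𝔤) ∈ p₁)
    (hY : (Y : 𝔤) ∈ p₂) (Z : ↥(p₁ ⊔ p₂)) : isotropyTerm hM.isCompl X Y Z = 0 := by
  rw [isotropyTerm, hM.lie_eq_zero_of_mem_radical hβ (SetLike.coe_mem _)
    (hM.killingForm_projectionOnto_lie_eq_zero Q hX hY) Z.2, map_zero]

theorem isSplitting (Q : InvariantMetric K (p₁ ⊔ p₂)) {β : ScalarProduct ↥(p₁ ⊔ p₂)}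
    (hβ : ∀ X Y, β.form X Y = -κ X Y) :
    IsSplitting hM.isCompl (isCompl_submoduleOf_sup hM.disjoint) β where
  skew := hM.brP_skew hβ
  orthogonal X hX Y hY := (hβ X Y).trans (neg_eq_zero.2 (hM.killingForm_eq_zero Q hX hY))
  brP_mem _ hX _ hY := hM.brP_mem hX hY
  isotropyTerm_eq_zero _ hX _ hY := hM.isotropyTerm_eq_zero Q hβ hX hY

theorem exists_scalarProduct_eq_neg_killingForm {Q : InvariantMetric K (p₁ ⊔ p₂)}
    (hQ : IsBackground Q) : ∃ b₁ b₂ : ℝ, 0 < b₁ ∧ 0 < b₂ ∧ ∃ β : ScalarProduct ↥(p₁ ⊔ p₂),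
      (∀ X Y, β.form X Y = -κ X Y) ∧ ∀ X Y, β.form X Y =
        b₁ * Q.form (proj₁ hM.disjoint X) (proj₁ hM.disjoint Y) +
        b₂ * Q.form (proj₂ hM.disjoint X) (proj₂ hM.disjoint Y) := by
  obtain ⟨b₁, b₂, hb₁, hb₂, h₁, h₂⟩ := hQ
  let f : LinearMap.BilinForm ℝ ↥(p₁ ⊔ p₂) :=
    -LinearMap.compl₁₂ κ (p₁ ⊔ p₂).subtype (p₁ ⊔ p₂).subtype
  have f_symm (X Y : ↥(p₁ ⊔ p₂)) : f X Y = f Y X :=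
    congrArg Neg.neg (LieModule.traceForm_comm ℝ 𝔤 𝔤 (X : 𝔤) (Y : 𝔤))
  have f_eq := form_eq_add_of_orthogonal hM.disjoint f_symm (f₁ := b₁ • Q.form) (f₂ := b₂ • Q.form)
    h₁ h₂ fun X Y hX hY => neg_eq_zero.2 (hM.killingForm_eq_zero Q hX hY)
  refine ⟨b₁, b₂, hb₁, hb₂, ⟨f, f_symm, fun X hX => ?_⟩, fun _ _ => rfl, f_eq⟩
  rw [f_eq]
  exact Q.form_proj_pos hM.disjoint hb₁ hb₂ hX

theorem exists_isDiagonal (Q g : InvariantMetric K (p₁ ⊔ p₂)) :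
    ∃ x₁ x₂ : ℝ, IsDiagonal Q g x₁ x₂ :=
  HomRicci.exists_isDiagonal hM.disjoint hM.irreducible₁ hM.irreducible₂ hM.inequivalent Q g

theorem exists_ricci_eq_add (Q g : InvariantMetric K (p₁ ⊔ p₂)) : ∃ c₁ c₂ : ℝ, ∀ X Y,
    ricci hM.isCompl g.toScalarProduct X Y =
      c₁ * Q.form (proj₁ hM.disjoint X) (proj₁ hM.disjoint Y) +
      c₂ * Q.form (proj₂ hM.disjoint X) (proj₂ hM.disjoint Y) := by
  have symm := ricci_symm (g.isotropySkew hM.isCompl hM.isAdInvariant)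
  simp only [← ricciForm_apply] at symm ⊢
  exact (g.isAdInvariantForm_ricciForm hM.isCompl hM.isAdInvariant).exists_eq_add hM.disjoint
    hM.irreducible₁ hM.irreducible₂ hM.inequivalent Q symm

end Summands

/-- The Ricci tensor of every metric `x₁ Q|𝔭₁ ⊕ x₂ Q|𝔭₂` is
`(A + B y²) Q|𝔭₁ ⊕ (C - D y) Q|𝔭₂` with `y = x₁ / x₂`. -/
def HasRicciCoefficients [FiniteDimensional ℝ E] (hM : IsTwoSummandPair K p₁ p₂)
    (Q : InvariantMetric K (p₁ ⊔ p₂)) (A B C D : ℝ) : Prop :=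
  ∀ (g : InvariantMetric K (p₁ ⊔ p₂)) (x₁ x₂ : ℝ), IsDiagonal Q g x₁ x₂ → ∀ X Y,
    ricci hM.isCompl g.toScalarProduct X Y =
      (A + B * (x₁ / x₂) ^ 2) * Q.form (proj₁ hM.disjoint X) (proj₁ hM.disjoint Y) +
      (C - D * (x₁ / x₂)) * Q.form (proj₂ hM.disjoint X) (proj₂ hM.disjoint Y)

theorem exists_hasRicciCoefficients [FiniteDimensional ℝ E] (hM : IsTwoSummandPair K p₁ p₂)
    {Q : InvariantMetric K (p₁ ⊔ p₂)} (hQ : IsBackground Q) :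
    ∃ A B C D : ℝ, 0 ≤ B ∧ 0 ≤ D ∧ HasRicciCoefficients hM Q A B C D := by
  have hp := hM.disjoint
  obtain ⟨b₁, b₂, hb₁, hb₂, β, hβ, hβQ⟩ := hM.exists_scalarProduct_eq_neg_killingForm hQ
  obtain ⟨U, hU, QU⟩ := Q.exists_form_self_eq_one hM.irreducible₁.2.1 (le_sup_left (b := p₂))
  obtain ⟨V, hV, QV⟩ := Q.exists_form_self_eq_one hM.irreducible₂.2.1 (le_sup_right (a := p₁))
  obtain ⟨A, B, hB, ricci_U⟩ := (hM.isSplitting Q hβ).exists_ricci_eq_of_mem₁ hU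
  obtain ⟨C, D, hD, ricci_V⟩ := (hM.isSplitting Q hβ).exists_ricci_eq_of_mem₂ hV
  refine ⟨A, B * (b₂ / b₁) ^ 2, C, D * (b₂ / b₁), by positivity, by positivity,
    fun g x₁ x₂ hg X Y => ?_⟩
  have split := hg.isSplitMetric hp hb₁.ne' hb₂.ne' hβQ
  have ratio : x₁ / b₁ / (x₂ / b₂) = b₂ / b₁ * (x₁ / x₂) := by
    rw [div_div_div_eq, div_mul_div_comm, mul_comm x₁]
  have scale_ne := (div_pos hg.2.1 hb₂).ne'
  obtain ⟨c₁, c₂, ricci_eq⟩ := hM.exists_ricci_eq_add Q g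
  have c₁_eq : A + B * (b₂ / b₁ * (x₁ / x₂)) ^ 2 = c₁ := by
    rw [← ratio, ← ricci_U _ _ _ split scale_ne, ricci_eq, proj₁_of_mem₁ hp hU,
      proj₂_of_mem₁ hp hU, map_zero, QU, mul_one, mul_zero, add_zero]
  have c₂_eq : C - D * (b₂ / b₁ * (x₁ / x₂)) = c₂ := by
    rw [← ratio, ← ricci_V _ _ _ split scale_ne, ricci_eq, proj₂_of_mem₂ hp hV,
      proj₁_of_mem₂ hp hV, map_zero, QV, mul_one, mul_zero, zero_add]
  rw [ricci_eq, ← c₁_eq, ← c₂_eq, mul_pow, mul_assoc B, mul_assoc D]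

end IsTwoSummandPair
end TwoSummandPair

section AutonomousODE

theorem eqOn_Ico_of_hasDerivWithinAt {F : Type*} [NormedAddCommGroup F] [NormedSpace ℝ F]
    {v : F → F} {U : Set F} (hv : ∀ x ∈ U, ContDiffAt ℝ 1 v x) {f g : ℝ → F} {a b : ℝ}
    (hf : ∀ t ∈ Ico a b, HasDerivWithinAt f (v (f t)) (Ico a b) t) (hfU : MapsTo f (Ico a b) U)
    (hg : ∀ t ∈ Ico a b, HasDerivWithinAt g (v (g t)) (Ico a b) t) (hgU : MapsTo g (Ico a b) U)
    (eq_left : f a = g a) : EqOn f g (Ico a b) := by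
  intro c hc
  have Icc_subset : Icc a c ⊆ Ico a b := Icc_subset_Ico_right hc.2
  have continuousOn {u : ℝ → F} (hu : ∀ t ∈ Ico a b, HasDerivWithinAt u (v (u t)) (Ico a b) t) :
      ContinuousOn u (Icc a c) := fun t ht =>
    ((hu t (Icc_subset ht)).mono Icc_subset).continuousWithinAt
  have right_deriv {u : ℝ → F} (hu : ∀ t ∈ Ico a b, HasDerivWithinAt u (v (u t)) (Ico a b) t) :
      ∀ t ∈ Ico a c, HasDerivWithinAt u (v (u t)) (Ici t) t := fun t ht =>
    (hu t (Icc_subset (Ico_subset_Icc_self ht))).mono_of_mem_nhdsWithin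
      (mem_of_superset (Ico_mem_nhdsGE (ht.2.trans hc.2)) (Ico_subset_Ico_left ht.1))
  let S := f '' Icc a c ∪ g '' Icc a c
  have S_subset : S ⊆ U :=
    union_subset (hfU.mono_left Icc_subset).image_subset (hgU.mono_left Icc_subset).image_subset
  have S_compact : IsCompact S := (isCompact_Icc.image_of_continuousOn (continuousOn hf)).union
    (isCompact_Icc.image_of_continuousOn (continuousOn hg))
  have locallyLipschitz : LocallyLipschitzOn S v := by
    intro x hx
    obtain ⟨L, N, hN, hL⟩ := (hv x (S_subset hx)).exists_lipschitzOnWith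
    exact ⟨L, N, mem_nhdsWithin_of_mem_nhds hN, hL⟩
  obtain ⟨L, hL⟩ := locallyLipschitz.exists_lipschitzOnWith_of_compact S_compact
  exact ODE_solution_unique_of_mem_Icc_right (v := fun _ => v) (s := fun _ => S) (fun _ _ => hL)
    (continuousOn hf) (right_deriv hf)
    (fun t ht => Or.inl (mem_image_of_mem f (Ico_subset_Icc_self ht)))
    (continuousOn hg) (right_deriv hg)
    (fun t ht => Or.inr (mem_image_of_mem g (Ico_subset_Icc_self ht)))
    eq_left (right_mem_Icc.2 hc.1)

theorem surjective_of_hasDerivAt_of_le {τ τ' : ℝ → ℝ} (hτ : ∀ x, HasDerivAt τ (τ' x) x) {m : ℝ}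
    (hm : 0 < m) (le_deriv : ∀ x, m ≤ τ' x) : Function.Surjective τ := by
  have mono : Monotone fun x => τ x - m * x :=
    monotone_of_hasDerivAt_nonneg
      (fun x => (hτ x).sub ((hasDerivAt_id x).const_mul m)) fun x => by
        rw [mul_one]
        exact sub_nonneg.2 (le_deriv x)
  have linear_atTop := tendsto_atTop_add_const_left atTop (τ 0) (tendsto_id.const_mul_atTop hm)
  have linear_atBot := tendsto_atBot_add_const_left atBot (τ 0) (tendsto_id.const_mul_atBot hm)
  refine (continuous_iff_continuousAt.2 fun x => (hτ x).continuousAt).surjective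
    (tendsto_atTop_mono' _ ?_ linear_atTop) (tendsto_atBot_mono' _ ?_ linear_atBot)
  · filter_upwards [eventually_ge_atTop 0] with x hx
    simpa [le_sub_iff_add_le] using mono hx
  · filter_upwards [eventually_le_atBot 0] with x hx
    simpa [sub_le_iff_le_add] using mono hx

-- Separation of variables: the solution inverts `x ↦ ∫₀ˣ 1 / f`.
theorem exists_strictMono_surjective_hasDerivAt {f : ℝ → ℝ} (hf : Continuous f)
    (f_pos : ∀ x, 0 < f x) {M : ℝ} (f_le : ∀ x, f x ≤ M) :
    ∃ u : ℝ → ℝ, u 0 = 0 ∧ StrictMono u ∧ Function.Surjective u ∧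
      ∀ t, HasDerivAt u (f (u t)) t := by
  let τ : ℝ → ℝ := fun s => ∫ x in (0 : ℝ)..s, (f x)⁻¹
  have hτ (s : ℝ) : HasDerivAt τ (f s)⁻¹ s :=
    ((hf.inv₀ fun x => (f_pos x).ne').integral_hasStrictDerivAt 0 s).hasDerivAt
  have τ_strictMono : StrictMono τ := strictMono_of_hasDerivAt_pos hτ fun s => inv_pos.2 (f_pos s)
  have τ_surjective : Function.Surjective τ :=
    surjective_of_hasDerivAt_of_le hτ (inv_pos.2 ((f_pos 0).trans_le (f_le 0)))
      fun s => inv_anti₀ (f_pos s) (f_le s)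
  let e := τ_strictMono.orderIsoOfSurjective τ τ_surjective
  refine ⟨e.symm, ?_, e.symm.strictMono, e.symm.surjective, fun t => ?_⟩
  · rw [OrderIso.symm_apply_eq]
    exact intervalIntegral.integral_same.symm
  · rw [← inv_inv (f (e.symm t))]
    exact HasDerivAt.of_local_left_inverse e.symm.continuous.continuousAt (hτ (e.symm t))
      (inv_pos.2 (f_pos _)).ne' (Eventually.of_forall e.apply_symm_apply)

theorem exists_descent_to_zero {f : ℝ → ℝ} {s₀ : ℝ} (hs₀ : 0 < s₀)
    (hf : ContinuousOn f (Icc 0 s₀)) (f_pos : ∀ x ∈ Icc 0 s₀, 0 < f x) :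
    ∃ T : ℝ, 0 < T ∧ ∃ s : ℝ → ℝ, Continuous s ∧ s 0 = s₀ ∧ s T = 0 ∧
      ∀ t ∈ Ico 0 T, s t ∈ Ioc 0 s₀ ∧ HasDerivAt s (-f (s t)) t := by
  let F : ℝ → ℝ := IccExtend hs₀.le ((Icc 0 s₀).domRestrict f)
  obtain ⟨M, hM⟩ := isCompact_Icc.exists_bound_of_continuousOn hf
  obtain ⟨u, u_zero, u_strictMono, u_surjective, hu⟩ :=
    exists_strictMono_surjective_hasDerivAt (f := F) hf.domRestrict.Icc_extend'
      (fun x => f_pos _ (projIcc 0 s₀ hs₀.le x).2)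
      fun x => (le_abs_self _).trans (hM _ (projIcc 0 s₀ hs₀.le x).2)
  obtain ⟨T, hT⟩ := u_surjective s₀
  have u_continuous : Continuous u := continuous_iff_continuousAt.2 fun t => (hu t).continuousAt
  have T_pos : 0 < T := u_strictMono.lt_iff_lt.1 (by rwa [u_zero, hT])
  refine ⟨T, T_pos, fun t => u (T - t), u_continuous.comp (continuous_const.sub continuous_id),
    (congrArg u (sub_zero T)).trans hT, (congrArg u (sub_self T)).trans u_zero, fun t ht => ?_⟩
  have u_mem : u (T - t) ∈ Ioc 0 s₀ :=
    ⟨u_zero ▸ u_strictMono (sub_pos.2 ht.2), hT ▸ u_strictMono.monotone (sub_le_self T ht.1)⟩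
  have F_eq : F (u (T - t)) = f (u (T - t)) :=
    IccExtend_of_mem hs₀.le _ (Ioc_subset_Icc_self u_mem)
  exact ⟨u_mem, F_eq ▸ (hu (T - t)).comp_const_sub T t⟩

end AutonomousODE

section DiagonalFlow

/-- The Einstein equation `A + B y² = y (C - D y)` for the ratio `y` of a diagonal metric has the
positive roots `y₁ < y₂` and no others. -/
structure HasEinsteinRatios (A B C D y₁ y₂ : ℝ) : Prop where
  nonneg_B : 0 ≤ B
  nonneg_D : 0 ≤ D
  pos : 0 < B + D
  pos₁ : 0 < y₁
  lt : y₁ < y₂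
  A_eq : A = (B + D) * (y₁ * y₂)
  C_eq : C = (B + D) * (y₁ + y₂)

theorem hasEinsteinRatios_of_forall {A B C D y₁ y₂ : ℝ} (hB : 0 ≤ B) (hD : 0 ≤ D) (hy₁ : 0 < y₁)
    (hy : y₁ < y₂) (h : ∀ y, 0 < y → (A + B * y ^ 2 = y * (C - D * y) ↔ y = y₁ ∨ y = y₂)) :
    HasEinsteinRatios A B C D y₁ y₂ := by
  have root₁ := (h y₁ hy₁).2 (Or.inl rfl)
  have root₂ := (h y₂ (hy₁.trans hy)).2 (Or.inr rfl)
  have C_eq : C = (B + D) * (y₁ + y₂) :=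
    mul_left_cancel₀ (sub_pos.2 hy).ne' (by linear_combination root₁ - root₂)
  have A_eq : A = (B + D) * (y₁ * y₂) := by
    linear_combination root₁ + y₁ * C_eq
  refine ⟨hB, hD, lt_of_le_of_ne (add_nonneg hB hD) fun sum_eq_zero => ?_, hy₁, hy, A_eq, C_eq⟩
  have B_eq_zero : B = 0 := by linarith
  have D_eq_zero : D = 0 := by linarith
  -- Otherwise `A = B = C = D = 0`, and every `y` is a root.
  have root := (h (y₁ + y₂) (by linarith)).1 (by rw [A_eq, C_eq, B_eq_zero, D_eq_zero]; ring)
  rcases root with eq | eq <;> linarith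

theorem HasEinsteinRatios.A_pos {A B C D y₁ y₂ : ℝ} (hE : HasEinsteinRatios A B C D y₁ y₂) :
    0 < A :=
  hE.A_eq ▸ mul_pos hE.pos (mul_pos hE.pos₁ (hE.pos₁.trans hE.lt))

theorem HasEinsteinRatios.C_pos {A B C D y₁ y₂ : ℝ} (hE : HasEinsteinRatios A B C D y₁ y₂) :
    0 < C :=
  hE.C_eq ▸ mul_pos hE.pos (add_pos hE.pos₁ (hE.pos₁.trans hE.lt))

/-- The Ricci flow `x₁' = -2 (A + B y²)`, `x₂' = -2 (C - D y)`, `y = x₁ / x₂`, for diagonal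
metrics. -/
structure IsDiagonalFlow (A B C D : ℝ) (x₁ x₂ : ℝ → ℝ) (J : Set ℝ) : Prop where
  pos₁ : ∀ t ∈ J, 0 < x₁ t
  pos₂ : ∀ t ∈ J, 0 < x₂ t
  deriv₁ : ∀ t ∈ J, HasDerivWithinAt x₁ (-2 * (A + B * (x₁ t / x₂ t) ^ 2)) J t
  deriv₂ : ∀ t ∈ J, HasDerivWithinAt x₂ (-2 * (C - D * (x₁ t / x₂ t))) J t

variable {A B C D y₁ y₂ : ℝ} {x₁ x₂ z₁ z₂ : ℝ → ℝ} {J : Set ℝ}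

theorem isDiagonalFlow_of_ratio (hE : HasEinsteinRatios A B C D y₁ y₂) {y : ℝ → ℝ}
    (y_pos : ∀ t ∈ J, 0 < y t) (x₂_pos : ∀ t ∈ J, 0 < x₂ t)
    (y_deriv : ∀ t ∈ J,
      HasDerivWithinAt y (-(2 * (B + D) * (y t - y₁) * (y t - y₂) / x₂ t)) J t)
    (x₂_deriv : ∀ t ∈ J, HasDerivWithinAt x₂ (-2 * (C - D * y t)) J t) :
    IsDiagonalFlow A B C D (fun t => y t * x₂ t) x₂ J := by
  have ratio (t : ℝ) (ht : t ∈ J) : y t * x₂ t / x₂ t = y t :=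
    mul_div_cancel_right₀ _ (x₂_pos t ht).ne'
  refine ⟨fun t ht => mul_pos (y_pos t ht) (x₂_pos t ht), x₂_pos, fun t ht => ?_, fun t ht => ?_⟩
  · refine ((y_deriv t ht).mul (x₂_deriv t ht)).congr_deriv ?_
    have x₂_ne := (x₂_pos t ht).ne'
    rw [ratio t ht, hE.A_eq, hE.C_eq]
    field_simp
    ring
  · rw [ratio t ht]
    exact x₂_deriv t ht

namespace IsDiagonalFlow

theorem mono {J' : Set ℝ} (h : IsDiagonalFlow A B C D x₁ x₂ J) (hJ : J' ⊆ J) :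
    IsDiagonalFlow A B C D x₁ x₂ J' where
  pos₁ t ht := h.pos₁ t (hJ ht)
  pos₂ t ht := h.pos₂ t (hJ ht)
  deriv₁ t ht := (h.deriv₁ t (hJ ht)).mono hJ
  deriv₂ t ht := (h.deriv₂ t (hJ ht)).mono hJ

theorem eqOn {a b : ℝ} (hx : IsDiagonalFlow A B C D x₁ x₂ (Ico a b))
    (hz : IsDiagonalFlow A B C D z₁ z₂ (Ico a b)) (eq₁ : x₁ a = z₁ a) (eq₂ : x₂ a = z₂ a) :
    EqOn x₁ z₁ (Ico a b) ∧ EqOn x₂ z₂ (Ico a b) := by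
  let v : ℝ × ℝ → ℝ × ℝ :=
    fun x => (-2 * (A + B * (x.1 / x.2) ^ 2), -2 * (C - D * (x.1 / x.2)))
  have hv (x : ℝ × ℝ) (hx : x ∈ {x : ℝ × ℝ | x.2 ≠ 0}) : ContDiffAt ℝ 1 v x := by
    have ratio : ContDiffAt ℝ 1 (fun x : ℝ × ℝ => x.1 / x.2) x :=
      contDiffAt_fst.div contDiffAt_snd hx
    exact (contDiffAt_const.mul (contDiffAt_const.add (contDiffAt_const.mul (ratio.pow 2)))).prodMk
      (contDiffAt_const.mul (contDiffAt_const.sub (contDiffAt_const.mul ratio)))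
  have pair_eqOn : EqOn (fun t => (x₁ t, x₂ t)) (fun t => (z₁ t, z₂ t)) (Ico a b) :=
    eqOn_Ico_of_hasDerivWithinAt hv
      (fun t ht => (hx.deriv₁ t ht).prodMk (hx.deriv₂ t ht)) (fun t ht => (hx.pos₂ t ht).ne')
      (fun t ht => (hz.deriv₁ t ht).prodMk (hz.deriv₂ t ht)) (fun t ht => (hz.pos₂ t ht).ne')
      (Prod.ext eq₁ eq₂)
  exact ⟨fun t ht => congrArg Prod.fst (pair_eqOn ht), fun t ht => congrArg Prod.snd (pair_eqOn ht)⟩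

theorem le_of_tendsto_zero {T T' : ℝ} (hT : 0 < T)
    (hx : IsDiagonalFlow A B C D x₁ x₂ (Ico 0 T)) (hz : IsDiagonalFlow A B C D z₁ z₂ (Ico 0 T'))
    (eq₁ : x₁ 0 = z₁ 0) (eq₂ : x₂ 0 = z₂ 0) (lim : Tendsto x₁ (𝓝[<] T) (𝓝 0)) : T' ≤ T := by
  by_contra! hlt
  have hTmem : T ∈ Ico 0 T' := ⟨hT.le, hlt⟩
  have x₁_eqOn := (hx.eqOn (hz.mono (Ico_subset_Ico_right hlt.le)) eq₁ eq₂).1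
  have z₁_continuousAt : ContinuousAt z₁ T :=
    ((hz.deriv₁ T hTmem).hasDerivAt (Ico_mem_nhds hT hlt)).continuousAt
  have z₁_lim : Tendsto z₁ (𝓝[<] T) (𝓝 0) := lim.congr' (x₁_eqOn.eventuallyEq_of_mem
    (Ico_mem_nhdsLT hT))
  exact (hz.pos₁ T hTmem).ne'
    (tendsto_nhds_unique (z₁_continuousAt.tendsto.mono_left nhdsWithin_le_nhds) z₁_lim)

theorem hasDerivWithinAt_div (hE : HasEinsteinRatios A B C D y₁ y₂)
    (h : IsDiagonalFlow A B C D x₁ x₂ J) {t : ℝ} (ht : t ∈ J) :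
    HasDerivWithinAt (fun t => x₁ t / x₂ t)
      (-(2 * (B + D) * (x₁ t / x₂ t - y₁) * (x₁ t / x₂ t - y₂) / x₂ t)) J t := by
  have x₂_ne := (h.pos₂ t ht).ne'
  refine ((h.deriv₁ t ht).div (h.deriv₂ t ht) x₂_ne).congr_deriv ?_
  rw [hE.A_eq, hE.C_eq]
  field_simp
  ring

end IsDiagonalFlow

end DiagonalFlow

section NoAncientSolution

theorem two_mul_div_le {a y y₁ y₂ x z : ℝ} (ha : 0 < a) (hy : y₁ < y₂) (hy₂ : y₂ < y)
    (hx : 0 < x) (hxz : x ≤ z) :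
    2 * a / z ≤ 2 * a * (y - y₁) * (y - y₂) / x / (y - y₂) ^ 2 := by
  have hy₂ : 0 < y - y₂ := sub_pos.2 hy₂
  have factor : 1 ≤ (y - y₁) / (y - y₂) := (one_le_div hy₂).2 (sub_le_sub_left hy.le y)
  calc 2 * a / z ≤ 2 * a / x := by gcongr
    _ ≤ 2 * a / x * ((y - y₁) / (y - y₂)) := le_mul_of_one_le_right (by positivity) factor
    _ = 2 * a * (y - y₁) * (y - y₂) / x / (y - y₂) ^ 2 := by field_simp

variable {A B C D y₁ y₂ T : ℝ} {x₁ x₂ : ℝ → ℝ}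

namespace IsDiagonalFlow

-- Wherever `y` takes a value `c > y₂` it is decreasing, so it cannot cross `c` upwards.
theorem le_div_of_nonpos (hE : HasEinsteinRatios A B C D y₁ y₂) (hT : 0 < T)
    (h : IsDiagonalFlow A B C D x₁ x₂ (Iio T)) (hy₀ : y₂ < x₁ 0 / x₂ 0) {t : ℝ} (ht : t ≤ 0) :
    x₁ 0 / x₂ 0 ≤ x₁ t / x₂ t := by
  by_contra! hlt
  obtain ⟨c, c_gt, c_lt⟩ := exists_between (max_lt hlt hy₀)
  obtain ⟨t_lt_c, hc⟩ := max_lt_iff.1 c_gt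
  have y_deriv {s : ℝ} (hs : s < T) := h.hasDerivWithinAt_div hE hs
  refine c_lt.not_ge (image_le_of_deriv_right_lt_deriv_boundary
    (f := fun t => x₁ t / x₂ t)
    (f' := fun t => -(2 * (B + D) * (x₁ t / x₂ t - y₁) * (x₁ t / x₂ t - y₂) / x₂ t))
    (B := fun _ => c) (B' := fun _ => 0) (fun s hs => ?_) (fun s hs => ?_) t_lt_c.le
    (fun s => hasDerivAt_const s c) (fun s hs y_eq => ?_) (right_mem_Icc.2 ht))
  · exact (y_deriv (hs.2.trans_lt hT)).continuousWithinAt.mono fun r hr => hr.2.trans_lt hT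
  · exact (y_deriv (hs.2.trans hT)).mono_of_mem_nhdsWithin
      (mem_nhdsWithin_of_mem_nhds (Iio_mem_nhds (hs.2.trans hT)))
  · rw [y_eq, neg_lt_zero]
    have hc₁ : 0 < c - y₁ := sub_pos.2 (hE.lt.trans hc)
    have hc₂ : 0 < c - y₂ := sub_pos.2 hc
    exact div_pos (mul_pos (mul_pos (mul_pos two_pos hE.pos) hc₁) hc₂) (h.pos₂ s (hs.2.trans hT))

theorem le_sub_mul (hD : 0 ≤ D) (hT : 0 < T) (h : IsDiagonalFlow A B C D x₁ x₂ (Iio T)) {t : ℝ}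
    (ht : t ≤ 0) : x₂ t ≤ x₂ 0 - 2 * C * t := by
  have mono : MonotoneOn (fun t => x₂ t + 2 * C * t) (Iio T) := by
    have deriv (t : ℝ) (ht : t ∈ Iio T) :
        HasDerivWithinAt (fun t => x₂ t + 2 * C * t)
          (-2 * (C - D * (x₁ t / x₂ t)) + 2 * C * 1) (Iio T) t :=
      (h.deriv₂ t ht).add ((hasDerivWithinAt_id t _).const_mul _)
    refine monotoneOn_of_hasDerivWithinAt_nonneg (convex_Iio T)
      (fun t ht => (deriv t ht).continuousWithinAt)
      (fun t ht => (deriv t (interior_subset ht)).mono interior_subset) fun t ht => ?_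
    have t_mem : t ∈ Iio T := interior_subset ht
    have := mul_nonneg hD (div_pos (h.pos₁ t t_mem) (h.pos₂ t t_mem)).le
    linarith
  have le_at_zero : x₂ t + 2 * C * t ≤ x₂ 0 + 2 * C * 0 := mono (ht.trans_lt hT) hT ht
  linarith

-- The derivative is `-2 a (y - y₁) / ((y - y₂) x₂) + 2 a / (x₂(0) - 2 C t)` with `a = B + D`.
theorem antitoneOn_neg_inv_sub_log (hE : HasEinsteinRatios A B C D y₁ y₂) (hT : 0 < T)
    (h : IsDiagonalFlow A B C D x₁ x₂ (Iio T)) (hy₀ : y₂ < x₁ 0 / x₂ 0) :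
    AntitoneOn (fun t => -(x₁ t / x₂ t - y₂)⁻¹ - (B + D) / C * Real.log (x₂ 0 - 2 * C * t))
      (Iic 0) := by
  have ratio_pos {t : ℝ} (ht : t ≤ 0) : 0 < x₁ t / x₂ t - y₂ :=
    sub_pos.2 (hy₀.trans_le (h.le_div_of_nonpos hE hT hy₀ ht))
  have x₂_le {t : ℝ} (ht : t ≤ 0) := h.le_sub_mul hE.nonneg_D hT ht
  have deriv (t : ℝ) (ht : t ∈ Iic (0 : ℝ)) : HasDerivAt
      (fun t => -(x₁ t / x₂ t - y₂)⁻¹ - (B + D) / C * Real.log (x₂ 0 - 2 * C * t))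
      (-(-(-(2 * (B + D) * (x₁ t / x₂ t - y₁) * (x₁ t / x₂ t - y₂) / x₂ t)) /
        (x₁ t / x₂ t - y₂) ^ 2) - (B + D) / C * (-(2 * C * 1) / (x₂ 0 - 2 * C * t))) t := by
    have t_lt : t < T := ht.trans_lt hT
    have y_deriv := (h.hasDerivWithinAt_div hE t_lt).hasDerivAt (Iio_mem_nhds t_lt)
    have linear_deriv := ((hasDerivAt_id t).const_mul (2 * C)).const_sub (x₂ 0)
    exact ((y_deriv.sub_const y₂).inv (ratio_pos ht).ne').neg.sub
      ((linear_deriv.log ((h.pos₂ t t_lt).trans_le (x₂_le ht)).ne').const_mul _)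
  refine antitoneOn_of_hasDerivWithinAt_nonpos (convex_Iic 0)
    (fun t ht => (deriv t ht).continuousAt.continuousWithinAt)
    (fun t ht => (deriv t (interior_subset ht)).hasDerivWithinAt) fun t t_mem => ?_
  have ht : t ∈ Iic (0 : ℝ) := interior_subset t_mem
  have x₂_pos := h.pos₂ t (ht.trans_lt hT)
  have C_ne := hE.C_pos.ne'
  have deriv_le := two_mul_div_le hE.pos hE.lt (sub_pos.1 (ratio_pos ht)) x₂_pos (x₂_le ht)
  have log_deriv : (B + D) / C * (-(2 * C * 1) / (x₂ 0 - 2 * C * t)) =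
      -(2 * (B + D) / (x₂ 0 - 2 * C * t)) := by
    field_simp
  rw [log_deriv, neg_div, neg_neg, neg_div]
  linarith

theorem div_le_of_ancient (hE : HasEinsteinRatios A B C D y₁ y₂) (hT : 0 < T)
    (h : IsDiagonalFlow A B C D x₁ x₂ (Iio T)) : x₁ 0 / x₂ 0 ≤ y₂ := by
  by_contra! hy₀
  have anti := h.antitoneOn_neg_inv_sub_log hE hT hy₀
  have bound_atTop : Tendsto (fun t => x₂ 0 - 2 * C * t) atBot atTop :=
    tendsto_atTop_add_const_left atBot (x₂ 0) (tendsto_neg_atBot_atTop.comp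
      (tendsto_id.const_mul_atBot (mul_pos two_pos hE.C_pos)))
  have log_atTop := (Real.tendsto_log_atTop.comp bound_atTop).const_mul_atTop
    (div_pos hE.pos hE.C_pos)
  obtain ⟨t, log_gt, ht⟩ := ((log_atTop.eventually_gt_atTop
    ((x₁ 0 / x₂ 0 - y₂)⁻¹ + (B + D) / C * Real.log (x₂ 0 - 2 * C * 0))).and
    (eventually_le_atBot 0)).exists
  have inv_pos : 0 < (x₁ t / x₂ t - y₂)⁻¹ :=
    inv_pos.2 (sub_pos.2 (hy₀.trans_le (h.le_div_of_nonpos hE hT hy₀ ht)))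
  have anti_le : -(x₁ 0 / x₂ 0 - y₂)⁻¹ - (B + D) / C * Real.log (x₂ 0 - 2 * C * 0) ≤
      -(x₁ t / x₂ t - y₂)⁻¹ - (B + D) / C * Real.log (x₂ 0 - 2 * C * t) :=
    anti ht self_mem_Iic ht
  have log_gt : (x₁ 0 / x₂ 0 - y₂)⁻¹ + (B + D) / C * Real.log (x₂ 0 - 2 * C * 0) <
    (B + D) / C * Real.log (x₂ 0 - 2 * C * t) := log_gt
  linarith

end IsDiagonalFlow
end NoAncientSolution

section ShrinkingTrajectory

/-- The ratio `y` along the trajectory shrinking to a point, as a function of the parameter `s`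
for which `(y - y₂) / (y - y₁) = s ^ q`. -/
def shrinkingRatio (y₁ y₂ q s : ℝ) : ℝ :=
  (y₂ - y₁ * s ^ q) / (1 - s ^ q)

/-- The second scale `x₂` along the trajectory with ratio `shrinkingRatio y₁ y₂ q`, for a suitable
choice of `θ` and `q`; the constant `c` is free because of the scaling invariance of the flow. -/
def shrinkingScale (c θ q s : ℝ) : ℝ :=
  c * (1 - s ^ q) ^ θ * s

variable {a c k q s₀ t θ y y₁ y₂ : ℝ} {s : ℝ → ℝ}

theorem continuous_rpow_one_sub_rpow (hq : 0 ≤ q) (hθ : 0 ≤ θ) :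
    Continuous fun x : ℝ => (1 - x ^ q) ^ θ :=
  (continuous_const.sub (Real.continuous_rpow_const hq)).rpow_const fun _ => Or.inr hθ

theorem tendsto_shrinkingRatio_zero (hq : 0 < q) :
    Tendsto (shrinkingRatio y₁ y₂ q) (𝓝 0) (𝓝 y₂) := by
  have pow_lim : Tendsto (fun x : ℝ => x ^ q) (𝓝 0) (𝓝 0) := by
    simpa only [Real.zero_rpow hq.ne'] using (Real.continuous_rpow_const hq.le).tendsto 0
  have den_lim : Tendsto (fun x : ℝ => 1 - x ^ q) (𝓝 0) (𝓝 1) := by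
    simpa only [sub_zero] using pow_lim.const_sub 1
  simpa only [mul_zero, sub_zero, div_one] using!
    ((pow_lim.const_mul y₁).const_sub y₂).div den_lim one_ne_zero

theorem tendsto_shrinkingScale_zero (hq : 0 ≤ q) (hθ : 0 ≤ θ) :
    Tendsto (shrinkingScale c θ q) (𝓝 0) (𝓝 0) := by
  have cont : Continuous (shrinkingScale c θ q) :=
    (continuous_const.mul (continuous_rpow_one_sub_rpow hq hθ)).mul continuous_id
  simpa only [shrinkingScale, mul_zero] using cont.tendsto 0

theorem shrinkingRatio_pos (hy₁ : 0 < y₁) (hy : y₁ < y₂) (hs₀ : s₀ ^ q < 1) :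
    0 < shrinkingRatio y₁ y₂ q s₀ :=
  div_pos (sub_pos.2 ((mul_lt_of_lt_one_right hy₁ hs₀).trans hy)) (sub_pos.2 hs₀)

theorem shrinkingScale_pos (hc : 0 < c) (hs₀ : 0 < s₀) (hs₀' : s₀ ^ q < 1) :
    0 < shrinkingScale c θ q s₀ :=
  mul_pos (mul_pos hc (Real.rpow_pos_of_pos (sub_pos.2 hs₀') θ)) hs₀

theorem exists_shrinkingRatio_eq (hq : q ≠ 0) (hy : y₁ < y₂) (hy₂ : y₂ < y) :
    ∃ s₀, 0 < s₀ ∧ s₀ ^ q < 1 ∧ shrinkingRatio y₁ y₂ q s₀ = y := by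
  have den_pos : 0 < y - y₁ := sub_pos.2 (hy.trans hy₂)
  have base_pos : 0 < (y - y₂) / (y - y₁) := div_pos (sub_pos.2 hy₂) den_pos
  have pow_eq : (((y - y₂) / (y - y₁)) ^ q⁻¹) ^ q = (y - y₂) / (y - y₁) :=
    Real.rpow_inv_rpow base_pos.le hq
  have base_lt : (y - y₂) / (y - y₁) < 1 := (div_lt_one den_pos).2 (sub_lt_sub_left hy y)
  refine ⟨_, Real.rpow_pos_of_pos base_pos q⁻¹, pow_eq.trans_lt base_lt, ?_⟩
  rw [shrinkingRatio, pow_eq, div_eq_iff (sub_pos.2 base_lt).ne']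
  field_simp
  ring

theorem exists_shrinkingScale_eq (hs₀ : 0 < s₀) (hs₀' : s₀ ^ q < 1) {x : ℝ} (hx : 0 < x) :
    ∃ c, 0 < c ∧ shrinkingScale c θ q s₀ = x := by
  have pos : 0 < (1 - s₀ ^ q) ^ θ * s₀ :=
    mul_pos (Real.rpow_pos_of_pos (sub_pos.2 hs₀') θ) hs₀
  exact ⟨x / ((1 - s₀ ^ q) ^ θ * s₀), div_pos hx pos,
    (mul_assoc _ _ _).trans (div_mul_cancel₀ x pos.ne')⟩

theorem hasDerivAt_rpow_of_shrinking (hs₀ : 0 < s t)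
    (hs : HasDerivAt s (-(k / (c * (1 - s t ^ q) ^ θ))) t) :
    HasDerivAt (fun t => s t ^ q) (-(q * k * s t ^ q / shrinkingScale c θ q (s t))) t := by
  refine (hs.rpow_const (p := q) (Or.inl hs₀.ne')).congr_deriv ?_
  rw [Real.rpow_sub_one hs₀.ne', shrinkingScale]
  field_simp

theorem hasDerivAt_shrinkingRatio (hk : q * k = 2 * a * (y₂ - y₁)) (hs₀ : 0 < s t)
    (hs₀' : s t ^ q < 1) (hs : HasDerivAt s (-(k / (c * (1 - s t ^ q) ^ θ))) t) :
    HasDerivAt (fun t => shrinkingRatio y₁ y₂ q (s t))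
      (-(2 * a * (shrinkingRatio y₁ y₂ q (s t) - y₁) * (shrinkingRatio y₁ y₂ q (s t) - y₂) /
        shrinkingScale c θ q (s t))) t := by
  have one_sub_ne := (sub_pos.2 hs₀').ne'
  have pow_deriv := hasDerivAt_rpow_of_shrinking hs₀ hs
  refine (((pow_deriv.const_mul y₁).const_sub y₂).div (pow_deriv.const_sub 1)
    one_sub_ne).congr_deriv ?_
  rw [hk, shrinkingRatio]
  field_simp
  ring

theorem hasDerivAt_shrinkingScale {C D : ℝ} (hk : q * k = 2 * a * (y₂ - y₁)) (hθ : a * θ = D)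
    (hk' : k = 2 * (C - D * y₂)) (hc : 0 < c) (hs₀ : 0 < s t) (hs₀' : s t ^ q < 1)
    (hs : HasDerivAt s (-(k / (c * (1 - s t ^ q) ^ θ))) t) :
    HasDerivAt (fun t => shrinkingScale c θ q (s t))
      (-2 * (C - D * shrinkingRatio y₁ y₂ q (s t))) t := by
  have one_sub_pos := sub_pos.2 hs₀'
  have weight_pos := Real.rpow_pos_of_pos one_sub_pos θ
  have pow_deriv := (hasDerivAt_rpow_of_shrinking hs₀ hs).const_sub 1
  refine (((pow_deriv.rpow_const (p := θ) (Or.inl one_sub_pos.ne')).const_mul c).mul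
    hs).congr_deriv ?_
  have excess : shrinkingRatio y₁ y₂ q (s t) - y₂ = (y₂ - y₁) * s t ^ q / (1 - s t ^ q) := by
    rw [shrinkingRatio, div_sub' one_sub_pos.ne']
    ring
  calc _ = θ * (q * k) * s t ^ q / (1 - s t ^ q) - k := by
        rw [Real.rpow_sub_one one_sub_pos.ne', shrinkingScale]
        generalize (1 - s t ^ q) ^ θ = w at *
        field_simp
        ring
    _ = 2 * D * (shrinkingRatio y₁ y₂ q (s t) - y₂) - k := by
        rw [hk, ← hθ, excess]
        ring
    _ = _ := by
        rw [hk']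
        ring

theorem exists_shrinking_parameter (hk : 0 < k) (hc : 0 < c) (hq : 0 ≤ q) (hθ : 0 ≤ θ)
    (hs₀ : 0 < s₀) (hs₀' : s₀ ^ q < 1) :
    ∃ T, 0 < T ∧ ∃ s : ℝ → ℝ, Continuous s ∧ s 0 = s₀ ∧ s T = 0 ∧
      ∀ t ∈ Ico 0 T, 0 < s t ∧ s t ^ q < 1 ∧
        HasDerivAt s (-(k / (c * (1 - s t ^ q) ^ θ))) t := by
  have weight_pos (x : ℝ) (hx : x ∈ Icc 0 s₀) : 0 < c * (1 - x ^ q) ^ θ :=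
    mul_pos hc (Real.rpow_pos_of_pos
      (sub_pos.2 ((Real.rpow_le_rpow hx.1 hx.2 hq).trans_lt hs₀')) θ)
  obtain ⟨T, hT, s, s_cont, s_zero, s_T, hs⟩ := exists_descent_to_zero hs₀
    (continuousOn_const.div (continuous_const.mul (continuous_rpow_one_sub_rpow hq hθ)).continuousOn
      fun x hx => (weight_pos x hx).ne')
    fun x hx => div_pos hk (weight_pos x hx)
  exact ⟨T, hT, s, s_cont, s_zero, s_T, fun t ht => ⟨(hs t ht).1.1,
    (Real.rpow_le_rpow (hs t ht).1.1.le (hs t ht).1.2 hq).trans_lt hs₀', (hs t ht).2⟩⟩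

theorem HasEinsteinRatios.sub_mul_pos {A B C D : ℝ} (hE : HasEinsteinRatios A B C D y₁ y₂) :
    0 < C - D * y₂ := by
  have C_sub : C - D * y₂ = (B + D) * y₁ + B * y₂ := by
    rw [hE.C_eq]
    ring
  rw [C_sub]
  exact add_pos_of_pos_of_nonneg (mul_pos hE.pos hE.pos₁)
    (mul_nonneg hE.nonneg_B (hE.pos₁.trans hE.lt).le)

theorem HasEinsteinRatios.exists_shrinking {A B C D a₁ a₂ : ℝ}
    (hE : HasEinsteinRatios A B C D y₁ y₂) (ha₂ : 0 < a₂) (hy₀ : y₂ < a₁ / a₂) :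
    ∃ T, 0 < T ∧ ∃ x₁ x₂ : ℝ → ℝ, x₁ 0 = a₁ ∧ x₂ 0 = a₂ ∧
      IsDiagonalFlow A B C D x₁ x₂ (Ico 0 T) ∧
      Tendsto x₁ (𝓝[<] T) (𝓝 0) ∧ Tendsto x₂ (𝓝[<] T) (𝓝 0) ∧
      Tendsto (fun t => x₁ t / x₂ t) (𝓝[<] T) (𝓝 y₂) := by
  have hk := mul_pos two_pos hE.sub_mul_pos
  obtain ⟨q, q_mul⟩ : ∃ q, q * (2 * (C - D * y₂)) = 2 * (B + D) * (y₂ - y₁) :=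
    ⟨_, div_mul_cancel₀ _ hk.ne'⟩
  have hq : 0 < q := pos_of_mul_pos_left
    (q_mul ▸ mul_pos (mul_pos two_pos hE.pos) (sub_pos.2 hE.lt)) hk.le
  have hθ : 0 ≤ D / (B + D) := div_nonneg hE.nonneg_D hE.pos.le
  have θ_mul : (B + D) * (D / (B + D)) = D := mul_div_cancel₀ D hE.pos.ne'
  obtain ⟨s₀, s₀_pos, s₀_lt, ratio_eq⟩ := exists_shrinkingRatio_eq hq.ne' hE.lt hy₀
  obtain ⟨c, c_pos, scale_eq⟩ := exists_shrinkingScale_eq (θ := D / (B + D)) s₀_pos s₀_lt ha₂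
  obtain ⟨T, hT, s, s_cont, s_zero, s_T, hs⟩ :=
    exists_shrinking_parameter hk c_pos hq.le hθ s₀_pos s₀_lt
  let y (t : ℝ) := shrinkingRatio y₁ y₂ q (s t)
  let x₂ (t : ℝ) := shrinkingScale c (D / (B + D)) q (s t)
  have s_lim : Tendsto s (𝓝[<] T) (𝓝 0) := s_T ▸ (s_cont.tendsto T).mono_left nhdsWithin_le_nhds
  have y_lim : Tendsto y (𝓝[<] T) (𝓝 y₂) := (tendsto_shrinkingRatio_zero hq).comp s_lim
  have x₂_lim : Tendsto x₂ (𝓝[<] T) (𝓝 0) := (tendsto_shrinkingScale_zero hq.le hθ).comp s_lim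
  have x₂_pos (t : ℝ) (ht : t ∈ Ico 0 T) : 0 < x₂ t :=
    shrinkingScale_pos c_pos (hs t ht).1 (hs t ht).2.1
  have flow : IsDiagonalFlow A B C D (fun t => y t * x₂ t) x₂ (Ico 0 T) :=
    isDiagonalFlow_of_ratio hE (fun t ht => shrinkingRatio_pos hE.pos₁ hE.lt (hs t ht).2.1) x₂_pos
      (fun t ht => (hasDerivAt_shrinkingRatio q_mul (hs t ht).1 (hs t ht).2.1
        (hs t ht).2.2).hasDerivWithinAt)
      (fun t ht => (hasDerivAt_shrinkingScale q_mul θ_mul rfl c_pos (hs t ht).1 (hs t ht).2.1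
        (hs t ht).2.2).hasDerivWithinAt)
  have x₂_zero : x₂ 0 = a₂ := (congrArg (shrinkingScale c _ q) s_zero).trans scale_eq
  have y_zero : y 0 = a₁ / a₂ := (congrArg (shrinkingRatio y₁ y₂ q) s_zero).trans ratio_eq
  refine ⟨T, hT, _, x₂, ?_, x₂_zero, flow, mul_zero y₂ ▸ y_lim.mul x₂_lim, x₂_lim, y_lim.congr' ?_⟩
  · rw [x₂_zero, y_zero, div_mul_cancel₀ a₁ ha₂.ne']
  · filter_upwards [Ico_mem_nhdsLT hT] with t ht
    exact (mul_div_cancel_right₀ (y t) (x₂_pos t ht).ne').symm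

end ShrinkingTrajectory

section RicciFlow

variable {E : Type*} [NormedAddCommGroup E] [NormedSpace ℝ E] [CompleteSpace E]
  [FiniteDimensional ℝ E]
  {G : Type*} [TopologicalSpace G] [ChartedSpace E G] [Group G] [LieGroup 𝓘(ℝ, E) ∞ G]
  {K : Subgroup G} {p₁ p₂ : Submodule ℝ (GroupLieAlgebra 𝓘(ℝ, E) G)}

local notation "𝔤" => GroupLieAlgebra 𝓘(ℝ, E) G

variable {hM : IsTwoSummandPair K p₁ p₂} {Q g : InvariantMetric K (p₁ ⊔ p₂)}
  {A B C D x₁ x₂ y₁ y₂ : ℝ}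

namespace IsTwoSummandPair.HasRicciCoefficients

variable (hR : hM.HasRicciCoefficients Q A B C D)
include hR

theorem ricci_self₁ (hg : IsDiagonal Q g x₁ x₂) {U : ↥(p₁ ⊔ p₂)} (hU : (U : 𝔤) ∈ p₁)
    (QU : Q.form U U = 1) :
    ricci hM.isCompl g.toScalarProduct U U = A + B * (x₁ / x₂) ^ 2 := by
  rw [hR g x₁ x₂ hg, proj₁_of_mem₁ _ hU, proj₂_of_mem₁ _ hU, QU, map_zero, mul_one, mul_zero,
    add_zero]

theorem ricci_self₂ (hg : IsDiagonal Q g x₁ x₂) {V : ↥(p₁ ⊔ p₂)} (hV : (V : 𝔤) ∈ p₂)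
    (QV : Q.form V V = 1) :
    ricci hM.isCompl g.toScalarProduct V V = C - D * (x₁ / x₂) := by
  rw [hR g x₁ x₂ hg, proj₁_of_mem₂ _ hV, proj₂_of_mem₂ _ hV, QV, map_zero, mul_one, mul_zero,
    zero_add]

theorem isEinstein_iff (hg : IsDiagonal Q g x₁ x₂) :
    IsEinstein hM.isCompl g.toScalarProduct ↔
      A + B * (x₁ / x₂) ^ 2 = x₁ / x₂ * (C - D * (x₁ / x₂)) := by
  have x₂_ne := hg.2.1.ne'
  constructor
  · rintro ⟨c, ricci_eq⟩
    obtain ⟨U, hU, QU⟩ := Q.exists_form_self_eq_one hM.irreducible₁.2.1 (le_sup_left (b := p₂))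
    obtain ⟨V, hV, QV⟩ := Q.exists_form_self_eq_one hM.irreducible₂.2.1 (le_sup_right (a := p₁))
    rw [← hR.ricci_self₁ hg hU QU, ← hR.ricci_self₂ hg hV QV, ricci_eq, ricci_eq,
      hg.form_self₁ hU QU, hg.form_self₂ hV QV]
    field_simp
  · intro einstein
    refine ⟨(C - D * (x₁ / x₂)) / x₂, fun X Y => ?_⟩
    rw [hR g x₁ x₂ hg, hg.form_eq hM.disjoint, einstein]
    field_simp

theorem hasEinsteinRatios (hB : 0 ≤ B) (hD : 0 ≤ D) (hy₁ : 0 < y₁) (hy : y₁ < y₂)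
    (hE : ∀ (g : InvariantMetric K (p₁ ⊔ p₂)) (x₁ x₂ : ℝ), IsDiagonal Q g x₁ x₂ →
      (IsEinstein hM.isCompl g.toScalarProduct ↔ x₁ / x₂ = y₁ ∨ x₁ / x₂ = y₂)) :
    HasEinsteinRatios A B C D y₁ y₂ := by
  refine hasEinsteinRatios_of_forall hB hD hy₁ hy fun y y_pos => ?_
  have diagonal := isDiagonal_diagonalMetric hM.disjoint hM.irreducible₁.1 hM.irreducible₂.1 Q
    y_pos one_pos
  simpa only [div_one] using (hR.isEinstein_iff diagonal).symm.trans (hE _ y 1 diagonal)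

theorem le_of_curvatureBoundedBy (hB : 0 ≤ B) (hg : IsDiagonal Q g x₁ x₂) {M : ℝ}
    (bounded : CurvatureBoundedBy hM.isCompl g.toScalarProduct M) :
    A ≤ Module.finrank ℝ ↥(p₁ ⊔ p₂) * M * x₁ := by
  obtain ⟨U, hU, gU⟩ := g.exists_form_self_eq_one hM.irreducible₁.2.1 (le_sup_left (b := p₂))
  have QU : x₁ * Q.form U U = 1 := (hg.2.2.1 U U hU hU).symm.trans gU
  have ricci_le := (le_abs_self _).trans (abs_ricci_le bounded gU.le)
  rw [hR g x₁ x₂ hg, proj₁_of_mem₁ _ hU, proj₂_of_mem₁ _ hU, map_zero, mul_zero, add_zero]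
    at ricci_le
  calc A ≤ A + B * (x₁ / x₂) ^ 2 := le_add_of_nonneg_right (mul_nonneg hB (sq_nonneg _))
    _ = (A + B * (x₁ / x₂) ^ 2) * Q.form U U * x₁ := by
        rw [mul_assoc, mul_comm (Q.form U U), QU, mul_one]
    _ ≤ _ := mul_le_mul_of_nonneg_right ricci_le hg.1.le

theorem frequently_not_curvatureBoundedBy (hA : 0 < A) (hB : 0 ≤ B) {T : ℝ} (hT : 0 < T)
    {g : ℝ → InvariantMetric K (p₁ ⊔ p₂)} {x₁ x₂ : ℝ → ℝ}
    (hg : ∀ t ∈ Ico 0 T, IsDiagonal Q (g t) (x₁ t) (x₂ t)) (lim : Tendsto x₁ (𝓝[<] T) (𝓝 0))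
    (M : ℝ) : ∃ᶠ t in 𝓝[<] T, ¬ CurvatureBoundedBy hM.isCompl (g t).toScalarProduct M := by
  have bound_lim : Tendsto (fun t => Module.finrank ℝ ↥(p₁ ⊔ p₂) * M * x₁ t) (𝓝[<] T) (𝓝 0) := by
    simpa only [mul_zero] using lim.const_mul (Module.finrank ℝ ↥(p₁ ⊔ p₂) * M)
  refine Eventually.frequently ?_
  filter_upwards [bound_lim.eventually_lt_const hA, Ico_mem_nhdsLT hT] with t bound_lt ht bounded
  exact bound_lt.not_ge (hR.le_of_curvatureBoundedBy hB (hg t ht) bounded)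

variable {g : ℝ → InvariantMetric K (p₁ ⊔ p₂)} {x₁ x₂ : ℝ → ℝ} {J : Set ℝ}

theorem isRicciFlowOn (hx : IsDiagonalFlow A B C D x₁ x₂ J)
    (hg : ∀ t ∈ J, IsDiagonal Q (g t) (x₁ t) (x₂ t)) : IsRicciFlowOn hM.isCompl g J := by
  intro t ht X Y
  have form_deriv := ((hx.deriv₁ t ht).mul_const (Q.form (proj₁ hM.disjoint X)
    (proj₁ hM.disjoint Y))).add ((hx.deriv₂ t ht).mul_const (Q.form (proj₂ hM.disjoint X)
    (proj₂ hM.disjoint Y)))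
  refine (form_deriv.congr (fun s hs => (hg s hs).form_eq hM.disjoint X Y)
    ((hg t ht).form_eq hM.disjoint X Y)).congr_deriv ?_
  rw [hR (g t) _ _ (hg t ht)]
  ring

theorem isDiagonalFlow (flow : IsRicciFlowOn hM.isCompl g J)
    (hg : ∀ t ∈ J, IsDiagonal Q (g t) (x₁ t) (x₂ t)) : IsDiagonalFlow A B C D x₁ x₂ J := by
  obtain ⟨U, hU, QU⟩ := Q.exists_form_self_eq_one hM.irreducible₁.2.1 (le_sup_left (b := p₂))
  obtain ⟨V, hV, QV⟩ := Q.exists_form_self_eq_one hM.irreducible₂.2.1 (le_sup_right (a := p₁))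
  refine ⟨fun t ht => (hg t ht).1, fun t ht => (hg t ht).2.1, fun t ht => ?_, fun t ht => ?_⟩
  · rw [← hR.ricci_self₁ (hg t ht) hU QU]
    exact (flow t ht U U).congr (fun s hs => ((hg s hs).form_self₁ hU QU).symm)
      ((hg t ht).form_self₁ hU QU).symm
  · rw [← hR.ricci_self₂ (hg t ht) hV QV]
    exact (flow t ht V V).congr (fun s hs => ((hg s hs).form_self₂ hV QV).symm)
      ((hg t ht).form_self₂ hV QV).symm

theorem exists_isDiagonalFlow (flow : IsRicciFlowOn hM.isCompl g J) :
    ∃ x₁ x₂ : ℝ → ℝ, (∀ t, IsDiagonal Q (g t) (x₁ t) (x₂ t)) ∧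
      IsDiagonalFlow A B C D x₁ x₂ J := by
  choose x₁ x₂ hx using fun t => hM.exists_isDiagonal Q (g t)
  exact ⟨x₁, x₂, hx, hR.isDiagonalFlow flow fun t _ => hx t⟩

theorem le_and_eqOn_of_tendsto_zero {T T' : ℝ} (hT : 0 < T)
    (hx : IsDiagonalFlow A B C D x₁ x₂ (Ico 0 T))
    (hg : ∀ t ∈ Ico 0 T, IsDiagonal Q (g t) (x₁ t) (x₂ t)) (lim : Tendsto x₁ (𝓝[<] T) (𝓝 0))
    {g' : ℝ → InvariantMetric K (p₁ ⊔ p₂)} (flow : IsRicciFlowOn hM.isCompl g' (Ico 0 T'))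
    (init : g' 0 = g 0) : T' ≤ T ∧ EqOn g' g (Ico 0 T') := by
  obtain ⟨z₁, z₂, hg', hz⟩ := hR.exists_isDiagonalFlow flow
  obtain ⟨eq₁, eq₂⟩ := hM.scale_eq (hg 0 ⟨le_rfl, hT⟩) (init ▸ hg' 0)
  have hle : T' ≤ T := hx.le_of_tendsto_zero hT hz eq₁ eq₂ lim
  obtain ⟨eqOn₁, eqOn₂⟩ := (hx.mono (Ico_subset_Ico_right hle)).eqOn hz eq₁ eq₂
  refine ⟨hle, fun t ht => (hg' t).unique hM.disjoint ?_⟩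
  rw [← eqOn₁ ht, ← eqOn₂ ht]
  exact hg t ⟨ht.1, ht.2.trans_le hle⟩

theorem div_le_of_ancient (hE : HasEinsteinRatios A B C D y₁ y₂) {T a₁ a₂ : ℝ} (hT : 0 < T)
    (flow : IsRicciFlowOn hM.isCompl g (Iio T)) (init : IsDiagonal Q (g 0) a₁ a₂) :
    a₁ / a₂ ≤ y₂ := by
  obtain ⟨x₁, x₂, hg, hx⟩ := hR.exists_isDiagonalFlow flow
  obtain ⟨rfl, rfl⟩ := hM.scale_eq init (hg 0)
  exact hx.div_le_of_ancient hE hT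

end IsTwoSummandPair.HasRicciCoefficients
end RicciFlow

end HomRicci

end

theorem mainTheorem4_general
    {E : Type*} [NormedAddCommGroup E] [NormedSpace ℝ E] [FiniteDimensional ℝ E]
    [CompleteSpace E]
    {G : Type*} [TopologicalSpace G] [ChartedSpace E G] [Group G] [LieGroup 𝓘(ℝ, E) ∞ G]
    (K : Subgroup G) (p₁ p₂ : Submodule ℝ (GroupLieAlgebra 𝓘(ℝ, E) G))
    (hM : HomRicci.IsTwoSummandPair K p₁ p₂)
    (Q : HomRicci.InvariantMetric K (p₁ ⊔ p₂)) (hQ : HomRicci.IsBackground Q)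
    (y₁ y₂ : ℝ) (hy₁ : 0 < y₁) (hy : y₁ < y₂)
    (hE : ∀ (g : HomRicci.InvariantMetric K (p₁ ⊔ p₂)) (x₁ x₂ : ℝ),
      HomRicci.IsDiagonal Q g x₁ x₂ →
        (HomRicci.IsEinstein hM.isCompl g.toScalarProduct ↔ x₁ / x₂ = y₁ ∨ x₁ / x₂ = y₂))
    (g₀ : HomRicci.InvariantMetric K (p₁ ⊔ p₂)) (a₁ a₂ : ℝ)
    (hg₀ : HomRicci.IsDiagonal Q g₀ a₁ a₂) (hy₀ : y₂ < a₁ / a₂) :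
    (∃ T : ℝ, 0 < T ∧ ∃ g : ℝ → HomRicci.InvariantMetric K (p₁ ⊔ p₂),
      HomRicci.IsRicciFlowOn hM.isCompl g (Ico 0 T) ∧ g 0 = g₀ ∧
      (∀ M : ℝ, ∃ᶠ t in 𝓝[<] T,
        ¬ HomRicci.CurvatureBoundedBy hM.isCompl (g t).toScalarProduct M) ∧
      (∀ (T' : ℝ) (g' : ℝ → HomRicci.InvariantMetric K (p₁ ⊔ p₂)), 0 < T' →
        HomRicci.IsRicciFlowOn hM.isCompl g' (Ico 0 T') → g' 0 = g₀ →
          T' ≤ T ∧ ∀ t ∈ Ico 0 T', g' t = g t) ∧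
      ∃ x₁ x₂ : ℝ → ℝ, (∀ t ∈ Ico 0 T, HomRicci.IsDiagonal Q (g t) (x₁ t) (x₂ t)) ∧
        Tendsto x₁ (𝓝[<] T) (𝓝 0) ∧ Tendsto x₂ (𝓝[<] T) (𝓝 0) ∧
        Tendsto (fun t => x₁ t / x₂ t) (𝓝[<] T) (𝓝 y₂)) ∧
    ¬ ∃ T' : ℝ, 0 < T' ∧ ∃ g : ℝ → HomRicci.InvariantMetric K (p₁ ⊔ p₂),
      HomRicci.IsRicciFlowOn hM.isCompl g (Iio T') ∧ g 0 = g₀ := by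
  obtain ⟨A, B, C, D, hB, hD, hR⟩ := hM.exists_hasRicciCoefficients hQ
  have hE := hR.hasEinsteinRatios hB hD hy₁ hy hE
  have no_ancient (g : ℝ → HomRicci.InvariantMetric K (p₁ ⊔ p₂)) (T' : ℝ) (hT' : 0 < T')
      (flow : HomRicci.IsRicciFlowOn hM.isCompl g (Iio T')) (init : g 0 = g₀) : False :=
    hy₀.not_ge (hR.div_le_of_ancient hE hT' flow (init ▸ hg₀))
  obtain ⟨T, hT, x₁, x₂, init₁, init₂, hx, lim₁, lim₂, lim_ratio⟩ :=
    hE.exists_shrinking hg₀.2.1 hy₀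
  obtain ⟨g, hg⟩ := hM.exists_diagonal_family Q hx.pos₁ hx.pos₂
  have init : g 0 = g₀ := (hg 0 ⟨le_rfl, hT⟩).unique hM.disjoint (init₁ ▸ init₂ ▸ hg₀)
  have maximal (T' : ℝ) (g' : ℝ → HomRicci.InvariantMetric K (p₁ ⊔ p₂)) (_ : 0 < T')
      (flow : HomRicci.IsRicciFlowOn hM.isCompl g' (Ico 0 T')) (init' : g' 0 = g₀) :
      T' ≤ T ∧ ∀ t ∈ Ico 0 T', g' t = g t :=
    hR.le_and_eqOn_of_tendsto_zero hT hx hg lim₁ flow (init'.trans init.symm)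
  exact ⟨⟨T, hT, g, hR.isRicciFlowOn hx hg, init,
    hR.frequently_not_curvatureBoundedBy hE.A_pos hB hT hg lim₁, maximal,
    x₁, x₂, hg, lim₁, lim₂, lim_ratio⟩,
    fun ⟨T', hT', g', flow, init'⟩ => no_ancient g' T' hT' flow init'⟩

theorem mainTheorem4
    {E : Type*} [NormedAddCommGroup E] [NormedSpace ℝ E] [FiniteDimensional ℝ E]
    [CompleteSpace E]
    {G : Type*} [TopologicalSpace G] [ChartedSpace E G] [Group G] [LieGroup 𝓘(ℝ, E) ∞ G]
    (K H : Subgroup G) (p₁ p₂ : Submodule ℝ (GroupLieAlgebra 𝓘(ℝ, E) G))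
    (hM : HomRicci.IsTwoSummandSpace K H p₁ p₂)
    (Q : HomRicci.InvariantMetric K (p₁ ⊔ p₂)) (hQ : HomRicci.IsBackground Q)
    (y₁ y₂ : ℝ) (hy₁ : 0 < y₁) (hy : y₁ < y₂)
    (hE : ∀ (g : HomRicci.InvariantMetric K (p₁ ⊔ p₂)) (x₁ x₂ : ℝ),
      HomRicci.IsDiagonal Q g x₁ x₂ →
        (HomRicci.IsEinstein hM.isCompl g.toScalarProduct ↔ x₁ / x₂ = y₁ ∨ x₁ / x₂ = y₂))
    (g₀ : HomRicci.InvariantMetric K (p₁ ⊔ p₂)) (a₁ a₂ : ℝ)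
    (hg₀ : HomRicci.IsDiagonal Q g₀ a₁ a₂) (hy₀ : y₂ < a₁ / a₂) :
    (∃ T : ℝ, 0 < T ∧ ∃ g : ℝ → HomRicci.InvariantMetric K (p₁ ⊔ p₂),
      HomRicci.IsRicciFlowOn hM.isCompl g (Ico 0 T) ∧ g 0 = g₀ ∧
      -- the curvature is unbounded as `t → T`
      (∀ M : ℝ, ∃ᶠ t in 𝓝[<] T,
        ¬ HomRicci.CurvatureBoundedBy hM.isCompl (g t).toScalarProduct M) ∧
      -- uniqueness, and `[0, T)` is the longest interval on which a solution exists
      (∀ (T' : ℝ) (g' : ℝ → HomRicci.InvariantMetric K (p₁ ⊔ p₂)), 0 < T' →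
        HomRicci.IsRicciFlowOn hM.isCompl g' (Ico 0 T') → g' 0 = g₀ →
          T' ≤ T ∧ ∀ t ∈ Ico 0 T', g' t = g t) ∧
      -- the metric stays diagonal, shrinks to zero, and `y(t) → y₂`
      ∃ x₁ x₂ : ℝ → ℝ, (∀ t ∈ Ico 0 T, HomRicci.IsDiagonal Q (g t) (x₁ t) (x₂ t)) ∧
        Tendsto x₁ (𝓝[<] T) (𝓝 0) ∧ Tendsto x₂ (𝓝[<] T) (𝓝 0) ∧
        Tendsto (fun t => x₁ t / x₂ t) (𝓝[<] T) (𝓝 y₂)) ∧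
    -- there is no ancient solution through the given initial metric
    ¬ ∃ T' : ℝ, 0 < T' ∧ ∃ g : ℝ → HomRicci.InvariantMetric K (p₁ ⊔ p₂),
      HomRicci.IsRicciFlowOn hM.isCompl g (Iio T') ∧ g 0 = g₀ :=
  mainTheorem4_general K p₁ p₂ hM.isTwoSummandPair Q hQ y₁ y₂ hy₁ hy hE g₀ a₁ a₂ hg₀ hy₀
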